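/- Setting. Let $M$ be a real smooth supermanifold of dimension $p|q$ that may depend on $N\ge 0$ auxiliary odd parameters $\eta^1,\dots,\eta^N$; the (odd) constants are the (odd) elements of the Grassmann algebra $\Lambda_N=\Lambda[\eta^1,\dots,\eta^N]$. In local coordinates $\Gamma^A$ of Grassmann parity $\varepsilon_A$ write $\partial_A$ for the left derivatives; repeated indices are summed. Let $\Delta$ be a Grassmann-odd second-order differential operator taking scalar functions to scalar functions. Its antibracket is $$(f,g)=(-1)^{\varepsilon_f}\Delta(fg)-(-1)^{\varepsilon_f}(\Delta f)g-f(\Delta g)+(-1)^{\varepsilon_g}fg(\Delta 1).$$ Put $E^{AB}=(\Gamma^A,\Gamma^B)$ and assume that $\Delta$ is non-degenerate: in every coordinate system the matrix $E^{AB}$ has an inverse $E_{AB}$. Put $\nu=\Delta 1$ and $\Delta_F=\Delta-\nu$. (1) In every coordinate system there are a unique graded-skewsymmetric $E^{AB}=-(-1)^{(\varepsilon_A+1)(\varepsilon_B+1)}E^{BA}$ of parity $\varepsilon_A+\varepsilon_B+1$, a unique $F_A$ of parity $\varepsilon_A$ (the line bundle connection) and a unique zeroth-order term, namely the odd function $\nu=\Delta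 1$, such that $\Delta=\Delta_F+\nu$ with $\Delta_F=\frac{(-1)^{\varepsilon_A}}{2}(\partial_A+F_A)E^{AB}\partial_B$; this $E^{AB}$ is $(\Gamma^A,\Gamma^B)$. (2) $\Delta^2=0$ if and only if the following three conditions hold: (i) the antibracket satisfies the Jacobi identity $\sum_{\mathrm{cycl.}\,f,g,h}(-1)^{(\varepsilon_f+1)(\varepsilon_h+1)}(f,(g,h))=0$; (ii) $F$ is flat, $\partial_AF_B-(-1)^{\varepsilon_A\varepsilon_B}\partial_BF_A=0$ in every coordinate system; (iii) $\Delta_F^2=(\nu,\cdot\,)$. (3) Condition (i) is equivalent to closedness of $E$, $\sum_{\mathrm{cycl.}\,A,B,C}(-1)^{\varepsilon_A\varepsilon_C}\partial_AE_{BC}=0$ in every coordinate system. In each coordinate system, flatness of $F$ is equivalent to the local existence of a density $\rho$ (even, with positive body) with $F_A=\partial_A\ln\rho$. For every such $\rho$ one has $\Delta_F=\Delta_\rho:=\frac{(-1)^{\varepsilon_A}}{2\rho}\partial_A\,\rho E^{AB}\partial_B$, $\rho$ has a square root that is a density, and for every such square root $$\nu_\rho:=\frac{1}{\sqrt\rho}(\Delta_1\sqrt\rho)+\frac{\nu^{(1)}}{8}-\frac{\nu^{(2)}}{24}\quad\text{equals}\quad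 \nu_F:=\frac{(-1)^{\varepsilon_A}}{4}\Big(\partial_A+\frac{F_A}{2}\Big)(E^{AB}F_B)+\frac{\nu^{(1)}}{8}-\frac{\nu^{(2)}}{24},$$ where $\Delta_1$ is $\Delta_\rho$ with $\rho$ replaced by $1$, $\nu^{(1)}=(-1)^{\varepsilon_A}\partial_B\partial_AE^{AB}$ and $\nu^{(2)}=(-1)^{\varepsilon_A\varepsilon_C}(\partial_DE^{AB})E_{BC}(\partial_AE^{CD})$. (4) Assume (i) and (ii). Then the equation $\Delta_F^2=(\nu',\cdot\,)$ for an odd function $\nu'$ is integrable. In every coordinate system, $\nu_F$ is odd, and $\nu'=\nu_F+c$ is a solution for every odd constant $c$. If the coordinate domain is connected, every odd solution is of this form. Every odd solution on a coordinate domain satisfies $\Delta_F\nu'=0$ and $$\nu'(\Gamma_1)=\nu'(\Gamma_0)+\int_{\Gamma_0}^{\Gamma_1}\big((\Delta_F^2\Gamma^A)E_{AB}\big)\,d\Gamma^B$$ along every smooth curve of superpoints from $\Gamma_0$ to $\Gamma_1$ in that domain. Every odd solution on all of $M$ satisfies $\Delta_F\nu'=0$, and if $M$ is connected, any two odd solutions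 on $M$ differ by an odd constant. (5) Consequently, if $\Delta^2=0$, then in every coordinate system with connected domain $\Delta=\Delta_F+\nu_F+c$ for some odd constant $c$; locally, where $F=\partial\ln\rho$, this is $\Delta=\Delta_\rho+\nu_\rho+c$. -/

import Mathlib

open TopologicalSpace
open scoped ContDiff TensorProduct

universe u

noncomputable section

namespace BV

/-! ### Smooth functions on an open subset of `ℝ^p` -/

/-- Extension by zero of a function on an open subset of `ℝ^p`. -/
def ext0 {p : ℕ} {U : Opens (Fin p → ℝ)} (f : U → ℝ) : (Fin p → ℝ) → ℝ :=
  Function.extend Subtype.val f 0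

theorem ext0_apply {p : ℕ} {U : Opens (Fin p → ℝ)} (f : U → ℝ) {x : Fin p → ℝ} (hx : x ∈ U) :
    ext0 f x = f ⟨x, hx⟩ :=
  Subtype.val_injective.extend_apply f 0 ⟨x, hx⟩

theorem ext0_apply_of_notMem {p : ℕ} {U : Opens (Fin p → ℝ)} (f : U → ℝ) {x : Fin p → ℝ}
    (hx : x ∉ U) : ext0 f x = 0 :=
  Function.extend_apply' f (0 : (Fin p → ℝ) → ℝ) x fun ⟨y, hy⟩ => hx (hy ▸ y.2)

/-- The algebra `C^∞(U)` of real smooth functions on an open set `U ⊆ ℝ^p`. -/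
def SmoothFn {p : ℕ} (U : Opens (Fin p → ℝ)) : Subalgebra ℝ (U → ℝ) where
  carrier := {f | ContDiffOn ℝ ∞ (ext0 f) U}
  mul_mem' {f g} hf hg := (ContDiffOn.mul hf hg).congr fun x hx => by
    simp [ext0_apply _ hx]
  add_mem' {f g} hf hg := (ContDiffOn.add hf hg).congr fun x hx => by
    simp [ext0_apply _ hx]
  algebraMap_mem' r := (contDiffOn_const (c := r)).congr fun x hx => by
    simp [ext0_apply _ hx]

theorem smoothFn_pd_mem {p : ℕ} {U : Opens (Fin p → ℝ)} (i : Fin p) (f : SmoothFn U) :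
    (fun x : U => fderiv ℝ (ext0 f.1) x (Pi.single i 1)) ∈ SmoothFn U := by
  have h : ContDiffOn ℝ ∞ (ext0 f.1) U := f.2
  have h1 : ContDiffOn ℝ ∞ (fun x => fderiv ℝ (ext0 f.1) x (Pi.single i 1)) U :=
    (h.fderiv_of_isOpen U.isOpen (by simp)).clm_apply contDiffOn_const
  exact h1.congr fun x hx => by simp [ext0_apply _ hx]

theorem ext0_differentiableAt {p : ℕ} {U : Opens (Fin p → ℝ)} (f : SmoothFn U) (x : U) :
    DifferentiableAt ℝ (ext0 f.1) x :=
  ((show ContDiffOn ℝ ∞ (ext0 f.1) U from f.2).differentiableOn (by simp)).differentiableAt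
    (U.isOpen.mem_nhds x.2)

/-- The partial derivative `∂/∂x^i` on `C^∞(U)`. -/
def smoothPd {p : ℕ} (U : Opens (Fin p → ℝ)) (i : Fin p) : SmoothFn U →ₗ[ℝ] SmoothFn U where
  toFun f := ⟨fun x => fderiv ℝ (ext0 f.1) x (Pi.single i 1), smoothFn_pd_mem i f⟩
  map_add' f g := by
    ext x
    have e : ext0 (f + g).1 = ext0 f.1 + ext0 g.1 := by
      funext y
      by_cases hy : y ∈ U
      · simp [ext0_apply _ hy]
      · simp [ext0_apply_of_notMem _ hy]
    simp only [e]
    rw [fderiv_add (ext0_differentiableAt f x) (ext0_differentiableAt g x)]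
    rfl
  map_smul' c f := by
    ext x
    have e : ext0 (c • f).1 = c • ext0 f.1 := by
      funext y
      by_cases hy : y ∈ U
      · simp [ext0_apply _ hy]
      · simp [ext0_apply_of_notMem _ hy]
    simp only [e]
    rw [fderiv_const_smul (ext0_differentiableAt f x)]
    rfl

/-- The coordinate function `x^i`. -/
def smoothCoord {p : ℕ} (U : Opens (Fin p → ℝ)) (i : Fin p) : SmoothFn U :=
  ⟨fun x => x.1 i, ((contDiff_apply ℝ ℝ i).contDiffOn).congr fun x hx => by
    simp [ext0_apply _ hx]⟩

/-- Restriction `C^∞(U) → C^∞(V)` for `V ⊆ U`. -/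
def smoothRes {p : ℕ} {V U : Opens (Fin p → ℝ)} (h : V ≤ U) : SmoothFn U →ₐ[ℝ] SmoothFn V where
  toFun f := ⟨fun x => f.1 ⟨x.1, h x.2⟩,
    (ContDiffOn.mono (show ContDiffOn ℝ ∞ (ext0 f.1) U from f.2) h).congr fun x hx => by
      simp [ext0_apply _ hx, ext0_apply _ (h hx)]⟩
  map_one' := rfl
  map_mul' _ _ := rfl
  map_zero' := rfl
  map_add' _ _ := rfl
  commutes' _ := rfl

/-- Evaluation at a point. -/
def smoothEval {p : ℕ} (U : Opens (Fin p → ℝ)) (x : U) : SmoothFn U →ₗ[ℝ] ℝ where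
  toFun f := f.1 x
  map_add' _ _ := rfl
  map_smul' _ _ := rfl

/-! ### Superdomains -/

/-- The Grassmann algebra generated by `N` odd parameters: the ring of constants. -/
abbrev Grass (N : ℕ) : Type := ExteriorAlgebra ℝ (Fin N → ℝ)

/-- The parity automorphism of the Grassmann algebra: `c ↦ (-1)^{ε(c)} c`. -/
abbrev grassParity (N : ℕ) : Grass N →ₐ[ℝ] Grass N :=
  CliffordAlgebra.involute (Q := (0 : QuadraticForm ℝ (Fin N → ℝ)))

/-- Functions on the superdomain over `U ⊆ ℝ^p` with odd coordinates `θ^1, …, θ^q`, with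
coefficients in the Grassmann algebra of `N` odd parameters:
`C^∞(U) ⊗ Λ[θ^1, …, θ^q, η^1, …, η^N]`. -/
def SFun {p : ℕ} (q N : ℕ) (U : Opens (Fin p → ℝ)) : Type :=
  SmoothFn U ⊗[ℝ] ExteriorAlgebra ℝ (Fin q ⊕ Fin N → ℝ)

instance {p q N : ℕ} {U : Opens (Fin p → ℝ)} : Ring (SFun q N U) :=
  inferInstanceAs (Ring (SmoothFn U ⊗[ℝ] ExteriorAlgebra ℝ (Fin q ⊕ Fin N → ℝ)))

instance {p q N : ℕ} {U : Opens (Fin p → ℝ)} : Algebra ℝ (SFun q N U) :=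
  inferInstanceAs (Algebra ℝ (SmoothFn U ⊗[ℝ] ExteriorAlgebra ℝ (Fin q ⊕ Fin N → ℝ)))

/-- Coordinate labels: `p` even ones and `q` odd ones. -/
abbrev Idx (p q : ℕ) : Type := Fin p ⊕ Fin q

/-- The Grassmann parity `ε_A` of the coordinate `Γ^A`. -/
def ε {p q : ℕ} : Idx p q → ℕ
  | Sum.inl _ => 0
  | Sum.inr _ => 1

/-- The sign `(-1)^n`. -/
def sg (n : ℕ) : ℝ := (-1) ^ n

/-- An element is homogeneous of Grassmann parity `n` (mod 2), with respect to the parity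
automorphism `σ`. -/
def HasParity {R : Type*} [Ring R] [Algebra ℝ R] (σ : R →ₐ[ℝ] R) (n : ℕ) (f : R) : Prop :=
  σ f = sg n • f

/-- The antibracket generated by an operator `D`. For homogeneous `f`, `g` this is
`(f,g) = (-1)^{ε_f} D(fg) - (-1)^{ε_f} (Df) g - f (Dg) + (-1)^{ε_g} f g (D1)`. -/
def antibracket {R : Type*} [Ring R] [Algebra ℝ R] (σ : R →ₐ[ℝ] R) (D : R →ₗ[ℝ] R) (f g : R) : R :=
  D (σ f * g) - D (σ f) * g - f * D g + f * σ g * D 1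

section Superdomain

variable {p q N : ℕ} {U V : Opens (Fin p → ℝ)}

/-- The parity automorphism of the functions on a superdomain: `f ↦ (-1)^{ε(f)} f`. -/
def parity : SFun q N U →ₐ[ℝ] SFun q N U :=
  Algebra.TensorProduct.map (AlgHom.id ℝ (SmoothFn U))
    (CliffordAlgebra.involute (Q := (0 : QuadraticForm ℝ (Fin q ⊕ Fin N → ℝ))))

/-- Restriction of superfunctions. -/
def sres (h : V ≤ U) : SFun q N U →ₐ[ℝ] SFun q N V :=
  Algebra.TensorProduct.map (smoothRes h) (AlgHom.id ℝ _)

/-- The constants: the inclusion of the Grassmann algebra of odd parameters. -/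
def sconst : Grass N →ₐ[ℝ] SFun q N U :=
  Algebra.TensorProduct.includeRight.comp
    (ExteriorAlgebra.map (Function.ExtendByZero.linearMap ℝ (Sum.inr : Fin N → Fin q ⊕ Fin N)))

/-- The body of a superfunction: all odd generators are set to zero. -/
def body : SFun q N U →ₐ[ℝ] SmoothFn U :=
  (Algebra.TensorProduct.rid ℝ ℝ (SmoothFn U)).toAlgHom.comp
    (Algebra.TensorProduct.map (AlgHom.id ℝ (SmoothFn U)) ExteriorAlgebra.algebraMapInv)

/-- The coordinate functions `Γ^A`. -/
def coord : Idx p q → SFun q N U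
  | Sum.inl i => smoothCoord U i ⊗ₜ 1
  | Sum.inr a => 1 ⊗ₜ ExteriorAlgebra.ι ℝ (Pi.single (Sum.inl a) 1)

/-- The left partial derivatives `∂_A = ∂/∂Γ^A`. -/
def pd : Idx p q → SFun q N U →ₗ[ℝ] SFun q N U
  | Sum.inl i => LinearMap.rTensor _ (smoothPd U i)
  | Sum.inr a => LinearMap.lTensor _
      (CliffordAlgebra.contractLeft (Q := (0 : QuadraticForm ℝ (Fin q ⊕ Fin N → ℝ)))
        (LinearMap.proj (Sum.inl a)))

/-- The value at a point of the underlying domain, in the Grassmann algebra of all odd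
generators. -/
def evalAt (x : U) : SFun q N U →ₗ[ℝ] ExteriorAlgebra ℝ (Fin q ⊕ Fin N → ℝ) :=
  (TensorProduct.lid ℝ _).toLinearMap ∘ₗ LinearMap.rTensor _ (smoothEval U x)

/-! #### The operators `Δ_F` and `Δ_ρ` and the function `ν_F` -/

/-- `Δ_F f = ½ (-1)^{ε_A} (∂_A + F_A) E^{AB} ∂_B f`. -/
def lap (E : Matrix (Idx p q) (Idx p q) (SFun q N U)) (F : Idx p q → SFun q N U) :
    SFun q N U →ₗ[ℝ] SFun q N U :=
  ∑ A, ∑ B, (sg (ε A) / 2) •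
    ((pd A + LinearMap.mulLeft ℝ (F A)) ∘ₗ LinearMap.mulLeft ℝ (E A B) ∘ₗ pd B)

/-- `Δ_ρ f = (-1)^{ε_A} / (2ρ) ∂_A (ρ E^{AB} ∂_B f)`. -/
def lapRho (E : Matrix (Idx p q) (Idx p q) (SFun q N U)) (ρ : SFun q N U) :
    SFun q N U →ₗ[ℝ] SFun q N U :=
  ∑ A, ∑ B, (sg (ε A) / 2) •
    (LinearMap.mulLeft ℝ (Ring.inverse ρ) ∘ₗ pd A ∘ₗ LinearMap.mulLeft ℝ (ρ * E A B) ∘ₗ pd B)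

/-- A (measure) density: an even function with positive body (hence invertible). -/
def IsDensity (ρ : SFun q N U) : Prop :=
  HasParity parity 0 ρ ∧ ∀ x : U, 0 < (body ρ).1 x

/-- `F_A = ∂_A ln ρ`, that is, `F_A = ρ⁻¹ ∂_A ρ`. -/
def IsDLog (F : Idx p q → SFun q N U) (ρ : SFun q N U) : Prop :=
  ∀ A, F A = Ring.inverse ρ * pd A ρ

/-- The matrix `E_{AB}` inverse to `E^{AB}`. -/
def lower (E : Matrix (Idx p q) (Idx p q) (SFun q N U)) : Matrix (Idx p q) (Idx p q) (SFun q N U) :=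
  Ring.inverse E

/-- `ν_F^{(0)} = ¼ (-1)^{ε_A} (∂_A + ½ F_A)(E^{AB} F_B)`. -/
def nuF0 (E : Matrix (Idx p q) (Idx p q) (SFun q N U)) (F : Idx p q → SFun q N U) : SFun q N U :=
  ∑ A, ∑ B, (sg (ε A) / 4) • (pd A (E A B * F B) + (1 / 2 : ℝ) • (F A * (E A B * F B)))

/-- `ν_ρ^{(0)} = (1/√ρ) (Δ_1 √ρ)`, as a function of `r = √ρ`. -/
def nuRho0 (E : Matrix (Idx p q) (Idx p q) (SFun q N U)) (r : SFun q N U) : SFun q N U :=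
  Ring.inverse r * lapRho E 1 r

/-- `ν^{(1)} = (-1)^{ε_A} (∂_B ∂_A E^{AB})`. -/
def nu1 (E : Matrix (Idx p q) (Idx p q) (SFun q N U)) : SFun q N U :=
  ∑ A, ∑ B, sg (ε A) • pd B (pd A (E A B))

/-- `ν^{(2)} = (-1)^{ε_A ε_C} (∂_D E^{AB}) E_{BC} (∂_A E^{CD})`. -/
def nu2 (E : Matrix (Idx p q) (Idx p q) (SFun q N U)) : SFun q N U :=
  ∑ A, ∑ B, ∑ C, ∑ D, sg (ε A * ε C) • (pd D (E A B) * lower E B C * pd A (E C D))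

/-- `ν_F = ν_F^{(0)} + ν^{(1)}/8 - ν^{(2)}/24`. -/
def nuF (E : Matrix (Idx p q) (Idx p q) (SFun q N U)) (F : Idx p q → SFun q N U) : SFun q N U :=
  nuF0 E F + (1 / 8 : ℝ) • nu1 E - (1 / 24 : ℝ) • nu2 E

/-- `ν_ρ = ν_ρ^{(0)} + ν^{(1)}/8 - ν^{(2)}/24`, as a function of `r = √ρ`. -/
def nuRho (E : Matrix (Idx p q) (Idx p q) (SFun q N U)) (r : SFun q N U) : SFun q N U :=
  nuRho0 E r + (1 / 8 : ℝ) • nu1 E - (1 / 24 : ℝ) • nu2 E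

/-- `E^{AB}` has Grassmann parity `ε_A + ε_B + 1` and the graded skewsymmetry
`E^{AB} = -(-1)^{(ε_A+1)(ε_B+1)} E^{BA}`. -/
def IsOddSkew (E : Matrix (Idx p q) (Idx p q) (SFun q N U)) : Prop :=
  (∀ A B, HasParity parity (ε A + ε B + 1) (E A B)) ∧
    ∀ A B, E A B = -(sg ((ε A + 1) * (ε B + 1)) • E B A)

/-- `F_A` has Grassmann parity `ε_A`. -/
def IsConnParity (F : Idx p q → SFun q N U) : Prop :=
  ∀ A, HasParity parity (ε A) (F A)

/-- The closedness relation `dE = 0` for the two-form `E = ½ dΓ^A E_{AB} ∧ dΓ^B`: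
the cyclic sum of `(-1)^{ε_A ε_C} ∂_A E_{BC}` vanishes. -/
def IsClosedForm (Elow : Matrix (Idx p q) (Idx p q) (SFun q N U)) : Prop :=
  ∀ A B C, sg (ε A * ε C) • pd A (Elow B C) + sg (ε B * ε A) • pd B (Elow C A)
    + sg (ε C * ε B) • pd C (Elow A B) = 0

/-- Vanishing of the curvature `R_{AB} = ∂_A F_B - (-1)^{ε_A ε_B} ∂_B F_A`. -/
def IsFlatConn (F : Idx p q → SFun q N U) : Prop :=
  ∀ A B, pd A (F B) - sg (ε A * ε B) • pd B (F A) = 0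

/-! #### The data carried by an operator on a superdomain -/

/-- `D` is a differential operator of order at most two. -/
def IsSecondOrderOp (D : SFun q N U →ₗ[ℝ] SFun q N U) : Prop :=
  ∃ (a : Idx p q → Idx p q → SFun q N U) (b : Idx p q → SFun q N U) (c : SFun q N U),
    ∀ f, D f = (∑ A, ∑ B, a A B * pd A (pd B f)) + (∑ A, b A * pd A f) + c * f

/-- The components `E^{AB} = (Γ^A, Γ^B)` of the antibracket of `D`. -/
def opE (D : SFun q N U →ₗ[ℝ] SFun q N U) : Matrix (Idx p q) (Idx p q) (SFun q N U) :=
  Matrix.of fun A B => antibracket parity D (coord A) (coord B)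

/-- The connection components `F_A` of `D`: they are obtained by solving
`(D - D1) Γ^B = ½ (-1)^{ε_A} (∂_A + F_A) E^{AB}` for `F_A`. -/
def opF (D : SFun q N U →ₗ[ℝ] SFun q N U) (C : Idx p q) : SFun q N U :=
  sg (ε C) • ∑ B, ((2 : ℝ) • (D (coord B) - D 1 * coord B)
    - ∑ A, sg (ε A) • pd A (opE D A B)) * lower (opE D) B C

end Superdomain

/-! ### Curves in a superdomain and contour integrals -/

/-- The line `ℝ`, as an open subset of `ℝ^1`. -/
abbrev line : Opens (Fin 1 → ℝ) := ⊤

/-- The number `t` as a point of the line. -/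
def linePt (t : ℝ) : line := ⟨fun _ => t, trivial⟩

theorem continuous_line (f : SmoothFn line) : Continuous fun t : ℝ => f.1 (linePt t) := by
  have h : ContDiffOn ℝ ∞ (ext0 f.1) (line : Opens (Fin 1 → ℝ)) := f.2
  have h1 : Continuous (ext0 f.1) := by
    rw [← continuousOn_univ]; simpa using h.continuousOn
  have h2 : (fun t : ℝ => f.1 (linePt t)) = fun t => ext0 f.1 (fun _ => t) := by
    funext t
    exact (ext0_apply f.1 (x := fun _ => t) trivial).symm
  rw [h2]
  exact h1.comp (continuous_pi fun _ => continuous_id)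

/-- `f ↦ ∫₀¹ f(t) dt`. -/
def smoothInt : SmoothFn line →ₗ[ℝ] ℝ where
  toFun f := ∫ t in (0 : ℝ)..1, f.1 (linePt t)
  map_add' f g := intervalIntegral.integral_add
    ((continuous_line f).intervalIntegrable _ _) ((continuous_line g).intervalIntegrable _ _)
  map_smul' c _ := intervalIntegral.integral_smul c _

/-- The integral `∫₀¹ dt` of Grassmann-algebra valued functions on the line. -/
def lineInt {K : ℕ} : SFun 0 K line →ₗ[ℝ] ExteriorAlgebra ℝ (Fin 0 ⊕ Fin K → ℝ) :=
  (TensorProduct.lid ℝ _).toLinearMap ∘ₗ LinearMap.rTensor _ smoothInt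

/-- A smooth curve `t ↦ Γ(t)` of superpoints in a superdomain, with values in the Grassmann
algebra of `K` odd parameters. It is given by the pullback `f ↦ f(Γ(t))`, a morphism of
superalgebras over a morphism of the Grassmann algebras of constants. -/
structure SuperCurve {p : ℕ} (q N : ℕ) (U : Opens (Fin p → ℝ)) (K : ℕ) where
  pull : SFun q N U →ₐ[ℝ] SFun 0 K line
  base : Grass N →ₐ[ℝ] Grass K
  base_parity : ∀ c, base (grassParity N c) = grassParity K (base c)
  pull_parity : ∀ f, pull (parity f) = parity (pull f)
  pull_const : ∀ c, pull (sconst c) = sconst (base c)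

/-- The contour integral `∫ ξ_B dΓ^B` along a curve. -/
def SuperCurve.integral {p q N K : ℕ} {U : Opens (Fin p → ℝ)} (γ : SuperCurve q N U K)
    (ξ : Idx p q → SFun q N U) : ExteriorAlgebra ℝ (Fin 0 ⊕ Fin K → ℝ) :=
  lineInt (∑ B, γ.pull (ξ B) * pd (Sum.inl 0) (γ.pull (coord B)))

/-- The value `f(Γ(t))` of a function at a point of a curve. -/
def SuperCurve.value {p q N K : ℕ} {U : Opens (Fin p → ℝ)} (γ : SuperCurve q N U K) (t : ℝ)
    (f : SFun q N U) : ExteriorAlgebra ℝ (Fin 0 ⊕ Fin K → ℝ) :=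
  evalAt (linePt t) (γ.pull f)

/-! ### Supermanifolds -/

/-- A topological space with a sheaf of real superalgebras (the grading being encoded by its
parity automorphism) that contain the Grassmann algebra of `N` odd parameters. -/
structure SuperSpace (N : ℕ) where
  X : TopCat.{u}
  sheaf : TopCat.Sheaf (AlgCat.{u} ℝ) X
  par : ∀ W : Opens X, sheaf.1.obj (Opposite.op W) →ₐ[ℝ] sheaf.1.obj (Opposite.op W)
  const : ∀ W : Opens X, Grass N →ₐ[ℝ] sheaf.1.obj (Opposite.op W)
  res_par : ∀ {V W : Opens X} (h : V ≤ W) (f : sheaf.1.obj (Opposite.op W)),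
    (sheaf.1.map (CategoryTheory.homOfLE h).op).hom (par W f) = par V ((sheaf.1.map (CategoryTheory.homOfLE h).op).hom f)
  res_const : ∀ {V W : Opens X} (h : V ≤ W) (c : Grass N),
    (sheaf.1.map (CategoryTheory.homOfLE h).op).hom (const W c) = const V c

namespace SuperSpace

variable {N : ℕ} (M : SuperSpace.{u} N)

/-- The algebra of scalar functions on an open set. -/
abbrev Fn (W : Opens M.X) : Type u := M.sheaf.1.obj (Opposite.op W)

/-- Restriction of functions. -/
def res {V W : Opens M.X} (h : V ≤ W) : M.Fn W →ₐ[ℝ] M.Fn V :=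
  (M.sheaf.1.map (CategoryTheory.homOfLE h).op).hom

/-- The image in a space of an open set `V ⊆ ℝ^p` under an open embedding of `U ⊆ ℝ^p`. -/
def openImage {X : TopCat.{u}} {p : ℕ} {U : Opens (Fin p → ℝ)} {φ : U → X}
    (h : Topology.IsOpenEmbedding φ) (V : Opens (Fin p → ℝ)) : Opens X :=
  ⟨φ '' (Subtype.val ⁻¹' (V : Set (Fin p → ℝ))),
    h.isOpenMap _ (V.isOpen.preimage continuous_subtype_val)⟩

theorem openImage_mono {X : TopCat.{u}} {p : ℕ} {U V W : Opens (Fin p → ℝ)} {φ : U → X}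
    (h : Topology.IsOpenEmbedding φ) (hVW : V ≤ W) : openImage h V ≤ openImage h W :=
  Set.image_mono (Set.preimage_mono hVW)

/-- A local coordinate system with `p` even and `q` odd coordinates: an isomorphism, over the
parameters, of an open part of the space with the superdomain over an open `tgt ⊆ ℝ^p`. -/
structure Chart (p q : ℕ) where
  tgt : Opens (Fin p → ℝ)
  toX : tgt → M.X
  emb : Topology.IsOpenEmbedding toX
  iso : ∀ V, V ≤ tgt → M.Fn (openImage emb V) ≃ₐ[ℝ] SFun q N V
  iso_res : ∀ {V W} (h : V ≤ W) (hW : W ≤ tgt) (f : M.Fn (openImage emb W)),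
    iso V (h.trans hW) (M.res (openImage_mono emb h) f) = sres h (iso W hW f)
  iso_par : ∀ V (hV : V ≤ tgt) (f : M.Fn (openImage emb V)), iso V hV (M.par _ f) = parity (iso V hV f)
  iso_const : ∀ V (hV : V ≤ tgt) (c : Grass N), iso V hV (M.const _ c) = sconst c

/-- A linear operator that takes scalar functions to scalar functions, compatibly with
restriction. -/
structure Operator where
  app : ∀ W : Opens M.X, M.Fn W →ₗ[ℝ] M.Fn W
  app_res : ∀ {V W : Opens M.X} (h : V ≤ W) (f : M.Fn W),
    M.res h (app W f) = app V (M.res h f)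

end SuperSpace

/-- A real smooth supermanifold of dimension `p|q`, depending on `N` odd parameters. -/
structure SuperManifold (p q N : ℕ) extends SuperSpace.{u} N where
  t2 : T2Space X
  secondCountable : SecondCountableTopology X
  exists_chart : ∀ x : X, ∃ κ : toSuperSpace.Chart p q, x ∈ Set.range κ.toX

namespace SuperManifold

variable {p q N : ℕ} (M : SuperManifold.{u} p q N)

abbrev Chart : Type u := M.toSuperSpace.Chart p q

abbrev Operator : Type u := M.toSuperSpace.Operator

variable {M}

/-- The expression of an operator in a coordinate system. -/
def Operator.inChart (Δ : M.Operator) (κ : M.Chart) : SFun q N κ.tgt →ₗ[ℝ] SFun q N κ.tgt :=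
  (κ.iso κ.tgt le_rfl).toLinearMap ∘ₗ Δ.app (SuperSpace.openImage κ.emb κ.tgt) ∘ₗ
    (κ.iso κ.tgt le_rfl).symm.toLinearMap

/-- The components `E^{AB}` of `Δ` in a coordinate system. -/
def Operator.E (Δ : M.Operator) (κ : M.Chart) :
    Matrix (Idx p q) (Idx p q) (SFun q N κ.tgt) := opE (Δ.inChart κ)

/-- The components `F_A` of `Δ` in a coordinate system. -/
def Operator.F (Δ : M.Operator) (κ : M.Chart) : Idx p q → SFun q N κ.tgt :=
  opF (Δ.inChart κ)

/-- The zeroth-order term `ν = Δ1`. -/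
def Operator.nu (Δ : M.Operator) (W : Opens M.X) : M.Fn W := Δ.app W 1

/-- The part `Δ_F = Δ - ν` of `Δ` without zeroth-order term. -/
def Operator.lapF (Δ : M.Operator) (W : Opens M.X) : M.Fn W →ₗ[ℝ] M.Fn W :=
  Δ.app W - LinearMap.mulLeft ℝ (Δ.nu W)

/-- The antibracket generated by `Δ`. -/
def Operator.bracket (Δ : M.Operator) {W : Opens M.X} (f g : M.Fn W) : M.Fn W :=
  antibracket (M.par W) (Δ.app W) f g

/-- `Δ` is Grassmann-odd. -/
def Operator.IsOdd (Δ : M.Operator) : Prop :=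
  ∀ (W : Opens M.X) (f : M.Fn W), M.par W (Δ.app W f) = -Δ.app W (M.par W f)

/-- `Δ` is a second-order differential operator. -/
def Operator.IsSecondOrder (Δ : M.Operator) : Prop :=
  ∀ κ : M.Chart, IsSecondOrderOp (Δ.inChart κ)

/-- The second-order term of `Δ` is of maximal rank: the matrix `E^{AB}` is invertible in every
coordinate system. -/
def Operator.IsNondegenerate (Δ : M.Operator) : Prop :=
  ∀ κ : M.Chart, IsUnit (Δ.E κ)

/-- `Δ² = 0`. -/
def Operator.IsNilpotent (Δ : M.Operator) : Prop :=
  ∀ (W : Opens M.X) (f : M.Fn W), Δ.app W (Δ.app W f) = 0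

/-- The Jacobi identity for the antibracket: for homogeneous `f, g, h` the cyclic sum of
`(-1)^{(ε_f+1)(ε_h+1)} (f,(g,h))` vanishes. -/
def Operator.Jacobi (Δ : M.Operator) : Prop :=
  ∀ (W : Opens M.X) (a b c : ℕ) (f g h : M.Fn W),
    HasParity (M.par W) a f → HasParity (M.par W) b g → HasParity (M.par W) c h →
      sg ((a + 1) * (c + 1)) • Δ.bracket f (Δ.bracket g h)
        + sg ((b + 1) * (a + 1)) • Δ.bracket g (Δ.bracket h f)
        + sg ((c + 1) * (b + 1)) • Δ.bracket h (Δ.bracket f g) = 0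

/-- The two-form with components `E_{AB}` is closed. -/
def Operator.EClosed (Δ : M.Operator) : Prop :=
  ∀ κ : M.Chart, IsClosedForm (lower (Δ.E κ))

/-- The line bundle connection `F` has vanishing curvature. -/
def Operator.FFlat (Δ : M.Operator) : Prop :=
  ∀ κ : M.Chart, IsFlatConn (Δ.F κ)

/-- The equation `Δ_F² = (ν, ·)` for a scalar function `ν`. -/
def Operator.NuEq (Δ : M.Operator) (ν : M.Fn ⊤) : Prop :=
  ∀ (W : Opens M.X) (f : M.Fn W),
    Δ.lapF W (Δ.lapF W f) = Δ.bracket (M.res le_top ν) f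

end SuperManifold

end BV

end

/-!
Everything reduces to identities on a superdomain, in the coordinates of one chart. There `Δ` is
`Δ_F + ν` (`IsOddOp.eq_lap_add`): both sides are differential operators of second order that agree
on `1`, on the coordinates `Γ^A`, and on the products `Γ^A Γ^B`, where the components `E^{AB}` and
`F_A` are chosen to make them agree. The antibracket of `Δ` is then
`(f, g) = (f ∂⃖_A) E^{AB} (∂_B g)` (`antibracket_eq_br`), for which the Jacobi identity only has to
be checked on coordinates (`IsOddSkew.jacobiBr_iff`), where it is the closedness of `E_{AB}` with its
indices raised (`IsOddSkew.jacobiCoord_iff`).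

For an odd function `ν`, `(Δ_F + ν)² = Δ_F² - (ν, ·) + (Δ_F ν)`. If this vanishes, then its value on
`1` is `Δ_F ν = 0`, so `Δ_F² = (ν, ·)` is a derivation of the product. Since the antibracket is the
failure of `Δ_F` to be a derivation of the product, `Δ_F` is then a derivation of the antibracket
(`IsOddSkew.lap_br_of_lap_sq`). This property on products gives the Jacobi identity
(`IsOddSkew.jacobiBr_of_lap_br`); on pairs of coordinates, compared with the same property of the
operator `Δ₁` without connection, it gives the flatness of `F` (`IsOddSkew.isFlatConn_of_lap_br`).

The main computation is the converse, and it has two steps. Let the Jacobi identity hold.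

* `Δ₁² = (ν^{(1)}/8 - ν^{(2)}/24, ·)` (`IsOddSkew.lap_zero_sq`). Both sides are derivations, so this
  is an identity on coordinates. Commuting `Δ₁` with derivatives turns `4 Δ₁ (2 Δ₁ Γ^C)` into
  `(ν^{(1)}, Γ^C)` minus a sum `quadY` that is quadratic in `E` (`IsOddSkew.lap_divE`), and repeated
  use of the Jacobi identity shows `(Γ^C, ν^{(2)})` to be `-3` times the same sum
  (`IsOddSkew.br_coord_nu2_eq`). Moreover `Δ₁ (ν^{(1)}/8 - ν^{(2)}/24) = 0`, because this is a triple
  divergence of the Jacobi identity (`IsOddSkew.lap_nuC`).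
* If `F = ∂ ln ρ`, then `√ρ (Δ_F + ν_F^{(0)}) = Δ₁ √ρ` as operators (`mul_lap_add`), so the conjugate
  of `Δ_F + ν_F` by `√ρ` is `Δ₁ + ν^{(1)}/8 - ν^{(2)}/24`, whose square vanishes by the first step.
  Hence `Δ_F² = (ν_F, ·)` and `Δ_F ν_F = 0`.

A flat `F` is locally `∂ ln ρ`: the Poincaré lemma (`IsFlatConn.exists_pd_eq`) gives a potential, and
the exponential of an even superfunction exists, since it is a smooth function plus a nilpotent.
The two identities for `ν_F` do not mention `ρ`, so they hold wherever `F` is flat (`lap_sq_eq`,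
`lap_nuF_eq_zero`). As the antibracket is non-degenerate, two solutions of `Δ_F² = (ν, ·)` have the
same derivatives, and a function with vanishing derivatives on a connected domain is a constant
(`exists_eq_sconst`). The contour integral is the fundamental theorem of calculus together with the
chain rule along a curve of superpoints (`SuperCurve.pd_pull`).

Several of these arguments need that a derivation is determined by its values on coordinates and
constants, also when it is a derivation along a homomorphism of superalgebras that is not assumed to
be continuous (`derivation_eq_zero`). This follows from Hadamard's lemma, and from the fact that
every real character of `C^∞(U)` is the evaluation at a point.

On the supermanifold, charts with connected domain form a basis of the topology
(`SuperManifold.exists_chart_le`), and the sheaf property reduces identities between functions to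
charts (`SuperManifold.fn_ext`).
-/

noncomputable section

namespace BV

/-! ### The exterior algebra as a supercommutative algebra -/

section Exterior

variable {W : Type*} [AddCommGroup W] [Module ℝ W]

/-- The parity automorphism of an exterior algebra. -/
abbrev invol : ExteriorAlgebra ℝ W →ₐ[ℝ] ExteriorAlgebra ℝ W :=
  CliffordAlgebra.involute (Q := (0 : QuadraticForm ℝ W))

/-- Contraction of an exterior algebra with a linear form, a left antiderivation. -/
abbrev contr (d : Module.Dual ℝ W) : ExteriorAlgebra ℝ W →ₗ[ℝ] ExteriorAlgebra ℝ W :=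
  CliffordAlgebra.contractLeft (Q := (0 : QuadraticForm ℝ W)) d

theorem exterior_left_induction {P : ExteriorAlgebra ℝ W → Prop}
    (alg : ∀ r : ℝ, P (algebraMap ℝ _ r)) (add : ∀ x y, P x → P y → P (x + y))
    (mul : ∀ x v, P x → P (ExteriorAlgebra.ι ℝ v * x)) (x : ExteriorAlgebra ℝ W) : P x :=
  CliffordAlgebra.left_induction (Q := (0 : QuadraticForm ℝ W)) alg add mul x

theorem invol_ι (v : W) :
    invol (ExteriorAlgebra.ι ℝ v) = -ExteriorAlgebra.ι ℝ v :=
  CliffordAlgebra.involute_ι (Q := (0 : QuadraticForm ℝ W)) v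

theorem invol_invol (x : ExteriorAlgebra ℝ W) : invol (invol x) = x :=
  CliffordAlgebra.involute_involute (Q := (0 : QuadraticForm ℝ W)) x

theorem contr_ι_mul (d : Module.Dual ℝ W) (v : W) (x : ExteriorAlgebra ℝ W) :
    contr d (ExteriorAlgebra.ι ℝ v * x) = d v • x - ExteriorAlgebra.ι ℝ v * contr d x :=
  CliffordAlgebra.contractLeft_ι_mul (Q := (0 : QuadraticForm ℝ W)) (d := d) v x

theorem contr_ι (d : Module.Dual ℝ W) (v : W) :
    contr d (ExteriorAlgebra.ι ℝ v) = algebraMap ℝ _ (d v) :=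
  CliffordAlgebra.contractLeft_ι (Q := (0 : QuadraticForm ℝ W)) (d := d) v

theorem contr_algebraMap (d : Module.Dual ℝ W) (r : ℝ) :
    contr d (algebraMap ℝ (ExteriorAlgebra ℝ W) r) = 0 :=
  CliffordAlgebra.contractLeft_algebraMap (Q := (0 : QuadraticForm ℝ W)) (d := d) r

theorem contr_comm (d d' : Module.Dual ℝ W) (x : ExteriorAlgebra ℝ W) :
    contr d (contr d' x) = -contr d' (contr d x) :=
  CliffordAlgebra.contractLeft_comm (Q := (0 : QuadraticForm ℝ W)) (d := d) (d' := d') x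

theorem ι_mul_swap (v w : W) : ExteriorAlgebra.ι ℝ v * ExteriorAlgebra.ι ℝ w =
    -(ExteriorAlgebra.ι ℝ w * ExteriorAlgebra.ι ℝ v) :=
  eq_neg_of_add_eq_zero_left (ExteriorAlgebra.ι_add_mul_swap v w)

theorem ι_mul_eq (v : W) (b : ExteriorAlgebra ℝ W) :
    ExteriorAlgebra.ι ℝ v * b = invol b * ExteriorAlgebra.ι ℝ v := by
  induction b using exterior_left_induction with
  | alg r => rw [AlgHom.commutes, Algebra.commutes]
  | add x y hx hy => simp [mul_add, add_mul, hx, hy]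
  | mul x w hx =>
    rw [← mul_assoc, ι_mul_swap, neg_mul, mul_assoc, hx, map_mul, invol_ι, neg_mul, neg_mul,
      mul_assoc]

/-- Supercommutativity, stated for inhomogeneous elements: `a + ā` is twice the even part of `a`
and `a - ā` twice the odd part. -/
theorem exterior_supercomm (a b : ExteriorAlgebra ℝ W) :
    (2 : ℝ) • (a * b) = b * (a + invol a) + invol b * (a - invol a) := by
  induction a using exterior_left_induction generalizing b with
  | alg r =>
    rw [AlgHom.commutes, sub_self, mul_zero, add_zero, mul_add, ← two_smul ℝ,
      Algebra.commutes]
  | add x y hx hy =>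
    rw [add_mul, smul_add, hx, hy, map_add]; noncomm_ring
  | mul x v hx =>
    rw [mul_assoc, ← mul_smul_comm, hx, mul_add, ← mul_assoc, ← mul_assoc, ι_mul_eq v b,
      ι_mul_eq v (invol b), invol_invol, map_mul, invol_ι]
    noncomm_ring

theorem contr_mul (d : Module.Dual ℝ W) (a b : ExteriorAlgebra ℝ W) :
    contr d (a * b) = contr d a * b + invol a * contr d b := by
  induction a using exterior_left_induction with
  | alg r =>
    rw [contr_algebraMap, AlgHom.commutes, zero_mul, zero_add, ← Algebra.smul_def, map_smul,
      Algebra.smul_def]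
  | add x y hx hy => rw [add_mul, map_add, hx, hy, map_add, map_add]; noncomm_ring
  | mul x v hx =>
    rw [mul_assoc, contr_ι_mul, contr_ι_mul, hx, map_mul, invol_ι, sub_mul, smul_mul_assoc]
    noncomm_ring

theorem invol_contr (d : Module.Dual ℝ W) (a : ExteriorAlgebra ℝ W) :
    invol (contr d a) = -contr d (invol a) := by
  induction a using exterior_left_induction with
  | alg r => rw [AlgHom.commutes, contr_algebraMap, map_zero, neg_zero]
  | add x y hx hy => simp only [map_add, hx, hy, neg_add]
  | mul x v hx =>
    rw [contr_ι_mul, map_sub, map_smul, map_mul, map_mul, invol_ι, hx, neg_mul, neg_mul,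
      map_neg, contr_ι_mul]
    noncomm_ring

/-- Splitting off one generator `e`: every `x` is the sum of its projection along `e` and
`e ∧ (d ⌋ x)`. -/
theorem eq_map_add_ι_mul_contr (d : Module.Dual ℝ W) (e : W)
    (x : ExteriorAlgebra ℝ W) :
    x = ExteriorAlgebra.map (LinearMap.id - d.smulRight e) x +
      ExteriorAlgebra.ι ℝ e * contr d x := by
  induction x using exterior_left_induction with
  | alg r => rw [AlgHom.commutes, contr_algebraMap, mul_zero, add_zero]
  | add x y hx hy =>
    conv_lhs => rw [hx, hy]
    simp only [map_add, mul_add]; abel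
  | mul x v hx =>
    rw [map_mul, ExteriorAlgebra.map_apply_ι, contr_ι_mul]
    set y := ExteriorAlgebra.map (LinearMap.id - d.smulRight e) x with hy
    have h1 : (LinearMap.id - d.smulRight e : W →ₗ[ℝ] W) v = v - d v • e := by simp
    have h2 : ExteriorAlgebra.ι ℝ e * (ExteriorAlgebra.ι ℝ v * contr d x) =
        -(ExteriorAlgebra.ι ℝ v * (ExteriorAlgebra.ι ℝ e * contr d x)) := by
      rw [← mul_assoc, ι_mul_swap, neg_mul, mul_assoc]
    have h3 : ExteriorAlgebra.ι ℝ e * x = ExteriorAlgebra.ι ℝ e * y := by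
      conv_lhs => rw [hx, mul_add, ← mul_assoc, ExteriorAlgebra.ι_sq_zero, zero_mul, add_zero]
    rw [h1, map_sub, map_smul, mul_sub, h2, mul_smul_comm, h3, sub_mul, smul_mul_assoc]
    conv_lhs => rw [hx, mul_add]
    abel

theorem even_commute (x y : ExteriorAlgebra ℝ W) : Commute (x + invol x) y := by
  have h := exterior_supercomm (x + invol x) y
  rw [map_add, invol_invol, add_comm (invol x) x, sub_self, mul_zero, add_zero, mul_add,
    ← two_smul ℝ] at h
  exact smul_right_injective _ (two_ne_zero (α := ℝ)) h

/-- The even part of an element differs from its body by a nilpotent element. -/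
theorem isNilpotent_even_sub_body (x : ExteriorAlgebra ℝ W) :
    IsNilpotent (x + invol x -
      algebraMap ℝ _ (2 * ExteriorAlgebra.algebraMapInv x)) := by
  have hc' : ∀ (r : ℝ) (x y : ExteriorAlgebra ℝ W),
      Commute (x + invol x - algebraMap ℝ _ r) y := fun r x y =>
    (even_commute x y).sub_left (Algebra.commutes r y)
  induction x using exterior_left_induction with
  | alg r =>
    have : ExteriorAlgebra.algebraMapInv (algebraMap ℝ (ExteriorAlgebra ℝ W) r) = r :=
      ExteriorAlgebra.algebraMap_leftInverse W r
    rw [this, AlgHom.commutes, ← map_add, ← two_mul, sub_self]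
    exact IsNilpotent.zero
  | add x y hx hy =>
    have : x + y + invol (x + y) - algebraMap ℝ _ (2 * ExteriorAlgebra.algebraMapInv (x + y)) =
        (x + invol x - algebraMap ℝ _ (2 * ExteriorAlgebra.algebraMapInv x)) +
        (y + invol y - algebraMap ℝ _ (2 * ExteriorAlgebra.algebraMapInv y)) := by
      simp only [map_add, mul_add]; abel
    rw [this]
    exact (hc' _ _ _).isNilpotent_add hx hy
  | mul x v _ =>
    -- the even part of `v ∧ x` is `v` times the odd part of `x`, so its square contains `v ∧ v`
    have h1 : ExteriorAlgebra.algebraMapInv (ExteriorAlgebra.ι ℝ v) = (0 : ℝ) := by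
      simp [ExteriorAlgebra.algebraMapInv]
    refine ⟨2, ?_⟩
    rw [map_mul ExteriorAlgebra.algebraMapInv, h1, zero_mul, mul_zero, map_zero, sub_zero,
      map_mul, invol_ι, neg_mul, ← sub_eq_add_neg, ← mul_sub, pow_two]
    set y := x - invol x
    have h2 : y * ExteriorAlgebra.ι ℝ v = ExteriorAlgebra.ι ℝ v * invol y := by
      rw [ι_mul_eq, invol_invol]
    rw [mul_assoc, ← mul_assoc y, h2, mul_assoc, ← mul_assoc, ExteriorAlgebra.ι_sq_zero, zero_mul]

theorem isNilpotent_of_body_eq_zero {x : ExteriorAlgebra ℝ W} (hx : invol x = x)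
    (h0 : ExteriorAlgebra.algebraMapInv x = 0) : IsNilpotent x := by
  have h := isNilpotent_even_sub_body x
  rw [h0, hx, mul_zero, map_zero, sub_zero, ← two_smul ℝ x] at h
  simpa using h.smul (2 : ℝ)⁻¹

end Exterior

/-! ### The structure of superfunctions -/

theorem sg_add (m n : ℕ) : sg (m + n) = sg m * sg n := pow_add _ _ _

theorem sg_zero : sg 0 = 1 := pow_zero _

theorem sg_one : sg 1 = -1 := pow_one _

theorem sg_mul_self (n : ℕ) : sg n * sg n = 1 := by
  rw [sg, ← pow_add, ← two_mul, pow_mul]; norm_num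

theorem sg_even {n : ℕ} (h : Even n) : sg n = 1 := h.neg_one_pow

theorem sg_congr {m n : ℕ} (h : m % 2 = n % 2) : sg m = sg n := by
  rw [sg, sg, neg_one_pow_eq_pow_mod_two, h, ← neg_one_pow_eq_pow_mod_two]

/-- Signs agree if their exponents agree modulo two; the congruence can be checked over `ZMod 2`. -/
theorem sg_eq {m n : ℕ} (h : (m : ZMod 2) = n) : sg m = sg n :=
  sg_congr ((ZMod.natCast_eq_natCast_iff' m n 2).mp h)

theorem neg_sg (n : ℕ) : -sg n = sg (n + 1) := by rw [sg_add, sg_one, mul_neg_one]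

theorem ε_cases {p q : ℕ} (A : Idx p q) : ε A = 0 ∨ ε A = 1 := by
  rcases A with i | a
  · exact Or.inl rfl
  · exact Or.inr rfl

section Superdomain

variable {p q N : ℕ} {U V : Opens (Fin p → ℝ)}

/-- The superfunction `f λ`, for a smooth function `f` and an element `λ` of the Grassmann
algebra of all odd generators. -/
def tm (f : SmoothFn U) (l : ExteriorAlgebra ℝ (Fin q ⊕ Fin N → ℝ)) : SFun q N U := f ⊗ₜ[ℝ] l

theorem SFun.induction {P : SFun q N U → Prop} (tmul : ∀ f l, P (tm f l))
    (add : ∀ x y, P x → P y → P (x + y)) (x : SFun q N U) : P x :=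
  TensorProduct.induction_on (motive := P) x
    (by have := tmul 0 0; rwa [show tm (0 : SmoothFn U) 0 = (0 : SFun q N U) from
          TensorProduct.zero_tmul _ _] at this) tmul add

theorem SFun.linearMap_ext {X : Type*} [AddCommMonoid X] [Module ℝ X] {S T : SFun q N U →ₗ[ℝ] X}
    (h : ∀ f l, S (tm f l) = T (tm f l)) : S = T :=
  LinearMap.ext fun x => SFun.induction (P := fun x => S x = T x) h
    (fun x y hx hy => by rw [map_add, map_add, hx, hy]) x

theorem tm_mul (f g : SmoothFn U) (l m : ExteriorAlgebra ℝ (Fin q ⊕ Fin N → ℝ)) :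
    (tm f l * tm g m : SFun q N U) = tm (f * g) (l * m) :=
  Algebra.TensorProduct.tmul_mul_tmul f g l m

theorem tm_one : (tm 1 1 : SFun q N U) = 1 := rfl

theorem tm_add_left (f g : SmoothFn U) (l : ExteriorAlgebra ℝ (Fin q ⊕ Fin N → ℝ)) :
    (tm (f + g) l : SFun q N U) = tm f l + tm g l := TensorProduct.add_tmul f g l

theorem tm_add (f : SmoothFn U) (l m : ExteriorAlgebra ℝ (Fin q ⊕ Fin N → ℝ)) :
    (tm f (l + m) : SFun q N U) = tm f l + tm f m := TensorProduct.tmul_add f l m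

theorem tm_sub (f : SmoothFn U) (l m : ExteriorAlgebra ℝ (Fin q ⊕ Fin N → ℝ)) :
    (tm f (l - m) : SFun q N U) = tm f l - tm f m := TensorProduct.tmul_sub f l m

theorem tm_neg (f : SmoothFn U) (l : ExteriorAlgebra ℝ (Fin q ⊕ Fin N → ℝ)) :
    (tm f (-l) : SFun q N U) = -tm f l := TensorProduct.tmul_neg f l

theorem tm_smul (c : ℝ) (f : SmoothFn U) (l : ExteriorAlgebra ℝ (Fin q ⊕ Fin N → ℝ)) :
    (tm f (c • l) : SFun q N U) = c • tm f l := TensorProduct.tmul_smul c f l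

theorem tm_smul_left (c : ℝ) (f : SmoothFn U) (l : ExteriorAlgebra ℝ (Fin q ⊕ Fin N → ℝ)) :
    (tm (c • f) l : SFun q N U) = c • tm f l := TensorProduct.smul_tmul' c f l

theorem tm_zero (f : SmoothFn U) : (tm f 0 : SFun q N U) = 0 := TensorProduct.tmul_zero _ f

theorem tm_zero_left (l : ExteriorAlgebra ℝ (Fin q ⊕ Fin N → ℝ)) : (tm 0 l : SFun q N U) = 0 :=
  TensorProduct.zero_tmul _ l

theorem parity_tm (f : SmoothFn U) (l : ExteriorAlgebra ℝ (Fin q ⊕ Fin N → ℝ)) :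
    parity (tm f l : SFun q N U) = tm f (invol l) := rfl

theorem sres_tm (h : V ≤ U) (f : SmoothFn U) (l : ExteriorAlgebra ℝ (Fin q ⊕ Fin N → ℝ)) :
    sres h (tm f l : SFun q N U) = tm (smoothRes h f) l := rfl

theorem pd_inl_tm (i : Fin p) (f : SmoothFn U) (l : ExteriorAlgebra ℝ (Fin q ⊕ Fin N → ℝ)) :
    pd (Sum.inl i) (tm f l : SFun q N U) = tm (smoothPd U i f) l := rfl

theorem pd_inr_tm (a : Fin q) (f : SmoothFn U) (l : ExteriorAlgebra ℝ (Fin q ⊕ Fin N → ℝ)) :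
    pd (Sum.inr a) (tm f l : SFun q N U) = tm f (contr (LinearMap.proj (Sum.inl a)) l) := rfl

theorem body_tm (f : SmoothFn U) (l : ExteriorAlgebra ℝ (Fin q ⊕ Fin N → ℝ)) :
    body (tm f l : SFun q N U) = ExteriorAlgebra.algebraMapInv l • f := rfl

theorem evalAt_tm (x : U) (f : SmoothFn U) (l : ExteriorAlgebra ℝ (Fin q ⊕ Fin N → ℝ)) :
    evalAt x (tm f l : SFun q N U) = f.1 x • l := rfl

theorem sconst_eq (c : Grass N) : (sconst c : SFun q N U) = tm 1 (ExteriorAlgebra.map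
    (Function.ExtendByZero.linearMap ℝ (Sum.inr : Fin N → Fin q ⊕ Fin N)) c) := rfl

theorem coord_inl (i : Fin p) : (coord (Sum.inl i) : SFun q N U) = tm (smoothCoord U i) 1 := rfl

theorem coord_inr (a : Fin q) : (coord (Sum.inr a) : SFun q N U) =
    tm 1 (ExteriorAlgebra.ι ℝ (Pi.single (Sum.inl a) 1)) := rfl

theorem parity_parity (f : SFun q N U) : parity (parity f) = f := by
  induction f using SFun.induction with
  | tmul f l => rw [parity_tm, parity_tm, invol_invol]
  | add x y hx hy => rw [map_add, map_add, hx, hy]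

theorem supercomm (a b : SFun q N U) :
    (2 : ℝ) • (a * b) = b * (a + parity a) + parity b * (a - parity a) := by
  induction a using SFun.induction with
  | tmul f l =>
    induction b using SFun.induction with
    | tmul g m =>
      simp only [parity_tm, tm_mul, ← tm_add, ← tm_sub, ← tm_smul, exterior_supercomm l m,
        mul_comm f g]
    | add x y hx hy => rw [mul_add, smul_add, hx, hy, map_add]; noncomm_ring
  | add x y hx hy => rw [add_mul, smul_add, hx, hy, map_add]; noncomm_ring

/-! #### Partial derivatives of smooth functions -/

theorem smoothPd_apply (i : Fin p) (f : SmoothFn U) (x : U) :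
    (smoothPd U i f).1 x = fderiv ℝ (ext0 f.1) x (Pi.single i 1) := rfl

theorem smoothFn_ext {f g : SmoothFn U} (h : ∀ x, f.1 x = g.1 x) : f = g :=
  Subtype.ext (funext h)

theorem ext0_contDiffOn (f : SmoothFn U) : ContDiffOn ℝ ∞ (ext0 f.1) U := f.2

theorem smoothPd_mul (i : Fin p) (f g : SmoothFn U) :
    smoothPd U i (f * g) = smoothPd U i f * g + f * smoothPd U i g := by
  refine smoothFn_ext fun x => ?_
  have e : ext0 (f * g).1 = ext0 f.1 * ext0 g.1 := by
    funext y
    by_cases hy : y ∈ U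
    · simp [ext0_apply _ hy]
    · simp [ext0_apply_of_notMem _ hy]
  have h : (smoothPd U i f * g + f * smoothPd U i g).1 x =
    (smoothPd U i f).1 x * g.1 x + f.1 x * (smoothPd U i g).1 x := rfl
  rw [h, smoothPd_apply, smoothPd_apply, smoothPd_apply, e,
    fderiv_mul (ext0_differentiableAt f x) (ext0_differentiableAt g x)]
  simp only [add_apply, smul_apply, smul_eq_mul,
    ext0_apply _ x.2]
  ring

theorem smoothPd_one (i : Fin p) : smoothPd U i 1 = 0 := by
  have h := smoothPd_mul i (1 : SmoothFn U) 1
  rw [mul_one, mul_one, one_mul] at h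
  exact left_eq_add.mp h

theorem ext0_smoothPd (i : Fin p) (f : SmoothFn U) {x : Fin p → ℝ} (hx : x ∈ U) :
    ext0 (smoothPd U i f).1 x = fderiv ℝ (ext0 f.1) x (Pi.single i 1) :=
  ext0_apply _ hx

theorem smoothPd_comm (i j : Fin p) (f : SmoothFn U) :
    smoothPd U i (smoothPd U j f) = smoothPd U j (smoothPd U i f) := by
  refine smoothFn_ext fun x => ?_
  have h2 : ContDiffAt ℝ 2 (ext0 f.1) x :=
    ((ext0_contDiffOn f).contDiffAt (U.isOpen.mem_nhds x.2)).of_le (by norm_cast)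
  have hd : DifferentiableAt ℝ (fderiv ℝ (ext0 f.1)) x :=
    (h2.fderiv_right (m := 1) le_rfl).differentiableAt one_ne_zero
  have key : ∀ i j : Fin p, (smoothPd U i (smoothPd U j f)).1 x =
      fderiv ℝ (fderiv ℝ (ext0 f.1)) x (Pi.single i 1) (Pi.single j 1) := by
    intro i j
    rw [smoothPd_apply]
    have : ext0 (smoothPd U j f).1 =ᶠ[nhds x.1]
        fun y => fderiv ℝ (ext0 f.1) y (Pi.single j 1) := by
      filter_upwards [U.isOpen.mem_nhds x.2] with y hy using ext0_smoothPd j f hy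
    rw [this.fderiv_eq, fderiv_clm_apply hd (by fun_prop)]
    simp
  rw [key, key]
  exact (h2.isSymmSndFDerivAt (by simp)).eq _ _

theorem smoothPd_coord (i j : Fin p) :
    smoothPd U i (smoothCoord U j) = if i = j then 1 else 0 := by
  refine smoothFn_ext fun x => ?_
  have : ext0 (smoothCoord U j).1 =ᶠ[nhds x.1] fun y => y j := by
    filter_upwards [U.isOpen.mem_nhds x.2] with y hy using ext0_apply _ hy
  rw [smoothPd_apply, this.fderiv_eq, fderiv_apply (by fun_prop)]
  by_cases h : i = j
  · subst h; simp
  · simp [h, Ne.symm h]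

theorem smoothRes_smoothPd (h : V ≤ U) (i : Fin p) (f : SmoothFn U) :
    smoothRes h (smoothPd U i f) = smoothPd V i (smoothRes h f) := by
  refine smoothFn_ext fun x => ?_
  have e1 : (smoothRes h (smoothPd U i f)).1 x = fderiv ℝ (ext0 f.1) x (Pi.single i 1) := rfl
  rw [e1, smoothPd_apply]
  have : ext0 (smoothRes h f).1 =ᶠ[nhds x.1] ext0 f.1 := by
    filter_upwards [V.isOpen.mem_nhds x.2] with y hy
    rw [ext0_apply _ hy, ext0_apply _ (h hy)]; rfl
  rw [this.fderiv_eq]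

/-! #### The left derivatives of superfunctions -/

/-- The automorphism `f ↦ (-1)^{n ε(f)} f`, by which an object of parity `n` moves past `f`. -/
def tw (n : ℕ) : SFun q N U →ₐ[ℝ] SFun q N U := parity ^ n

theorem tw_zero (f : SFun q N U) : tw 0 f = f := rfl

theorem tw_one (f : SFun q N U) : tw 1 f = parity f := by rw [tw, pow_one]

theorem tw_add (m n : ℕ) (f : SFun q N U) : tw (m + n) f = tw m (tw n f) := by
  rw [tw, pow_add]; rfl

theorem tw_tw_self (n : ℕ) (f : SFun q N U) : tw n (tw n f) = f := by
  have h : (parity * parity : SFun q N U →ₐ[ℝ] SFun q N U) = 1 := AlgHom.ext parity_parity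
  rw [← tw_add, ← two_mul, tw, pow_mul, pow_two, h, one_pow]; rfl

theorem tw_congr {m n : ℕ} (h : m % 2 = n % 2) (f : SFun q N U) : tw m f = tw n f := by
  have h2 : (parity ^ 2 : SFun q N U →ₐ[ℝ] SFun q N U) = 1 := by
    rw [pow_two]; exact AlgHom.ext parity_parity
  rw [tw, tw, pow_eq_pow_mod m h2, h, ← pow_eq_pow_mod n h2]

theorem pd_mul (A : Idx p q) (f g : SFun q N U) :
    pd A (f * g) = pd A f * g + tw (ε A) f * pd A g := by
  induction f using SFun.induction with
  | tmul f l =>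
    induction g using SFun.induction with
    | tmul g m =>
      rcases A with i | a
      · simp only [ε, tw_zero, tm_mul, pd_inl_tm, smoothPd_mul, tm_add_left]
      · simp only [ε, tw_one, tm_mul, pd_inr_tm, parity_tm, contr_mul, tm_add]
    | add x y hx hy => rw [mul_add, map_add, hx, hy, map_add]; noncomm_ring
  | add x y hx hy => rw [add_mul, map_add, hx, hy, map_add, map_add]; noncomm_ring

theorem pd_comm (A B : Idx p q) (f : SFun q N U) :
    pd A (pd B f) = sg (ε A * ε B) • pd B (pd A f) := by
  induction f using SFun.induction with
  | tmul f l =>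
    rcases A with i | a <;> rcases B with j | b
    · simp only [ε, pd_inl_tm, mul_zero, sg_zero, one_smul, smoothPd_comm i j]
    · simp only [ε, pd_inl_tm, pd_inr_tm, zero_mul, sg_zero, one_smul]
    · simp only [ε, pd_inl_tm, pd_inr_tm, mul_zero, sg_zero, one_smul]
    · simp only [ε, pd_inr_tm, mul_one, sg_one, neg_smul, one_smul, ← tm_neg]
      rw [contr_comm]
  | add x y hx hy => rw [map_add, map_add, hx, hy, map_add, map_add, smul_add]

theorem parity_pd (A : Idx p q) (f : SFun q N U) :
    parity (pd A f) = sg (ε A) • pd A (parity f) := by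
  induction f using SFun.induction with
  | tmul f l =>
    rcases A with i | a
    · simp only [ε, pd_inl_tm, parity_tm, sg_zero, one_smul]
    · simp only [ε, pd_inr_tm, parity_tm, sg_one, neg_smul, one_smul, ← tm_neg, invol_contr]
  | add x y hx hy => rw [map_add, map_add, hx, hy, map_add, map_add, smul_add]

theorem pd_one (A : Idx p q) : pd A (1 : SFun q N U) = 0 := by
  have h := pd_mul A (1 : SFun q N U) 1
  rw [mul_one, mul_one, map_one (tw (ε A)), one_mul] at h
  exact left_eq_add.mp h

theorem pd_coord (A B : Idx p q) : pd A (coord B : SFun q N U) = if A = B then 1 else 0 := by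
  rcases A with i | a <;> rcases B with j | b
  · rw [coord_inl, pd_inl_tm, smoothPd_coord]
    by_cases h : i = j
    · rw [if_pos h, if_pos (congrArg _ h), tm_one]
    · rw [if_neg h, if_neg (by simpa using h), tm_zero_left]
  · rw [coord_inr, pd_inl_tm, smoothPd_one, tm_zero_left]; simp
  · rw [coord_inl, pd_inr_tm, ← map_one (algebraMap ℝ _), contr_algebraMap, tm_zero]; simp
  · rw [coord_inr, pd_inr_tm, contr_ι]
    by_cases h : a = b
    · subst h; simp [tm_one]
    · rw [if_neg (by simpa using h)]
      simp [h, tm_zero]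

theorem pd_sconst (A : Idx p q) (c : Grass N) : pd A (sconst c : SFun q N U) = 0 := by
  rw [sconst_eq]
  rcases A with i | a
  · rw [pd_inl_tm, smoothPd_one, tm_zero_left]
  · rw [pd_inr_tm]
    suffices h : contr (LinearMap.proj (Sum.inl a)) (ExteriorAlgebra.map
        (Function.ExtendByZero.linearMap ℝ (Sum.inr : Fin N → Fin q ⊕ Fin N)) c) = 0 by
      rw [h, tm_zero]
    induction c using exterior_left_induction with
    | alg r => rw [AlgHom.commutes, contr_algebraMap]
    | add x y hx hy => rw [map_add, map_add, hx, hy, add_zero]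
    | mul x v hx =>
      rw [map_mul, ExteriorAlgebra.map_apply_ι, contr_ι_mul, hx, mul_zero, sub_zero]
      have h0 : ¬ ∃ b : Fin N, (Sum.inr b : Fin q ⊕ Fin N) = Sum.inl a := by simp
      have h1 : (LinearMap.proj (Sum.inl a) : Module.Dual ℝ (Fin q ⊕ Fin N → ℝ))
          (Function.ExtendByZero.linearMap ℝ Sum.inr v) = 0 :=
        Function.extend_apply' v (0 : Fin q ⊕ Fin N → ℝ) _ h0
      rw [h1, zero_smul]

theorem parity_sconst (c : Grass N) :
    parity (sconst c : SFun q N U) = sconst (grassParity N c) := by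
  rw [sconst_eq, sconst_eq, parity_tm]
  congr 1
  induction c using exterior_left_induction with
  | alg r => simp only [AlgHom.commutes]
  | add x y hx hy => simp only [map_add, hx, hy]
  | mul x v hx =>
    rw [map_mul, map_mul, ExteriorAlgebra.map_apply_ι, invol_ι, hx, map_mul, map_mul, invol_ι,
      map_neg, ExteriorAlgebra.map_apply_ι]

theorem parity_coord (A : Idx p q) :
    parity (coord A : SFun q N U) = sg (ε A) • coord A := by
  rcases A with i | a
  · rw [coord_inl, parity_tm, map_one]; simp [ε, sg]
  · rw [coord_inr, parity_tm, invol_ι, tm_neg]; simp [ε, sg]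

/-! #### Restriction -/

theorem sres_pd (h : V ≤ U) (A : Idx p q) (f : SFun q N U) :
    sres h (pd A f) = pd A (sres h f) := by
  induction f using SFun.induction with
  | tmul f l =>
    rcases A with i | a
    · simp only [pd_inl_tm, sres_tm, smoothRes_smoothPd]
    · simp only [pd_inr_tm, sres_tm]
  | add x y hx hy => simp only [map_add, hx, hy]

theorem sres_parity (h : V ≤ U) (f : SFun q N U) :
    sres h (parity f) = parity (sres h f) := by
  induction f using SFun.induction with
  | tmul f l => simp only [parity_tm, sres_tm]
  | add x y hx hy => simp only [map_add, hx, hy]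

theorem sres_coord (h : V ≤ U) (A : Idx p q) :
    sres h (coord A : SFun q N U) = coord A := by
  rcases A with i | a
  · rfl
  · rw [coord_inr, coord_inr, sres_tm, map_one]

theorem evalAt_sres (h : V ≤ U) (x : V) (f : SFun q N U) :
    evalAt x (sres h f) = evalAt ⟨x.1, h x.2⟩ f := by
  induction f using SFun.induction with
  | tmul f l => rfl
  | add x y hx hy => simp only [map_add, hx, hy]

/-! #### Components -/

/-- The coefficients of a superfunction with respect to a basis of the Grassmann algebra. Any basis
will do. -/
def comp (k : Module.Basis.ofVectorSpaceIndex ℝ (ExteriorAlgebra ℝ (Fin q ⊕ Fin N → ℝ))) :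
    SFun q N U →ₗ[ℝ] SmoothFn U :=
  (TensorProduct.rid ℝ (SmoothFn U)).toLinearMap ∘ₗ LinearMap.lTensor (SmoothFn U)
    ((Module.Basis.ofVectorSpace ℝ (ExteriorAlgebra ℝ (Fin q ⊕ Fin N → ℝ))).coord k)

theorem comp_tm (k) (f : SmoothFn U) (l : ExteriorAlgebra ℝ (Fin q ⊕ Fin N → ℝ)) :
    comp k (tm f l : SFun q N U) =
      (Module.Basis.ofVectorSpace ℝ (ExteriorAlgebra ℝ (Fin q ⊕ Fin N → ℝ))).repr l k • f := rfl

theorem SFun.exists_eq_sum (f : SFun q N U) :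
    ∃ s : Finset (Module.Basis.ofVectorSpaceIndex ℝ (ExteriorAlgebra ℝ (Fin q ⊕ Fin N → ℝ))),
      (∀ k ∉ s, comp k f = 0) ∧
      f = ∑ k ∈ s, tm (comp k f) (Module.Basis.ofVectorSpace ℝ _ k) := by
  classical
  set b := Module.Basis.ofVectorSpace ℝ (ExteriorAlgebra ℝ (Fin q ⊕ Fin N → ℝ)) with hb
  let e := TensorProduct.equivFinsuppOfBasisRight (M := SmoothFn U) b
  have hk : ∀ (g : SFun q N U) k, comp k g = e g k := by
    intro g k
    induction g using SFun.induction with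
    | tmul f l =>
      exact (TensorProduct.equivFinsuppOfBasisRight_apply_tmul_apply b f l k).symm
    | add x y hx hy =>
      have : e (x + y) = e x + e y := map_add e x y
      rw [map_add, hx, hy, this]; rfl
  refine ⟨(e f).support, fun k hk' => by rw [hk]; exact Finsupp.notMem_support_iff.mp hk', ?_⟩
  have h := e.symm_apply_apply f
  rw [TensorProduct.equivFinsuppOfBasisRight_symm_apply] at h
  refine h.symm.trans ?_
  rw [Finsupp.sum]
  exact Finset.sum_congr rfl fun k _ => by rw [hk]; rfl

theorem SFun.ext_comp {f g : SFun q N U} (h : ∀ k, comp k f = comp k g) : f = g := by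
  have h0 : ∀ k, comp k (f - g) = 0 := fun k => by rw [map_sub, h, sub_self]
  obtain ⟨s, -, hs⟩ := SFun.exists_eq_sum (f - g)
  refine sub_eq_zero.mp (hs.trans (Finset.sum_eq_zero fun k _ => ?_))
  rw [h0, tm_zero_left]

theorem comp_pd_inl (k) (i : Fin p) (f : SFun q N U) :
    comp k (pd (Sum.inl i) f) = smoothPd U i (comp k f) := by
  induction f using SFun.induction with
  | tmul f l => rw [pd_inl_tm, comp_tm, comp_tm, map_smul]
  | add x y hx hy => simp only [map_add, hx, hy]

theorem comp_evalAt (k) (x : U) (f : SFun q N U) :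
    (comp k f).1 x = (Module.Basis.ofVectorSpace ℝ _).repr (evalAt x f) k := by
  induction f using SFun.induction with
  | tmul f l =>
    rw [evalAt_tm, comp_tm, map_smul, Finsupp.smul_apply, smul_eq_mul, mul_comm]; rfl
  | add x y hx hy =>
    simp only [map_add, Finsupp.add_apply, ← hx, ← hy]; rfl

theorem SFun.ext_evalAt {f g : SFun q N U} (h : ∀ x, evalAt x f = evalAt x g) : f = g :=
  SFun.ext_comp fun k => smoothFn_ext fun x => by rw [comp_evalAt, comp_evalAt, h]

/-- Superfunctions that agree near every point are equal. -/
theorem SFun.ext_local {f g : SFun q N U}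
    (h : ∀ x ∈ U, ∃ (V : Opens (Fin p → ℝ)) (hV : V ≤ U), x ∈ V ∧ sres hV f = sres hV g) :
    f = g := by
  refine SFun.ext_evalAt fun x => ?_
  obtain ⟨V, hV, hx, e⟩ := h x.1 x.2
  rw [← evalAt_sres hV ⟨x.1, hx⟩, e, evalAt_sres]

end Superdomain

/-! ### Hadamard's lemma and derivations along homomorphisms -/

section Hadamard

variable {p : ℕ}

open MeasureTheory in
/-- Smooth dependence of `∫₀¹ φ(a + t (x - a)) dt` on `x`. The integral is the value at zero of the
convolution of an indicator function with a smooth function that depends smoothly on `x`; the bump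
function `ψ`, which is `1` where the integral is taken, makes its support compact. -/
theorem contDiff_segment_integral {φ : (Fin p → ℝ) → ℝ} (hφ : ContDiff ℝ ∞ φ) (a : Fin p → ℝ) :
    ContDiff ℝ ∞ fun x => ∫ t in (0 : ℝ)..1, φ (a + t • (x - a)) := by
  let ψ : ContDiffBump (0 : ℝ) := ⟨2, 3, by norm_num, by norm_num⟩
  let g : (Fin p → ℝ) → ℝ → ℝ := fun x u => ψ u * φ (a - u • (x - a))
  let f : ℝ → ℝ := Set.indicator (Set.Ioc 0 1) 1
  have hg : ContDiffOn ℝ ∞ (Function.uncurry g) (Set.univ ×ˢ Set.univ) := by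
    have h1 : ContDiff ℝ ∞ fun z : (Fin p → ℝ) × ℝ => ψ z.2 := ψ.contDiff.comp contDiff_snd
    have h2 : ContDiff ℝ ∞ fun z : (Fin p → ℝ) × ℝ => φ (a - z.2 • (z.1 - a)) :=
      hφ.comp (by fun_prop)
    exact (h1.mul h2).contDiffOn
  have hf : LocallyIntegrable f volume :=
    ((integrable_indicator_iff measurableSet_Ioc).mpr
      (integrableOn_const (by simp))).locallyIntegrable
  have h := contDiffOn_convolution_right_with_param (𝕜 := ℝ) (n := ⊤) (ContinuousLinearMap.mul ℝ ℝ)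
    (g := g) (f := f) (μ := volume) isOpen_univ (isCompact_closedBall (0 : ℝ) 3)
    (fun x u _ hu => by
      have : ψ u = 0 := ψ.zero_of_le_dist (by
        rw [Metric.mem_closedBall, not_le] at hu; exact hu.le)
      simp [g, this]) hf hg
  have h2 : ContDiff ℝ ∞ fun x : Fin p → ℝ =>
      convolution f (g x) (ContinuousLinearMap.mul ℝ ℝ) volume 0 := by
    have h3 : ContDiff ℝ ∞ fun z : (Fin p → ℝ) × ℝ =>
        convolution f (g z.1) (ContinuousLinearMap.mul ℝ ℝ) volume z.2 := by
      rw [← contDiffOn_univ, ← Set.univ_prod_univ]; exact h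
    exact h3.comp (contDiff_id.prodMk contDiff_const)
  convert h2 using 2 with x
  rw [convolution_def, intervalIntegral.integral_of_le zero_le_one,
    ← integral_indicator measurableSet_Ioc]
  refine integral_congr_ae (Filter.Eventually.of_forall fun t => ?_)
  by_cases ht : t ∈ Set.Ioc (0 : ℝ) 1
  · have : ψ (0 - t) = 1 := ψ.one_of_mem_closedBall (by
      rw [Metric.mem_closedBall, dist_zero_right, zero_sub, norm_neg, Real.norm_eq_abs,
        abs_of_pos ht.1]
      exact ht.2.trans one_le_two)
    have h4 : f t = 1 := Set.indicator_of_mem ht _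
    simp only [Set.indicator_of_mem ht, ContinuousLinearMap.mul_apply', g, h4, zero_sub,
      neg_smul, sub_neg_eq_add, one_mul]
    rw [zero_sub] at this
    rw [this, one_mul]
  · have h4 : f t = 0 := Set.indicator_of_notMem ht _
    simp [Set.indicator_of_notMem ht, h4]

/-- Hadamard's lemma for functions on the whole space. -/
theorem hadamard_global {F : (Fin p → ℝ) → ℝ} (hF : ContDiff ℝ ∞ F) (a : Fin p → ℝ) :
    ∃ G : Fin p → (Fin p → ℝ) → ℝ, (∀ i, ContDiff ℝ ∞ (G i)) ∧
      ∀ x, F x - F a = ∑ i, (x i - a i) * G i x := by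
  have hd : ∀ i : Fin p, ContDiff ℝ ∞ fun x => fderiv ℝ F x (Pi.single i 1) := fun i =>
    (hF.fderiv_right (m := ∞) (by simp)).clm_apply contDiff_const
  refine ⟨fun i x => ∫ t in (0 : ℝ)..1, fderiv ℝ F (a + t • (x - a)) (Pi.single i 1),
    fun i => contDiff_segment_integral (hd i) a, fun x => ?_⟩
  have hder : ∀ t : ℝ, HasDerivAt (fun t : ℝ => F (a + t • (x - a)))
      (fderiv ℝ F (a + t • (x - a)) (x - a)) t := by
    intro t
    have h1 : HasDerivAt (fun t : ℝ => a + t • (x - a)) (x - a) t := by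
      simpa using ((hasDerivAt_id t).smul_const (x - a)).const_add a
    exact ((hF.differentiable (by simp)) _).hasFDerivAt.comp_hasDerivAt t h1
  have hcont : ∀ v : Fin p → ℝ, Continuous fun t : ℝ => fderiv ℝ F (a + t • (x - a)) v := by
    intro v
    have := (hF.continuous_fderiv (by simp)).clm_apply (continuous_const (y := v))
    exact this.comp (by fun_prop)
  have h := intervalIntegral.integral_eq_sub_of_hasDerivAt (a := 0) (b := 1)
    (fun t _ => hder t) ((hcont (x - a)).intervalIntegrable _ _)
  simp only [one_smul, zero_smul, add_zero, add_sub_cancel] at h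
  rw [← h]
  simp only [← intervalIntegral.integral_const_mul]
  rw [← intervalIntegral.integral_finsetSum fun i _ =>
    ((hcont (Pi.single i 1)).const_mul _).intervalIntegrable _ _]
  congr 1
  funext t
  have hs := congrArg (fderiv ℝ F (a + t • (x - a))) (Finset.univ_sum_single (x - a))
  rw [map_sum] at hs
  rw [← hs]
  refine Finset.sum_congr rfl fun i _ => ?_
  have : (Pi.single i ((x - a) i) : Fin p → ℝ) = (x i - a i) • Pi.single i 1 := by
    rw [← Pi.single_smul, smul_eq_mul, mul_one]; rfl
  rw [this, map_smul, smul_eq_mul]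

/-- Hadamard's lemma: on any open set, a smooth function is its value at a point plus a
combination of the coordinate differences. A bump function reduces it to functions on the whole
space and functions that vanish near the point. -/
theorem hadamard {U : Opens (Fin p → ℝ)} (f : SmoothFn U) (a : U) :
    ∃ g : Fin p → SmoothFn U, f = algebraMap ℝ _ (f.1 a) +
      ∑ i, (smoothCoord U i - algebraMap ℝ _ (a.1 i)) * g i := by
  obtain ⟨r, hr, hrU⟩ := Metric.isOpen_iff.mp U.isOpen a.1 a.2
  let χ : ContDiffBump a.1 := ⟨r / 4, r / 2, by positivity, by linarith⟩
  have hfU := ext0_contDiffOn f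
  have hF : ContDiff ℝ ∞ fun x => χ x * ext0 f.1 x := by
    rw [contDiff_iff_contDiffAt]
    intro x
    by_cases hx : x ∈ U
    · exact χ.contDiff.contDiffAt.mul (hfU.contDiffAt (U.isOpen.mem_nhds hx))
    · have hxr : x ∈ (Metric.closedBall a.1 (r / 2))ᶜ := fun h =>
        hx (hrU (Metric.closedBall_subset_ball (by linarith) h))
      have : (fun x => χ x * ext0 f.1 x) =ᶠ[nhds x] fun _ => 0 := by
        filter_upwards [Metric.isClosed_closedBall.isOpen_compl.mem_nhds hxr] with y hy
        have : χ y = 0 := χ.zero_of_le_dist (le_of_lt (by simpa using hy))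
        rw [this, zero_mul]
      exact contDiffAt_const.congr_of_eventuallyEq this
  -- `f - f(a) = (χ f - f(a)) + (1 - χ) f`, and the second summand, which vanishes near `a`, is
  -- divided by the square of the distance to `a`
  obtain ⟨G, hG, hFG⟩ := hadamard_global hF a.1
  let nsq : (Fin p → ℝ) → ℝ := fun x => ∑ i, (x i - a.1 i) ^ 2
  have hns : ContDiff ℝ ∞ nsq := by fun_prop
  have hn0 : ∀ x, nsq x = 0 → x = a.1 := by
    intro x hx
    funext i
    have := (Finset.sum_eq_zero_iff_of_nonneg fun i _ => sq_nonneg (x i - a.1 i)).mp hx i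
      (Finset.mem_univ i)
    exact sub_eq_zero.mp (pow_eq_zero_iff two_ne_zero |>.mp this)
  let h : (Fin p → ℝ) → ℝ := fun x => (1 - χ x) * ext0 f.1 x / nsq x
  have hh : ContDiffOn ℝ ∞ h U := by
    intro x hx
    apply ContDiffAt.contDiffWithinAt
    by_cases hxa : x = a.1
    · have : h =ᶠ[nhds x] fun _ => 0 := by
        rw [hxa]
        filter_upwards [χ.eventuallyEq_one] with y hy
        have hy' : χ y = 1 := hy
        simp [h, hy']
      exact contDiffAt_const.congr_of_eventuallyEq this
    · exact ((contDiffAt_const.sub χ.contDiff.contDiffAt).mul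
        (hfU.contDiffAt (U.isOpen.mem_nhds hx))).div hns.contDiffAt fun h0 => hxa (hn0 x h0)
  have hg : ∀ i, ContDiffOn ℝ ∞ (fun x => G i x + (x i - a.1 i) * h x) U := fun i =>
    (hG i).contDiffOn.add (ContDiffOn.mul (by fun_prop) hh)
  refine ⟨fun i => ⟨fun x => G i x.1 + (x.1 i - a.1 i) * h x.1,
    (hg i).congr fun x hx => ext0_apply _ hx⟩, smoothFn_ext fun x => ?_⟩
  have hsum : ∀ g : Fin p → SmoothFn U, (algebraMap ℝ (SmoothFn U) (f.1 a) +
      ∑ i, (smoothCoord U i - algebraMap ℝ _ (a.1 i)) * g i).1 x =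
      f.1 a + ∑ i, (x.1 i - a.1 i) * (g i).1 x := by
    intro g
    have e : ∀ s : Finset (Fin p), (∑ i ∈ s, (smoothCoord U i -
        algebraMap ℝ (SmoothFn U) (a.1 i)) * g i).1 x = ∑ i ∈ s, (x.1 i - a.1 i) * (g i).1 x := by
      intro s
      induction s using Finset.cons_induction with
      | empty => rfl
      | cons i s hi ih => rw [Finset.sum_cons, Finset.sum_cons, ← ih]; rfl
    rw [← e]; rfl
  rw [hsum]
  have hχa : χ a.1 = 1 := χ.eventuallyEq_one.self_of_nhds
  have e1 := hFG x.1
  rw [hχa, one_mul, ext0_apply _ a.2, ext0_apply _ x.2] at e1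
  have e2 : (1 - χ x.1) * f.1 x = ∑ i, (x.1 i - a.1 i) ^ 2 * h x.1 := by
    rw [← Finset.sum_mul]
    change _ = nsq x.1 * ((1 - χ x.1) * ext0 f.1 x.1 / nsq x.1)
    rw [ext0_apply _ x.2]
    by_cases h0 : nsq x.1 = 0
    · have hx1 : χ x.1 = 1 := by rw [hn0 _ h0, hχa]
      rw [hx1]; simp
    · field_simp
  have e3 : f.1 x = f.1 a + ((χ x.1 * f.1 x - f.1 a) + (1 - χ x.1) * f.1 x) := by ring
  change f.1 x = _
  rw [e3, e1, e2, ← Finset.sum_add_distrib]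
  congr 1
  refine Finset.sum_congr rfl fun i _ => ?_
  change _ = (x.1 i - a.1 i) * (G i x.1 + (x.1 i - a.1 i) * h x.1)
  ring

/-- A smooth function without zeros is invertible. -/
theorem smoothFn_isUnit {U : Opens (Fin p → ℝ)} (f : SmoothFn U) (h : ∀ x, f.1 x ≠ 0) :
    IsUnit f := by
  have hc : ContDiffOn ℝ ∞ (fun x => (ext0 f.1 x)⁻¹) U :=
    (ext0_contDiffOn f).inv fun x hx => by rw [ext0_apply _ hx]; exact h _
  refine IsUnit.of_mul_eq_one ⟨fun x => (f.1 x)⁻¹, hc.congr fun x hx => ?_⟩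
    (smoothFn_ext fun x => mul_inv_cancel₀ (h x))
  rw [ext0_apply _ hx, ext0_apply _ hx]

/-- Every real character of `C^∞(U)` is the evaluation at a point of `U`: the sum of the squares
of the functions `x^i - χ(x^i)` and `f - χ(f)` is in the kernel of `χ`, so it has a zero. -/
theorem exists_eq_eval_of_character {U : Opens (Fin p → ℝ)} (χ : SmoothFn U →ₐ[ℝ] ℝ) :
    ∃ a : U, ∀ i, χ (smoothCoord U i) = a.1 i := by
  let g : SmoothFn U := ∑ i, (smoothCoord U i - algebraMap ℝ _ (χ (smoothCoord U i))) ^ 2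
  have hg : χ g = 0 := by simp [g]
  have : ¬ ∀ x, g.1 x ≠ 0 := fun h => ((smoothFn_isUnit g h).map χ).ne_zero hg
  push Not at this
  obtain ⟨a, ha⟩ := this
  refine ⟨a, fun i => ?_⟩
  have e : ∀ s : Finset (Fin p), (∑ i ∈ s, (smoothCoord U i -
      algebraMap ℝ (SmoothFn U) (χ (smoothCoord U i))) ^ 2).1 a =
      ∑ i ∈ s, (a.1 i - χ (smoothCoord U i)) ^ 2 := by
    intro s
    induction s using Finset.cons_induction with
    | empty => rfl
    | cons i s hi ih => rw [Finset.sum_cons, Finset.sum_cons, ← ih]; rfl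
  rw [e] at ha
  have := (Finset.sum_eq_zero_iff_of_nonneg fun i _ => sq_nonneg _).mp ha i (Finset.mem_univ i)
  exact (sub_eq_zero.mp (pow_eq_zero_iff two_ne_zero |>.mp this)).symm

end Hadamard

section Derivations

variable {p q N : ℕ} {U : Opens (Fin p → ℝ)}

theorem evalAt_mul (x : U) (f g : SFun q N U) : evalAt x (f * g) = evalAt x f * evalAt x g := by
  induction f using SFun.induction with
  | tmul f l =>
    induction g using SFun.induction with
    | tmul g m =>
      simp only [tm_mul, evalAt_tm, smul_mul_smul_comm]; rfl
    | add a b ha hb => rw [mul_add, map_add, ha, hb, map_add, mul_add]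
  | add a b ha hb => rw [add_mul, map_add, ha, hb, map_add, add_mul]

theorem evalAt_one (x : U) : evalAt x (1 : SFun q N U) = 1 := by
  rw [← tm_one, evalAt_tm]; exact one_smul _ _

theorem evalAt_parity (x : U) (f : SFun q N U) : evalAt x (parity f) = invol (evalAt x f) := by
  induction f using SFun.induction with
  | tmul f l => rw [parity_tm, evalAt_tm, evalAt_tm, map_smul]
  | add a b ha hb => rw [map_add, map_add, ha, hb, map_add, map_add]

/-- Smooth functions as superfunctions without odd generators. -/
def ofSmooth : SmoothFn U →ₐ[ℝ] SFun q N U := Algebra.TensorProduct.includeLeft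

theorem ofSmooth_apply (f : SmoothFn U) : (ofSmooth f : SFun q N U) = tm f 1 := rfl

theorem tm_eq_mul (f : SmoothFn U) (l : ExteriorAlgebra ℝ (Fin q ⊕ Fin N → ℝ)) :
    (tm f l : SFun q N U) = ofSmooth f * tm 1 l := by
  rw [ofSmooth_apply, tm_mul, mul_one, one_mul]

theorem parity_ofSmooth (f : SmoothFn U) : parity (ofSmooth f : SFun q N U) = ofSmooth f := by
  rw [ofSmooth_apply, parity_tm, map_one]

theorem extendByZero_single (b : Fin N) :
    Function.ExtendByZero.linearMap ℝ (Sum.inr : Fin N → Fin q ⊕ Fin N) (Pi.single b 1) =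
      Pi.single (Sum.inr b) 1 := by
  funext j
  rcases j with a | c
  · have h0 : ¬ ∃ b : Fin N, (Sum.inr b : Fin q ⊕ Fin N) = Sum.inl a := by simp
    have h1 : Function.extend (Sum.inr : Fin N → Fin q ⊕ Fin N) (Pi.single b (1 : ℝ)) 0
      (Sum.inl a) = 0 := Function.extend_apply' _ _ _ h0
    rw [Pi.single_eq_of_ne (by simp)]; exact h1
  · have h1 : Function.extend (Sum.inr : Fin N → Fin q ⊕ Fin N) (Pi.single b (1 : ℝ)) 0
      (Sum.inr c) = (Pi.single b 1 : Fin N → ℝ) c := Sum.inr_injective.extend_apply _ _ _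
    refine h1.trans ?_
    by_cases h : c = b
    · subst h; simp
    · rw [Pi.single_eq_of_ne h, Pi.single_eq_of_ne (by simpa using h)]

/-- A derivation along a homomorphism of superalgebras that kills the coordinates and the
constants is zero. On smooth functions this is checked at each point, where the homomorphism
becomes a point of the domain plus nilpotent corrections: by Hadamard's lemma the values of the
derivation lie in every power of a nilpotent ideal. -/
theorem derivation_eq_zero {p' q' K : ℕ} {V : Opens (Fin p' → ℝ)} (φ ψ : SFun q N U →ₐ[ℝ] SFun q' K V)
    (T : SFun q N U →ₗ[ℝ] SFun q' K V)
    (hφ : ∀ f : SmoothFn U, parity (φ (ofSmooth f)) = φ (ofSmooth f))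
    (hψ : ∀ f : SmoothFn U, ψ (ofSmooth f) = φ (ofSmooth f))
    (hT : ∀ f g, T (f * g) = T f * φ g + ψ f * T g) (hc : ∀ A, T (coord A) = 0)
    (hs : ∀ c, T (sconst c) = 0) : T = 0 := by
  have h1 : T 1 = 0 := by rw [← map_one (sconst (p := p) (q := q) (N := N) (U := U)), hs]
  -- on smooth functions, at a point `y`: the homomorphism followed by the evaluation at `y` lies
  -- over a point `a`, up to the nilpotent elements `n i`
  have hsm : ∀ f : SmoothFn U, T (ofSmooth f) = 0 := by
    intro f
    refine SFun.ext_evalAt fun y => ?_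
    rw [map_zero]
    let ev : SFun q' K V →ₐ[ℝ] ExteriorAlgebra ℝ (Fin q' ⊕ Fin K → ℝ) :=
      AlgHom.ofLinearMap (evalAt y) (evalAt_one y) (evalAt_mul y)
    obtain ⟨a, ha⟩ := exists_eq_eval_of_character
      (ExteriorAlgebra.algebraMapInv.comp (ev.comp (φ.comp ofSmooth)))
    let Z := Subalgebra.center ℝ (ExteriorAlgebra ℝ (Fin q' ⊕ Fin K → ℝ))
    let n : Fin p → ExteriorAlgebra ℝ (Fin q' ⊕ Fin K → ℝ) := fun i =>
      ev (φ (ofSmooth (smoothCoord U i - algebraMap ℝ _ (a.1 i))))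
    have hinv : ∀ i, invol (n i) = n i := fun i => by
      change invol (evalAt y _) = evalAt y _
      rw [← evalAt_parity, hφ]
    have hnil : ∀ i, IsNilpotent (n i) := fun i => by
      refine isNilpotent_of_body_eq_zero (hinv i) ?_
      have := ha i
      simp only [AlgHom.comp_apply] at this
      simp only [n, map_sub, this, AlgHom.commutes, sub_eq_zero]
      rfl
    have hcent : ∀ i, n i ∈ Z := fun i => by
      rw [Subalgebra.mem_center_iff]
      intro b
      have := even_commute (n i) b
      rw [hinv, ← two_smul ℝ] at this
      have h2 : ((2 : ℝ)⁻¹ • ((2 : ℝ) • n i)) = n i := by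
        rw [smul_smul]; norm_num
      rw [← h2]
      exact (this.smul_left (2 : ℝ)⁻¹).eq.symm
    let n' : Fin p → Z := fun i => ⟨n i, hcent i⟩
    let I : Ideal Z := Ideal.span (Set.range n')
    have hI : IsNilpotent I := by
      have hfg : I.FG := ⟨Set.range n' |>.toFinite.toFinset, by simp [I]⟩
      rw [hfg.isNilpotent_iff_le_nilradical, Ideal.span_le]
      rintro _ ⟨i, rfl⟩
      obtain ⟨k, hk⟩ := hnil i
      exact ⟨k, Subtype.ext hk⟩
    -- each use of Hadamard's lemma at `a` gains a factor in the nilpotent ideal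
    have key : ∀ k (f : SmoothFn U), evalAt y (T (ofSmooth f)) ∈
        (I ^ k • ⊤ : Submodule Z (ExteriorAlgebra ℝ (Fin q' ⊕ Fin K → ℝ))) := by
      intro k
      induction k with
      | zero => intro f; simp
      | succ k ih =>
        intro f
        obtain ⟨g, hg⟩ := hadamard f a
        have hx : ∀ i, T (ofSmooth (smoothCoord U i - algebraMap ℝ _ (a.1 i))) = 0 := fun i => by
          have h0 : T (ofSmooth (smoothCoord U i)) = 0 := hc (Sum.inl i)
          rw [map_sub, map_sub, h0, AlgHom.commutes, Algebra.algebraMap_eq_smul_one, map_smul, h1,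
            smul_zero, sub_zero]
        have e : evalAt y (T (ofSmooth f)) = ∑ i, n' i • evalAt y (T (ofSmooth (g i))) := by
          conv_lhs => rw [hg]
          rw [map_add, map_add, AlgHom.commutes, Algebra.algebraMap_eq_smul_one, map_smul, h1,
            smul_zero, zero_add, map_sum, map_sum, map_sum]
          refine Finset.sum_congr rfl fun i _ => ?_
          rw [map_mul, hT, hx, zero_mul, zero_add, hψ, evalAt_mul]
          rfl
        rw [e, pow_succ', Submodule.mul_smul]
        exact Submodule.sum_mem _ fun i _ => Submodule.smul_mem_smul
          (Ideal.subset_span ⟨i, rfl⟩) (ih _)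
    obtain ⟨k, hk⟩ := hI
    have := key k f
    rw [hk] at this
    simpa using this
  -- on the odd generators, among which are both odd coordinates and parameters
  have hι : ∀ v : Fin q ⊕ Fin N → ℝ, T (tm 1 (ExteriorAlgebra.ι ℝ v)) = 0 := by
    let S : (Fin q ⊕ Fin N → ℝ) →ₗ[ℝ] SFun q' K V :=
      { toFun := fun v => T (tm 1 (ExteriorAlgebra.ι ℝ v))
        map_add' := fun v w => by rw [map_add, tm_add, map_add]
        map_smul' := fun c v => by rw [map_smul, tm_smul, map_smul]; rfl }
    have hS : S = 0 := by
      refine LinearMap.pi_ext' fun j => LinearMap.ext_ring ?_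
      change T (tm 1 (ExteriorAlgebra.ι ℝ (Pi.single j 1))) = 0
      rcases j with a | b
      · exact hc (Sum.inr a)
      · have := hs (ExteriorAlgebra.ι ℝ (Pi.single b 1))
        rwa [sconst_eq, ExteriorAlgebra.map_apply_ι, extendByZero_single] at this
    intro v
    exact LinearMap.congr_fun hS v
  have hl : ∀ l : ExteriorAlgebra ℝ (Fin q ⊕ Fin N → ℝ), T (tm 1 l) = 0 := by
    intro l
    induction l using exterior_left_induction with
    | alg r => rw [Algebra.algebraMap_eq_smul_one, tm_smul, map_smul, tm_one, h1, smul_zero]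
    | add x y hx hy => rw [tm_add, map_add, hx, hy, add_zero]
    | mul x v hx =>
      have e : (tm 1 (ExteriorAlgebra.ι ℝ v * x) : SFun q N U) =
          tm 1 (ExteriorAlgebra.ι ℝ v) * tm 1 x := by rw [tm_mul, mul_one]
      rw [e, hT, hx, hι, zero_mul, mul_zero, add_zero]
  refine SFun.linearMap_ext fun f l => ?_
  rw [tm_eq_mul, hT, hsm, hl, zero_mul, mul_zero, add_zero]; rfl

end Derivations

section Calculus

variable {p q N : ℕ} {U V : Opens (Fin p → ℝ)}

/-! ### Homogeneous superfunctions -/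

/-- Homogeneity of a superfunction. -/
abbrev HP (n : ℕ) (f : SFun q N U) : Prop := HasParity parity n f

theorem HP.congr {m n : ℕ} {f : SFun q N U} (hf : HP m f) (h : m % 2 = n % 2) : HP n f := by
  rw [HP, HasParity, ← sg_congr h]; exact hf

theorem HP.mul {a b : ℕ} {f g : SFun q N U} (hf : HP a f) (hg : HP b g) : HP (a + b) (f * g) := by
  rw [HP, HasParity, map_mul, hf, hg, smul_mul_smul_comm, sg_add]

theorem HP.add {a : ℕ} {f g : SFun q N U} (hf : HP a f) (hg : HP a g) : HP a (f + g) := by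
  rw [HP, HasParity, map_add, hf, hg, smul_add]

theorem HP.smul {a : ℕ} {f : SFun q N U} (hf : HP a f) (c : ℝ) : HP a (c • f) := by
  rw [HP, HasParity, map_smul, hf, smul_comm]

theorem HP.sub {a : ℕ} {f g : SFun q N U} (hf : HP a f) (hg : HP a g) : HP a (f - g) := by
  rw [HP, HasParity, map_sub, hf, hg, smul_sub]

theorem HP.zero (a : ℕ) : HP a (0 : SFun q N U) := by
  rw [HP, HasParity, map_zero, smul_zero]

theorem HP.one : HP 0 (1 : SFun q N U) := by
  rw [HP, HasParity, map_one, sg_zero, one_smul]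

theorem HP.sum {ι : Type*} {s : Finset ι} {a : ℕ} {f : ι → SFun q N U} (h : ∀ i ∈ s, HP a (f i)) :
    HP a (∑ i ∈ s, f i) := by
  rw [HP, HasParity, map_sum, Finset.smul_sum]
  exact Finset.sum_congr rfl h

theorem HP.pd {a : ℕ} {f : SFun q N U} (hf : HP a f) (A : Idx p q) : HP (ε A + a) (pd A f) := by
  rw [HP, HasParity, parity_pd, hf, map_smul, smul_smul, sg_add]

theorem hp_coord (A : Idx p q) : HP (ε A) (coord A : SFun q N U) := parity_coord A

theorem HP.tw {a : ℕ} {f : SFun q N U} (hf : HP a f) (n : ℕ) : tw n f = sg (n * a) • f := by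
  induction n with
  | zero => rw [tw_zero, zero_mul, sg_zero, one_smul]
  | succ n ih =>
    rw [add_comm n 1, tw_add, ih, map_smul, tw_one, hf, smul_smul, add_mul, one_mul, sg_add,
      mul_comm]

/-- Supercommutativity for one homogeneous factor. -/
theorem HP.mul_eq_tw {a : ℕ} {f : SFun q N U} (hf : HP a f) (g : SFun q N U) :
    f * g = BV.tw a g * f := by
  have h := supercomm f g
  rw [hf] at h
  refine smul_right_injective _ (two_ne_zero (α := ℝ)) (h.trans ?_)
  rcases Nat.even_or_odd a with ha | ha
  · rw [sg_even ha, one_smul, sub_self, mul_zero, add_zero, mul_add, ← two_smul ℝ,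
      tw_congr (n := 0) (by simpa using Nat.even_iff.mp ha), tw_zero]
  · have : sg a = -1 := ha.neg_one_pow
    rw [this, neg_smul, one_smul, add_neg_cancel, mul_zero, zero_add, sub_neg_eq_add, mul_add,
      ← two_smul ℝ, tw_congr (n := 1) (by simpa using Nat.odd_iff.mp ha), tw_one]

theorem HP.comm {a b : ℕ} {f g : SFun q N U} (hf : HP a f) (hg : HP b g) :
    f * g = sg (a * b) • (g * f) := by
  rw [hf.mul_eq_tw, hg.tw, smul_mul_assoc]

theorem exists_even_add_odd (f : SFun q N U) : ∃ f₀ f₁, HP 0 f₀ ∧ HP 1 f₁ ∧ f = f₀ + f₁ := by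
  refine ⟨(1 / 2 : ℝ) • (f + parity f), (1 / 2 : ℝ) • (f - parity f), ?_, ?_, ?_⟩
  · rw [HP, HasParity, map_smul, map_add, parity_parity, sg_zero, one_smul, add_comm]
  · rw [HP, HasParity, map_smul, map_sub, parity_parity, sg_one, neg_smul, one_smul, ← smul_neg,
      neg_sub]
  · rw [← smul_add, add_add_sub_cancel, ← two_smul ℝ, smul_smul]; norm_num

/-- Linear operators that agree on homogeneous functions are equal. -/
theorem linearMap_ext_hp {X : Type*} [AddCommMonoid X] [Module ℝ X] {S T : SFun q N U →ₗ[ℝ] X}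
    (h : ∀ a f, HP a f → S f = T f) : S = T := by
  refine LinearMap.ext fun f => ?_
  obtain ⟨f₀, f₁, h₀, h₁, rfl⟩ := exists_even_add_odd f
  rw [map_add, map_add, h _ _ h₀, h _ _ h₁]

theorem HP.pd_mul {a : ℕ} {f : SFun q N U} (hf : HP a f) (A : Idx p q) (g : SFun q N U) :
    BV.pd A (f * g) = BV.pd A f * g + sg (ε A * a) • (f * BV.pd A g) := by
  rw [BV.pd_mul, hf.tw, smul_mul_assoc]

theorem HP.sres {a : ℕ} {f : SFun q N U} (hf : HP a f) (h : V ≤ U) : HP a (sres h f) := by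
  rw [HP, HasParity, ← sres_parity, hf, map_smul]

/-- A graded derivation of parity `n` that kills the coordinates and the constants is zero. -/
theorem tw_derivation_eq_zero (n : ℕ) (T : SFun q N U →ₗ[ℝ] SFun q N U)
    (hT : ∀ a f g, HP a f → T (f * g) = T f * g + sg (n * a) • (f * T g))
    (hc : ∀ A, T (coord A) = 0) (hs : ∀ c, T (sconst c) = 0) : T = 0 := by
  refine derivation_eq_zero (AlgHom.id ℝ _) (tw n) T (fun f => parity_ofSmooth f) (fun f => ?_)
    (fun f g => ?_) hc hs
  · have : HP 0 (ofSmooth f : SFun q N U) := by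
      rw [HP, HasParity, parity_ofSmooth, sg_zero, one_smul]
    rw [this.tw, mul_zero, sg_zero, one_smul]; rfl
  · obtain ⟨f₀, f₁, h₀, h₁, rfl⟩ := exists_even_add_odd f
    rw [add_mul, map_add, hT _ _ _ h₀, hT _ _ _ h₁, map_add, map_add, h₀.tw, h₁.tw, AlgHom.id_apply,
      add_mul, add_mul, smul_mul_assoc, smul_mul_assoc]
    abel

/-! ### The antibracket in coordinates -/

variable {E : Matrix (Idx p q) (Idx p q) (SFun q N U)}

/-- The antibracket `(f, g) = (f ∂⃖_A) E^{AB} (∂_B g)` in coordinates. -/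
def br (E : Matrix (Idx p q) (Idx p q) (SFun q N U)) :
    SFun q N U →ₗ[ℝ] SFun q N U →ₗ[ℝ] SFun q N U :=
  LinearMap.mk₂ ℝ (fun f g => ∑ A, ∑ B, tw (ε A) (pd A f) * (E A B * pd B g))
    (fun f f' g => by simp only [map_add, add_mul, Finset.sum_add_distrib])
    (fun c f g => by simp only [map_smul, smul_mul_assoc, Finset.smul_sum])
    (fun f g g' => by simp only [map_add, mul_add, Finset.sum_add_distrib])
    (fun c f g => by simp only [map_smul, mul_smul_comm, Finset.smul_sum])

theorem br_apply (f g : SFun q N U) :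
    br E f g = ∑ A, ∑ B, tw (ε A) (pd A f) * (E A B * pd B g) := rfl

theorem HP.br_apply {a : ℕ} {f : SFun q N U} (hf : HP a f) (g : SFun q N U) :
    br E f g = ∑ A, ∑ B, sg (ε A * (ε A + a)) • (BV.pd A f * (E A B * BV.pd B g)) := by
  simp only [BV.br_apply, (hf.pd _).tw, smul_mul_assoc]

theorem br_coord_left (A : Idx p q) (g : SFun q N U) :
    br E (coord A) g = ∑ B, E A B * pd B g := by
  rw [br_apply]
  simp only [pd_coord]
  rw [Finset.sum_eq_single A]
  · simp
  · intro C _ hC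
    simp [hC]
  · simp

theorem br_coord_right (f : SFun q N U) (B : Idx p q) :
    br E f (coord B) = ∑ A, tw (ε A) (pd A f) * E A B := by
  rw [br_apply]
  simp only [pd_coord]
  refine Finset.sum_congr rfl fun A _ => ?_
  rw [Finset.sum_eq_single B]
  · simp
  · intro C _ hC
    simp [hC]
  · simp

theorem br_coord_coord (A B : Idx p q) : br E (coord A) (coord B) = E A B := by
  rw [br_coord_left]
  simp [pd_coord]

theorem br_sconst_right (f : SFun q N U) (c : Grass N) : br E f (sconst c) = 0 := by
  simp [br_apply, pd_sconst]

theorem br_sconst_left (f : SFun q N U) (c : Grass N) : br E (sconst c) f = 0 := by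
  simp [br_apply, pd_sconst]

theorem IsOddSkew.hp (hE : IsOddSkew E) (A B : Idx p q) : HP (ε A + ε B + 1) (E A B) := hE.1 A B

theorem IsOddSkew.br_hp (hE : IsOddSkew E) {a b : ℕ} {f g : SFun q N U} (hf : HP a f)
    (hg : HP b g) : HP (a + b + 1) (br E f g) := by
  rw [hf.br_apply]
  refine HP.sum fun A _ => HP.sum fun B _ => HP.smul ?_ _
  exact ((hf.pd A).mul ((hE.hp A B).mul (hg.pd B))).congr (by omega)

theorem IsOddSkew.br_mul (hE : IsOddSkew E) {a b : ℕ} {f g : SFun q N U} (hf : HP a f)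
    (hg : HP b g) (h : SFun q N U) :
    br E f (g * h) = br E f g * h + sg ((a + 1) * b) • (g * br E f h) := by
  simp only [hf.br_apply, Finset.sum_mul, Finset.mul_sum, Finset.smul_sum,
    ← Finset.sum_add_distrib]
  refine Finset.sum_congr rfl fun A _ => Finset.sum_congr rfl fun B _ => ?_
  have e : pd A f * (E A B * g) = sg ((ε A + a + (ε A + ε B + 1)) * b) • (g * (pd A f * E A B)) := by
    rw [← mul_assoc, ((hf.pd A).mul (hE.hp A B)).comm hg]
  rw [hg.pd_mul, mul_add (E A B), mul_add (pd A f), smul_add, mul_smul_comm, mul_smul_comm,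
    ← mul_assoc (E A B) g, ← mul_assoc (pd A f) (E A B * g), e]
  simp only [smul_mul_assoc, mul_smul_comm, smul_smul, mul_assoc]
  congr 2
  simp only [← sg_add]
  apply sg_eq
  push_cast
  generalize (ε A : ZMod 2) = A', (ε B : ZMod 2) = B', (a : ZMod 2) = a', (b : ZMod 2) = b'
  decide +revert

theorem IsOddSkew.br_skew (hE : IsOddSkew E) {a b : ℕ} {f g : SFun q N U} (hf : HP a f)
    (hg : HP b g) : br E g f = -sg ((a + 1) * (b + 1)) • br E f g := by
  rw [hf.br_apply, hg.br_apply, Finset.sum_comm, Finset.smul_sum]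
  refine Finset.sum_congr rfl fun A _ => ?_
  rw [Finset.smul_sum]
  refine Finset.sum_congr rfl fun B _ => ?_
  rw [((hg.pd B).comm ((hE.hp B A).mul (hf.pd A))), ((hE.hp B A).comm (hf.pd A)), hE.2 B A]
  simp only [smul_mul_assoc, mul_smul_comm, smul_smul, mul_assoc, mul_neg, neg_mul,
    ← neg_smul]
  congr 1
  simp only [← sg_add, neg_sg]
  apply sg_eq
  push_cast
  generalize (ε A : ZMod 2) = A', (ε B : ZMod 2) = B', (a : ZMod 2) = a', (b : ZMod 2) = b'
  decide +revert

/-! ### The Laplacian -/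

theorem lap_apply (F : Idx p q → SFun q N U) (f : SFun q N U) :
    lap E F f = ∑ A, ∑ B, (sg (ε A) / 2) • (pd A (E A B * pd B f) + F A * (E A B * pd B f)) := by
  simp only [lap, LinearMap.sum_apply, LinearMap.smul_apply, LinearMap.comp_apply,
    LinearMap.add_apply, LinearMap.mulLeft_apply]

theorem lap_zero_apply (f : SFun q N U) :
    lap E 0 f = ∑ A, ∑ B, (sg (ε A) / 2) • pd A (E A B * pd B f) := by
  simp only [lap_apply, Pi.zero_apply, zero_mul, add_zero]

theorem lap_sconst (F : Idx p q → SFun q N U) (c : Grass N) : lap E F (sconst c) = 0 := by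
  simp [lap_apply, pd_sconst]

theorem lap_one (F : Idx p q → SFun q N U) : lap E F 1 = 0 := by
  simp [lap_apply, pd_one]

theorem IsOddSkew.lap_hp (hE : IsOddSkew E) {F : Idx p q → SFun q N U} (hF : IsConnParity F)
    {a : ℕ} {f : SFun q N U} (hf : HP a f) : HP (a + 1) (lap E F f) := by
  rw [lap_apply]
  refine HP.sum fun A _ => HP.sum fun B _ => HP.smul (HP.add ?_ ?_) _
  · exact (((hE.hp A B).mul (hf.pd B)).pd A).congr (by omega)
  · exact (HP.mul (hF A) ((hE.hp A B).mul (hf.pd B))).congr (by omega)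

theorem isConnParity_zero : IsConnParity (0 : Idx p q → SFun q N U) := fun _ => HP.zero _

/-- The Leibniz rule for `Δ_F`: the failure to be a derivation is the antibracket. -/
theorem IsOddSkew.lap_mul (hE : IsOddSkew E) {F : Idx p q → SFun q N U} (hF : IsConnParity F)
    {a : ℕ} {f : SFun q N U} (hf : HP a f) (g : SFun q N U) :
    lap E F (f * g) = lap E F f * g + sg a • (f * lap E F g) + sg a • br E f g := by
  have key : ∀ A B, (sg (ε A) / 2) • (pd A (E A B * pd B (f * g)) + F A * (E A B * pd B (f * g))) =
      (sg (ε A) / 2) • (pd A (E A B * pd B f) + F A * (E A B * pd B f)) * g +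
      sg a • (f * ((sg (ε A) / 2) • (pd A (E A B * pd B g) + F A * (E A B * pd B g)))) +
      ((1 / 2 : ℝ) • sg a • sg (ε B * (ε B + a)) • (pd B f * (E B A * pd A g)) +
        (1 / 2 : ℝ) • sg a • sg (ε A * (ε A + a)) • (pd A f * (E A B * pd B g))) := by
    intro A B
    have hx := hE.hp A B
    have e1 : E A B * (f * pd B g) = sg ((ε A + ε B + 1) * a) • (f * (E A B * pd B g)) := by
      rw [← mul_assoc, hx.comm hf, smul_mul_assoc, mul_assoc]
    have e2 : F A * (f * (E A B * pd B g)) = sg (ε A * a) • (f * (F A * (E A B * pd B g))) := by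
      rw [← mul_assoc, HP.comm (hF A) hf, smul_mul_assoc, mul_assoc]
    have e3 : (E A B * pd B f) * pd A g =
        -sg ((ε A + ε B + 1) * (ε B + a) + (ε A + 1) * (ε B + 1)) •
          (pd B f * (E B A * pd A g)) := by
      rw [hx.comm (hf.pd B), hE.2 A B]
      simp only [smul_mul_assoc, mul_smul_comm, smul_smul, mul_assoc, mul_neg,
        ← neg_smul, sg_add]
    have e4 : E A B * pd B (f * g) =
        (E A B * pd B f) * g + sg (ε A * a + a) • (f * (E A B * pd B g)) := by
      rw [hf.pd_mul, mul_add, ← mul_assoc, mul_smul_comm, e1, smul_smul]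
      congr 2
      simp only [← sg_add]
      apply sg_eq
      push_cast
      generalize (ε A : ZMod 2) = A', (ε B : ZMod 2) = B', (a : ZMod 2) = a'
      decide +revert
    rw [e4, map_add, map_smul, (hx.mul (hf.pd B)).pd_mul, hf.pd_mul, mul_add (F A), mul_smul_comm,
      e2, e3]
    have h2 : sg (ε A) * (sg (ε A * (ε A + ε B + 1 + (ε B + a))) *
        -sg ((ε A + ε B + 1) * (ε B + a) + (ε A + 1) * (ε B + 1))) =
        sg a * sg (ε B * (ε B + a)) := by
      simp only [← sg_add, neg_sg]
      apply sg_eq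
      push_cast
      generalize (ε A : ZMod 2) = A', (ε B : ZMod 2) = B', (a : ZMod 2) = a'
      decide +revert
    have h3 : sg (ε A) * sg (ε A * a + a) = sg a * sg (ε A * (ε A + a)) := by
      simp only [← sg_add]
      apply sg_eq
      push_cast
      generalize (ε A : ZMod 2) = A', (a : ZMod 2) = a'
      decide +revert
    have h4 : sg (ε A * a + a) * sg (ε A * a) = sg a := by
      simp only [← sg_add]
      apply sg_eq
      push_cast
      generalize (ε A : ZMod 2) = A', (a : ZMod 2) = a'
      decide +revert
    simp only [smul_mul_assoc, mul_smul_comm, smul_smul, smul_add, add_mul (R := SFun q N U),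
      mul_add f, mul_assoc]
    linear_combination (norm := module) ((1 / 2 : ℝ) • h2) • (pd B f * (E B A * pd A g))
      + ((1 / 2 : ℝ) • h3) • (pd A f * (E A B * pd B g))
      + ((sg (ε A) / 2 : ℝ) • h4) • (f * pd A (E A B * pd B g))
      + ((sg (ε A) / 2 : ℝ) • h4) • (f * (F A * (E A B * pd B g)))
  rw [lap_apply, lap_apply, lap_apply]
  simp only [key, Finset.sum_add_distrib]
  rw [hf.br_apply]
  simp only [Finset.sum_mul, Finset.mul_sum, Finset.smul_sum]
  rw [Finset.sum_comm (f := fun A B => (1 / 2 : ℝ) • sg a • sg (ε B * (ε B + a)) •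
    (pd B f * (E B A * pd A g)))]
  rw [← Finset.sum_add_distrib (f := fun A => ∑ B, (1 / 2 : ℝ) • sg a • sg (ε A * (ε A + a)) •
    (pd A f * (E A B * pd B g)))]
  congr 1
  refine Finset.sum_congr rfl fun A _ => ?_
  rw [← Finset.sum_add_distrib]
  refine Finset.sum_congr rfl fun B _ => ?_
  module

end Calculus

section Jacobi

variable {p q N : ℕ} {U V : Opens (Fin p → ℝ)}
variable {E : Matrix (Idx p q) (Idx p q) (SFun q N U)}

/-! ### The Jacobi identity -/

/-- The Jacobi identity for the antibracket on a superdomain. -/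
def JacobiBr (E : Matrix (Idx p q) (Idx p q) (SFun q N U)) : Prop :=
  ∀ (a b c : ℕ) (f g h : SFun q N U), HP a f → HP b g → HP c h →
    sg ((a + 1) * (c + 1)) • br E f (br E g h) + sg ((b + 1) * (a + 1)) • br E g (br E h f)
      + sg ((c + 1) * (b + 1)) • br E h (br E f g) = 0

/-- The Jacobi identity for the coordinate functions. -/
def JacobiCoord (E : Matrix (Idx p q) (Idx p q) (SFun q N U)) : Prop :=
  ∀ A B C : Idx p q,
    sg ((ε A + 1) * (ε C + 1)) • br E (coord A) (E B C)
      + sg ((ε B + 1) * (ε A + 1)) • br E (coord B) (E C A)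
      + sg ((ε C + 1) * (ε B + 1)) • br E (coord C) (E A B) = 0

/-- The cyclic form of the Jacobi identity in terms of its Leibniz form. -/
theorem IsOddSkew.jacobi_cyclic_eq (hE : IsOddSkew E) {a b c : ℕ} {f g h : SFun q N U}
    (hf : HP a f) (hg : HP b g) (hh : HP c h) :
    sg ((a + 1) * (c + 1)) • br E f (br E g h) + sg ((b + 1) * (a + 1)) • br E g (br E h f)
      + sg ((c + 1) * (b + 1)) • br E h (br E f g) =
    sg ((a + 1) * (c + 1)) • (br E f (br E g h) - br E (br E f g) h
      - sg ((a + 1) * (b + 1)) • br E g (br E f h)) := by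
  rw [hE.br_skew hf hh, hE.br_skew (hE.br_hp hf hg) hh, map_smul, smul_sub, smul_sub, smul_smul,
    smul_smul, smul_smul]
  have h1 : sg ((b + 1) * (a + 1)) * -sg ((a + 1) * (c + 1)) =
      -(sg ((a + 1) * (c + 1)) * sg ((a + 1) * (b + 1))) := by
    rw [mul_comm (b + 1)]; ring
  have h2 : sg ((c + 1) * (b + 1)) * -sg ((a + b + 1 + 1) * (c + 1)) = -sg ((a + 1) * (c + 1)) := by
    simp only [← sg_add, neg_sg]
    apply sg_eq
    push_cast
    generalize (a : ZMod 2) = a', (b : ZMod 2) = b', (c : ZMod 2) = c'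
    decide +revert
  rw [h1, h2]
  module

theorem JacobiBr.leibniz (hJ : JacobiBr E) (hE : IsOddSkew E) {a b : ℕ} {f g : SFun q N U}
    (hf : HP a f) (hg : HP b g) (h : SFun q N U) :
    br E f (br E g h) = br E (br E f g) h + sg ((a + 1) * (b + 1)) • br E g (br E f h) := by
  have key : br E f ∘ₗ br E g = br E (br E f g) + sg ((a + 1) * (b + 1)) • (br E g ∘ₗ br E f) := by
    refine linearMap_ext_hp fun c h hh => ?_
    have h1 := hE.jacobi_cyclic_eq hf hg hh
    rw [hJ a b c f g h hf hg hh] at h1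
    have h2 := congrArg (fun x => sg ((a + 1) * (c + 1)) • x) h1
    simp only [smul_zero, smul_smul, sg_mul_self, one_smul] at h2
    rw [sub_sub, eq_comm, sub_eq_zero] at h2
    exact h2
  exact LinearMap.congr_fun key h

/-- The Leibniz form of the Jacobi identity holds for all functions in the last slot as soon as it
holds for the coordinates there. -/
theorem IsOddSkew.jacobiator_eq_zero (hE : IsOddSkew E) {a b : ℕ} {f g : SFun q N U} (hf : HP a f)
    (hg : HP b g) (hc : ∀ C, br E f (br E g (coord C)) - br E (br E f g) (coord C)
      - sg ((a + 1) * (b + 1)) • br E g (br E f (coord C)) = 0) (h : SFun q N U) :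
    br E f (br E g h) - br E (br E f g) h - sg ((a + 1) * (b + 1)) • br E g (br E f h) = 0 := by
  have key : br E f ∘ₗ br E g - br E (br E f g) - sg ((a + 1) * (b + 1)) • (br E g ∘ₗ br E f) = 0 := by
    refine tw_derivation_eq_zero (a + b) _ (fun c h k hh => ?_) hc fun c => ?_
    · simp only [LinearMap.sub_apply, LinearMap.comp_apply, LinearMap.smul_apply]
      rw [hE.br_mul hg hh, hE.br_mul hf hh, hE.br_mul (hE.br_hp hf hg) hh, map_add, map_smul,
        map_add, map_smul, hE.br_mul hf (hE.br_hp hg hh), hE.br_mul hf hh,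
        hE.br_mul hg (hE.br_hp hf hh), hE.br_mul hg hh]
      have h1 : sg ((a + 1) * (b + c + 1)) =
          sg ((a + 1) * (b + 1)) * sg ((a + 1) * c) := by
        rw [← sg_add]; congr 1; ring
      have h2 : sg ((b + 1) * (a + c + 1)) =
          sg ((a + 1) * (b + 1)) * sg ((b + 1) * c) := by
        rw [← sg_add]; congr 1; ring
      have h3 : sg ((a + b + 1 + 1) * c) = sg ((a + 1) * c) * sg ((b + 1) * c) := by
        rw [← sg_add]; congr 1; ring
      have h4 : sg ((a + b) * c) = sg ((a + 1) * c) * sg ((b + 1) * c) := by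
        rw [← sg_add]; apply sg_eq; push_cast
        generalize (a : ZMod 2) = a', (b : ZMod 2) = b', (c : ZMod 2) = c'
        decide +revert
      have h5 := sg_mul_self ((a + 1) * (b + 1))
      rw [h1, h2, h3, h4]
      generalize sg ((a + 1) * (b + 1)) = s at h5 ⊢
      simp only [sub_mul (α := SFun q N U), mul_sub h, smul_mul_assoc, mul_smul_comm, smul_sub,
        smul_add, smul_smul]
      linear_combination (norm := module)
        (sg ((b + 1) * c) • h5) • (-(br E f h * br E g k))
    · simp [br_sconst_right]
  exact LinearMap.congr_fun key h

/-- The Jacobi identity only has to be checked on coordinates. It holds for all functions in the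
last slot as soon as it holds for coordinates there, and cyclic rotations move the other slots into
that place. -/
theorem IsOddSkew.jacobiBr_iff (hE : IsOddSkew E) : JacobiBr E ↔ JacobiCoord E := by
  constructor
  · intro hJ A B C
    have := hJ _ _ _ _ _ _ (hp_coord A) (hp_coord B) (hp_coord C)
    simpa only [br_coord_coord] using this
  · intro hJ
    have hz : ∀ {a b c : ℕ} {f g h : SFun q N U}, HP a f → HP b g → HP c h →
        ((sg ((a + 1) * (c + 1)) • br E f (br E g h) + sg ((b + 1) * (a + 1)) • br E g (br E h f)
          + sg ((c + 1) * (b + 1)) • br E h (br E f g) = 0) ↔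
        br E f (br E g h) - br E (br E f g) h - sg ((a + 1) * (b + 1)) • br E g (br E f h) = 0) := by
      intro a b c f g h hf hg hh
      rw [hE.jacobi_cyclic_eq hf hg hh]
      have h0 : sg ((a + 1) * (c + 1)) ≠ 0 := fun h0 => by
        have := sg_mul_self ((a + 1) * (c + 1)); rw [h0] at this; norm_num at this
      exact smul_eq_zero_iff_right h0
    have rot : ∀ {x y z : SFun q N U}, x + y + z = 0 → y + z + x = 0 := fun h => by
      rw [← h]; abel
    -- two slots, and then one slot, are filled with coordinates
    have s1 : ∀ A B {c : ℕ} {h : SFun q N U}, HP c h → _ := fun A B c h hh =>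
      (hz (hp_coord A) (hp_coord B) hh).mpr (hE.jacobiator_eq_zero (hp_coord A) (hp_coord B)
        (fun C => (hz (hp_coord A) (hp_coord B) (hp_coord C)).mp (by
          simpa only [br_coord_coord] using hJ A B C)) h)
    have s2 : ∀ A {b c : ℕ} {g h : SFun q N U}, HP b g → HP c h → _ := fun A b c g h hg hh =>
      (hz (hp_coord A) hg hh).mpr (hE.jacobiator_eq_zero (hp_coord A) hg
        (fun C => (hz (hp_coord A) hg (hp_coord C)).mp (rot (s1 C A hg))) h)
    intro a b c f g h hf hg hh
    exact (hz hf hg hh).mpr (hE.jacobiator_eq_zero hf hg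
        (fun C => (hz hf hg (hp_coord C)).mp (rot (s2 C hf hg))) h)

/-! ### The inverse matrix -/

theorem mul_lower (hU : IsUnit E) (A C : Idx p q) :
    ∑ B, E A B * lower E B C = if A = C then 1 else 0 := by
  have := congrFun (congrFun (Ring.mul_inverse_cancel E hU) A) C
  rwa [Matrix.mul_apply, Matrix.one_apply] at this

theorem lower_mul (hU : IsUnit E) (A C : Idx p q) :
    ∑ B, lower E A B * E B C = if A = C then 1 else 0 := by
  have := congrFun (congrFun (Ring.inverse_mul_cancel E hU) A) C
  rwa [Matrix.mul_apply, Matrix.one_apply] at this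

theorem eq_lower (hU : IsUnit E) {e : Matrix (Idx p q) (Idx p q) (SFun q N U)}
    (h : ∀ A C, ∑ B, E A B * e B C = if A = C then 1 else 0) : lower E = e := by
  have h1 : E * e = 1 := by
    ext A C : 2
    rw [Matrix.mul_apply, h, Matrix.one_apply]
  calc lower E = lower E * (E * e) := by rw [h1, mul_one]
    _ = e := by rw [← mul_assoc, lower, Ring.inverse_mul_cancel E hU, one_mul]

theorem eq_zero_of_sum_mul (hU : IsUnit E) {y : Idx p q → SFun q N U}
    (h : ∀ C, ∑ D, y D * E D C = 0) (A : Idx p q) : y A = 0 := by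
  have h1 : ∑ C, (∑ D, y D * E D C) * lower E C A = y A := by
    simp only [Finset.sum_mul, mul_assoc]
    rw [Finset.sum_comm]
    simp only [← Finset.mul_sum, mul_lower hU, mul_ite, mul_one, mul_zero]
    simp
  rw [← h1]
  simp [h]

theorem eq_zero_of_sum_mul_left (hU : IsUnit E) {y : Idx p q → SFun q N U}
    (h : ∀ C, ∑ D, E C D * y D = 0) (A : Idx p q) : y A = 0 := by
  have h1 : ∑ C, lower E A C * (∑ D, E C D * y D) = y A := by
    simp only [Finset.mul_sum, ← mul_assoc]
    rw [Finset.sum_comm]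
    simp only [← Finset.sum_mul, lower_mul hU, ite_mul, one_mul, zero_mul]
    simp
  rw [← h1]
  simp [h]

theorem IsOddSkew.lower_hp (hE : IsOddSkew E) (hU : IsUnit E) (A B : Idx p q) :
    HP (ε A + ε B + 1) (lower E A B) := by
  have h : lower E = Matrix.of fun A B => sg (ε A + ε B + 1) • parity (lower E A B) := by
    refine eq_lower hU fun A C => ?_
    have h1 : ∀ B, E A B * (sg (ε B + ε C + 1) • parity (lower E B C)) =
        sg (ε A + ε C) • parity (E A B * lower E B C) := by
      intro B
      rw [map_mul, hE.hp A B, smul_mul_assoc, mul_smul_comm, smul_smul, ← sg_add]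
      congr 1
      apply sg_eq; push_cast
      generalize (ε A : ZMod 2) = A', (ε B : ZMod 2) = B', (ε C : ZMod 2) = C'
      decide +revert
    simp only [Matrix.of_apply, h1]
    rw [← Finset.smul_sum, ← map_sum, mul_lower hU]
    split_ifs with hAC
    · rw [hAC, map_one, sg_even (Even.add_self _), one_smul]
    · rw [map_zero, smul_zero]
  have h2 := congrFun (congrFun h A) B
  rw [Matrix.of_apply] at h2
  rw [HP, HasParity]
  conv_rhs => rw [h2, smul_smul, sg_mul_self, one_smul]

theorem IsOddSkew.lower_skew (hE : IsOddSkew E) (hU : IsUnit E) (A B : Idx p q) :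
    lower E A B = -sg (ε A * ε B) • lower E B A := by
  have h : lower E = Matrix.of fun A B => -sg (ε A * ε B) • lower E B A := by
    refine eq_lower hU fun A C => ?_
    have h1 : ∀ B, E A B * (-sg (ε B * ε C) • lower E C B) =
        sg (ε A * ε C + ε C) • (lower E C B * E B A) := by
      intro B
      rw [mul_smul_comm, (hE.hp A B).comm (hE.lower_hp hU C B), hE.2 A B, mul_neg, mul_smul_comm,
        smul_smul, smul_neg, smul_smul, ← neg_smul]
      congr 1
      simp only [← sg_add, neg_sg]
      apply sg_eq; push_cast
      generalize (ε A : ZMod 2) = A', (ε B : ZMod 2) = B', (ε C : ZMod 2) = C'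
      decide +revert
    simp only [Matrix.of_apply, h1]
    rw [← Finset.smul_sum, lower_mul hU]
    by_cases hAC : A = C
    · subst hAC
      rw [if_pos rfl, sg_even, one_smul]
      rcases ε_cases A with hA | hA <;> rw [hA] <;> decide
    · rw [if_neg hAC, if_neg (Ne.symm hAC), smul_zero]
  exact congrFun (congrFun h A) B

/-- The derivative of the inverse matrix determines that of the matrix. -/
theorem IsOddSkew.pd_eq (hE : IsOddSkew E) (hU : IsUnit E) (D B C : Idx p q) :
    pd D (E B C) = -∑ M, ∑ K, sg (ε D * (ε B + ε M + 1)) •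
      (E B M * (pd D (lower E M K) * E K C)) := by
  have h0 : ∀ K, ∑ M, (pd D (E B M) * lower E M K +
      sg (ε D * (ε B + ε M + 1)) • (E B M * pd D (lower E M K))) = 0 := by
    intro K
    have := congrArg (pd D) (mul_lower hU B K)
    rw [map_sum] at this
    simp only [(hE.hp B _).pd_mul] at this
    rw [this]
    split_ifs
    · exact pd_one D
    · exact map_zero _
  have h1 : ∑ K, (∑ M, (pd D (E B M) * lower E M K +
      sg (ε D * (ε B + ε M + 1)) • (E B M * pd D (lower E M K)))) * E K C = 0 := by
    simp [h0]
  simp only [Finset.sum_add_distrib, add_mul, Finset.sum_mul, smul_mul_assoc, mul_assoc] at h1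
  rw [Finset.sum_comm] at h1
  simp only [← Finset.mul_sum, lower_mul hU] at h1
  simp only [mul_ite, mul_one, mul_zero, Finset.sum_ite_eq', Finset.mem_univ, if_true] at h1
  rw [Finset.sum_comm] at h1
  exact eq_neg_of_add_eq_zero_left h1

/-! ### The Jacobi identity and closedness -/

theorem sum_rotate {ι X : Type*} [Fintype ι] [AddCommMonoid X] (f : ι → ι → ι → X) :
    ∑ A, ∑ B, ∑ C, f A B C = ∑ C, ∑ A, ∑ B, f A B C := by
  rw [Finset.sum_comm' (t' := Finset.univ) (s' := fun _ => Finset.univ) (by simp)]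
  calc ∑ B, ∑ A, ∑ C, f A B C = ∑ B, ∑ C, ∑ A, f A B C :=
        Finset.sum_congr rfl fun _ _ => Finset.sum_comm
    _ = ∑ C, ∑ B, ∑ A, f A B C := Finset.sum_comm
    _ = _ := Finset.sum_congr rfl fun _ _ => Finset.sum_comm

theorem HP.mul_rotate {a b c x : ℕ} {f g h X : SFun q N U} (hf : HP a f) (hg : HP b g)
    (hh : HP c h) (hX : HP x X) : g * (h * (X * f)) =
      sg (b * a + c * (x + a) + x * a) • (f * (g * (X * h))) := by
  rw [hh.comm (hX.mul hf), hX.comm hf, mul_smul_comm, smul_mul_assoc, mul_smul_comm, mul_assoc f,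
    ← mul_assoc g f, hg.comm hf, smul_mul_assoc, smul_smul, smul_smul, mul_assoc f,
    sg_add, sg_add]
  congr 1
  ring

theorem HP.mul_swap_outer {a b c x : ℕ} {f g h X : SFun q N U} (hf : HP a f) (hg : HP b g)
    (hh : HP c h) (hX : HP x X) : h * (f * (X * g)) =
      sg (c * (a + (x + b)) + x * b) • (f * (g * (X * h))) := by
  rw [hh.comm (hf.mul (hX.mul hg)), hX.comm hg, mul_smul_comm, smul_mul_assoc, smul_smul,
    mul_assoc f, mul_assoc g, sg_add]

/-- The Jacobi identity is the closedness of the inverse matrix, with its indices raised. -/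
theorem IsOddSkew.jacobiCoord_eq (hE : IsOddSkew E) (hU : IsUnit E) (A B C : Idx p q) :
    sg ((ε A + 1) * (ε C + 1)) • br E (coord A) (E B C)
      + sg ((ε B + 1) * (ε A + 1)) • br E (coord B) (E C A)
      + sg ((ε C + 1) * (ε B + 1)) • br E (coord C) (E A B) =
    -sg ((ε A + 1) * (ε C + 1)) • ∑ K, (∑ D, E A D * ((sg (ε D * ε B + ε D + ε D * ε K)) • ∑ M,
      E B M * (sg (ε D * ε M) • (sg (ε D * ε K) • pd D (lower E M K) +
        sg (ε M * ε D) • pd M (lower E K D) + sg (ε K * ε M) • pd K (lower E D M))))) * E K C := by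
  have hX : ∀ D M K : Idx p q, HP (ε D + (ε M + ε K + 1)) (pd D (lower E M K)) := fun D M K =>
    (hE.lower_hp hU M K).pd D
  have t1 : br E (coord A) (E B C) = -∑ K, ∑ D, ∑ M, sg (ε D * (ε B + ε M + 1)) •
      (E A D * (E B M * (pd D (lower E M K) * E K C))) := by
    rw [br_coord_left, ← sum_rotate, ← Finset.sum_neg_distrib]
    refine Finset.sum_congr rfl fun D _ => ?_
    rw [hE.pd_eq hU, mul_neg, Finset.mul_sum]
    simp only [Finset.mul_sum, mul_smul_comm]
  have t2 : br E (coord B) (E C A) = -∑ K, ∑ D, ∑ M, sg (ε M * (ε C + ε K + 1)) •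
      (E B M * (E C K * (pd M (lower E K D) * E D A))) := by
    rw [br_coord_left, sum_rotate (f := fun K D M => sg (ε M * (ε C + ε K + 1)) •
      (E B M * (E C K * (pd M (lower E K D) * E D A)))), ← Finset.sum_neg_distrib]
    refine Finset.sum_congr rfl fun D _ => ?_
    rw [hE.pd_eq hU, mul_neg, Finset.mul_sum]
    simp only [Finset.mul_sum, mul_smul_comm]
  have t3 : br E (coord C) (E A B) = -∑ K, ∑ D, ∑ M, sg (ε K * (ε A + ε D + 1)) •
      (E C K * (E A D * (pd K (lower E D M) * E M B))) := by
    rw [br_coord_left, ← Finset.sum_neg_distrib]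
    refine Finset.sum_congr rfl fun D _ => ?_
    rw [hE.pd_eq hU, mul_neg, Finset.mul_sum]
    simp only [Finset.mul_sum, mul_smul_comm]
  rw [t1, t2, t3]
  simp only [Finset.mul_sum, Finset.sum_mul, Finset.smul_sum, ← Finset.sum_neg_distrib,
    ← Finset.sum_add_distrib]
  refine Finset.sum_congr rfl fun K _ => Finset.sum_congr rfl fun D _ =>
    Finset.sum_congr rfl fun M _ => ?_
  rw [(hE.hp D A).mul_rotate (hE.hp B M) (hE.hp C K) (hX M K D),
    (hE.hp A D).mul_swap_outer (hE.hp M B) (hE.hp C K) (hX K D M), hE.2 D A, hE.2 C K, hE.2 M B]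
  simp only [mul_neg, neg_mul, mul_smul_comm, smul_mul_assoc, smul_smul, neg_neg,
    mul_add (R := SFun q N U), add_mul (R := SFun q N U), smul_add, mul_assoc (G := SFun q N U), ← neg_smul]
  have e : ∀ (x y z x' y' z' : SFun q N U), x = x' → y = y' → z = z' → x + y + z = x' + y' + z' := by
    rintro x y z _ _ _ rfl rfl rfl; rfl
  apply e
  all_goals
    congr 1
    simp only [← sg_add, neg_sg]
    apply sg_eq
    push_cast
    generalize (ε A : ZMod 2) = A', (ε B : ZMod 2) = B', (ε C : ZMod 2) = C',
      (ε D : ZMod 2) = D', (ε M : ZMod 2) = M', (ε K : ZMod 2) = K'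
    decide +revert

theorem IsOddSkew.jacobiCoord_iff (hE : IsOddSkew E) (hU : IsUnit E) :
    JacobiCoord E ↔ IsClosedForm (lower E) := by
  constructor
  · intro h D M K
    have hm : ∀ n : ℕ, ∀ x : SFun q N U, sg n • x = 0 → x = 0 := fun n x hx => by
      have := congrArg (fun y => sg n • y) hx
      simpa only [smul_zero, smul_smul, sg_mul_self, one_smul] using this
    have h1 : ∀ A B C, ∑ K, (∑ D, E A D * ((sg (ε D * ε B + ε D + ε D * ε K)) • ∑ M,
      E B M * (sg (ε D * ε M) • (sg (ε D * ε K) • pd D (lower E M K) +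
        sg (ε M * ε D) • pd M (lower E K D) + sg (ε K * ε M) • pd K (lower E D M))))) * E K C = 0 := by
      intro A B C
      have := h A B C
      rw [hE.jacobiCoord_eq hU, neg_smul, neg_eq_zero] at this
      exact hm _ _ this
    have h2 := fun A B => eq_zero_of_sum_mul hU (h1 A B) K
    have h3 := fun B => hm _ _ (eq_zero_of_sum_mul_left hU (fun A => h2 A B) D)
    exact hm _ _ (eq_zero_of_sum_mul_left hU h3 M)
  · intro h A B C
    rw [hE.jacobiCoord_eq hU]
    have h' := fun D M K => h D M K
    simp only [h', smul_zero, mul_zero, Finset.sum_const_zero, zero_mul]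

end Jacobi

section Square

variable {p q N : ℕ} {U V : Opens (Fin p → ℝ)}
variable {E : Matrix (Idx p q) (Idx p q) (SFun q N U)}

/-! ### The Laplacian without connection as a derivation of the antibracket -/

/-- The divergence `(-1)^{ε_A} ∂_A E^{AC}`, which is `2 Δ₁ Γ^C`. -/
def divE (E : Matrix (Idx p q) (Idx p q) (SFun q N U)) (C : Idx p q) : SFun q N U :=
  ∑ A, sg (ε A) • pd A (E A C)

theorem IsOddSkew.divE_hp (hE : IsOddSkew E) (C : Idx p q) : HP (ε C + 1) (divE E C) := by
  refine HP.sum fun A _ => HP.smul (((hE.hp A C).pd A).congr (by omega)) _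

theorem lap_zero_eq_br (f : SFun q N U) :
    lap E 0 f = (1 / 2 : ℝ) • ∑ A, sg (ε A) • pd A (br E (coord A) f) := by
  rw [lap_zero_apply, Finset.smul_sum]
  refine Finset.sum_congr rfl fun A _ => ?_
  rw [br_coord_left, map_sum, Finset.smul_sum, Finset.smul_sum]
  refine Finset.sum_congr rfl fun B _ => ?_
  rw [smul_smul]; congr 1; ring

theorem lap_coord (C : Idx p q) : lap E 0 (coord C) = (1 / 2 : ℝ) • divE E C := by
  simp only [lap_zero_eq_br, br_coord_coord, divE]

theorem nu1_eq : nu1 E = ∑ B, pd B (divE E B) := by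
  simp only [nu1, divE, map_sum, map_smul]
  exact Finset.sum_comm

/-- Given the Jacobi identity, `Δ₁` differentiates the antibrackets of the coordinates. -/
theorem IsOddSkew.lap_E (hE : IsOddSkew E) (hJ : JacobiBr E) (A B : Idx p q) :
    lap E 0 (E A B) = (1 / 2 : ℝ) • (br E (divE E A) (coord B)
      - sg (ε A) • br E (coord A) (divE E B)) := by
  rw [lap_zero_eq_br]
  congr 1
  have h1 : ∀ M, br E (coord M) (E A B) = br E (E M A) (coord B) +
      sg ((ε M + 1) * (ε A + 1)) • br E (coord A) (E M B) := by
    intro M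
    have := hJ.leibniz hE (hp_coord M) (hp_coord A) (coord B)
    simpa only [br_coord_coord] using this
  have hd : ∀ C D B : Idx p q, HP (ε C + (ε D + ε B + 1)) (pd C (E D B)) := fun C D B =>
    (hE.hp D B).pd C
  have h2 : ∑ M, sg (ε M) • pd M (br E (E M A) (coord B)) = br E (divE E A) (coord B) +
      ∑ M, ∑ K, sg (ε K + ε K * ε A + ε M * ε A) • (pd M (E K A) * pd K (E M B)) := by
    rw [Finset.sum_comm (f := fun M K => sg (ε K + ε K * ε A + ε M * ε A) •
      (pd M (E K A) * pd K (E M B)))]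
    simp only [br_coord_right, ((hE.divE_hp A).pd _).tw, ((hE.hp _ A).pd _).tw, smul_mul_assoc]
    simp only [divE, map_sum, map_smul, Finset.sum_mul, Finset.smul_sum]
    rw [Finset.sum_comm (f := fun K M => sg (ε K * (ε K + (ε A + 1))) •
      (sg (ε M) • pd K (pd M (E M A)) * E K B)), ← Finset.sum_add_distrib]
    refine Finset.sum_congr rfl fun M _ => ?_
    rw [← Finset.sum_add_distrib]
    refine Finset.sum_congr rfl fun K _ => ?_
    rw [(hd K M A).pd_mul, pd_comm M K]
    simp only [smul_add, smul_mul_assoc, smul_smul, ← sg_add]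
    congr 2
    all_goals
      apply sg_eq
      push_cast
      generalize (ε A : ZMod 2) = A', (ε K : ZMod 2) = K', (ε M : ZMod 2) = M'
      decide +revert
  have h3 : ∑ M, sg (ε M) • pd M (sg ((ε M + 1) * (ε A + 1)) • br E (coord A) (E M B)) =
      -(sg (ε A) • br E (coord A) (divE E B)) -
      ∑ M, ∑ K, sg (ε K + ε K * ε A + ε M * ε A) • (pd M (E K A) * pd K (E M B)) := by
    have e1 : sg (ε A) • br E (coord A) (divE E B) =
        ∑ M, ∑ K, (sg (ε A) * sg (ε M)) • (E A K * pd K (pd M (E M B))) := by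
      rw [Finset.sum_comm, br_coord_left, Finset.smul_sum]
      refine Finset.sum_congr rfl fun K _ => ?_
      rw [divE, map_sum, Finset.mul_sum, Finset.smul_sum]
      refine Finset.sum_congr rfl fun M _ => ?_
      rw [map_smul, mul_smul_comm, smul_smul]
    rw [e1, ← Finset.sum_neg_distrib, ← Finset.sum_sub_distrib]
    refine Finset.sum_congr rfl fun M _ => ?_
    rw [br_coord_left, ← Finset.sum_neg_distrib, ← Finset.sum_sub_distrib, Finset.smul_sum,
      map_sum, Finset.smul_sum]
    refine Finset.sum_congr rfl fun K _ => ?_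
    have e2 : pd M (E A K) * pd K (E M B) =
        -(sg ((ε A + 1) * (ε K + 1)) • (pd M (E K A) * pd K (E M B))) := by
      conv_lhs => rw [hE.2 A K, map_neg, map_smul, neg_mul, smul_mul_assoc]
    rw [map_smul, (hE.hp A K).pd_mul, pd_comm M K, e2, mul_smul_comm]
    simp only [smul_add, smul_smul, ← sg_add, sub_eq_add_neg, ← neg_smul, neg_sg]
    rw [add_comm]
    congr 2
    all_goals
      apply sg_eq
      push_cast
      generalize (ε A : ZMod 2) = A', (ε K : ZMod 2) = K', (ε M : ZMod 2) = M'
      decide +revert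
  simp only [h1, map_add, smul_add, Finset.sum_add_distrib]
  rw [h2, h3]
  abel

/-- The defect of `Δ₁` as a derivation of the antibracket is graded symmetric. -/
theorem IsOddSkew.lapDefect_symm (hE : IsOddSkew E) {a b : ℕ} {f g : SFun q N U} (hf : HP a f)
    (hg : HP b g)
    (h : lap E 0 (br E f g) = br E (lap E 0 f) g - sg a • br E f (lap E 0 g)) :
    lap E 0 (br E g f) = br E (lap E 0 g) f - sg b • br E g (lap E 0 f) := by
  have hf' := hE.lap_hp isConnParity_zero hf
  have hg' := hE.lap_hp isConnParity_zero hg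
  rw [hE.br_skew hf hg, map_smul, h, hE.br_skew hf hg', hE.br_skew hf' hg]
  simp only [smul_sub, smul_smul, ← sg_add, neg_sg]
  rw [sub_eq_add_neg, add_comm, sub_eq_add_neg]
  simp only [← neg_smul, neg_sg]
  congr 2
  all_goals
    apply sg_eq
    push_cast
    generalize (a : ZMod 2) = a', (b : ZMod 2) = b'
    decide +revert

/-- The defect of `Δ₁` as a derivation of the antibracket is a derivation in its second argument,
hence it vanishes if it does so on coordinates. -/
theorem IsOddSkew.lap_br_of_coord (hE : IsOddSkew E) (hJ : JacobiBr E) {a : ℕ} {f : SFun q N U}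
    (hf : HP a f) (hc : ∀ B, lap E 0 (br E f (coord B)) =
      br E (lap E 0 f) (coord B) - sg a • br E f (lap E 0 (coord B))) (g : SFun q N U) :
    lap E 0 (br E f g) = br E (lap E 0 f) g - sg a • br E f (lap E 0 g) := by
  have h0 := isConnParity_zero (p := p) (q := q) (N := N) (U := U)
  have hf' := hE.lap_hp h0 hf
  have key : lap E 0 ∘ₗ br E f - br E (lap E 0 f) + sg a • (br E f ∘ₗ lap E 0) = 0 := by
    refine tw_derivation_eq_zero a _ (fun b g h hg => ?_) (fun A => ?_) fun c => ?_
    · simp only [LinearMap.sub_apply, LinearMap.add_apply, LinearMap.comp_apply,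
        LinearMap.smul_apply]
      have hJ' := hJ.leibniz hE hf hg h
      rw [hE.br_mul hf hg, map_add, map_smul, hE.lap_mul h0 (hE.br_hp hf hg), hE.lap_mul h0 hg,
        hE.lap_mul h0 hg, hE.br_mul hf' hg, map_add, map_add, map_smul, map_smul,
        hE.br_mul hf (hE.lap_hp h0 hg), hE.br_mul hf hg, hJ']
      have h1 : sg (a + b + 1) = -(sg a * sg b) := by rw [sg_add, sg_add, sg_one]; ring
      have h2 : sg ((a + 1) * b) = sg (a * b) * sg b := by rw [← sg_add]; congr 1; ring
      have h3 : sg ((a + 1) * (b + 1)) = -(sg (a * b) * sg a * sg b) := by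
        rw [← sg_add, ← sg_add, neg_sg]; congr 1; ring
      have h4 : sg ((a + 1 + 1) * b) = sg (a * b) := by
        rw [add_assoc, add_mul, sg_add, sg_even (n := (1 + 1) * b) (by simp [parity_simps]),
          mul_one]
      rw [h1, h2, h3, h4]
      have ha := sg_mul_self a
      have hb := sg_mul_self b
      generalize sg a = s at ha ⊢
      generalize sg b = t at hb ⊢
      generalize sg (a * b) = z
      simp only [sub_mul (α := SFun q N U), add_mul (R := SFun q N U), mul_sub g, mul_add g,
        smul_mul_assoc, mul_smul_comm, smul_sub, smul_add, smul_smul]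
      linear_combination (norm := module)
        (-(z * t) • ha) • (lap E 0 g * br E f h) + (z • hb) • (g * lap E 0 (br E f h)) -
        ((z * t * t) • ha) • br E g (br E f h) + ((z * s) • hb) • (g * br E f (lap E 0 h))
    · simp only [LinearMap.sub_apply, LinearMap.add_apply, LinearMap.comp_apply,
        LinearMap.smul_apply, hc]
      abel
    · simp [br_sconst_right, lap_sconst]
  have := LinearMap.congr_fun key g
  simp only [LinearMap.sub_apply, LinearMap.add_apply, LinearMap.comp_apply,
        LinearMap.smul_apply, LinearMap.zero_apply] at this
  rw [← sub_eq_zero, ← this]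
  abel

/-- Given the Jacobi identity, `Δ₁` is a derivation of the antibracket. -/
theorem IsOddSkew.lap_br (hE : IsOddSkew E) (hJ : JacobiBr E) {a : ℕ} {f : SFun q N U}
    (hf : HP a f) (g : SFun q N U) :
    lap E 0 (br E f g) = br E (lap E 0 f) g - sg a • br E f (lap E 0 g) := by
  have h1 : ∀ A (g : SFun q N U), lap E 0 (br E (coord A) g) =
      br E (lap E 0 (coord A)) g - sg (ε A) • br E (coord A) (lap E 0 g) := by
    intro A
    refine hE.lap_br_of_coord hJ (hp_coord A) fun B => ?_
    rw [br_coord_coord, hE.lap_E hJ, lap_coord, lap_coord, map_smul, map_smul,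
      LinearMap.smul_apply]
    module
  exact hE.lap_br_of_coord hJ hf (fun B =>
    hE.lapDefect_symm (hp_coord B) hf (h1 B f)) g

/-- Given the Jacobi identity, `Δ₁²` is a derivation. -/
theorem IsOddSkew.lap_lap_mul (hE : IsOddSkew E) (hJ : JacobiBr E) {a : ℕ} {f : SFun q N U}
    (hf : HP a f) (g : SFun q N U) :
    lap E 0 (lap E 0 (f * g)) = lap E 0 (lap E 0 f) * g + f * lap E 0 (lap E 0 g) := by
  have h0 := isConnParity_zero (p := p) (q := q) (N := N) (U := U)
  rw [hE.lap_mul h0 hf, map_add, map_add, map_smul, map_smul, hE.lap_mul h0 (hE.lap_hp h0 hf),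
    hE.lap_mul h0 hf, hE.lap_br hJ hf, sg_add, sg_one]
  have ha := sg_mul_self a
  generalize sg a = s at ha ⊢
  linear_combination (norm := module) ha • (f * lap E 0 (lap E 0 g))

/-- The commutator of `Δ₁` with a partial derivative. -/
theorem IsOddSkew.pd_lap (hE : IsOddSkew E) (A : Idx p q) (f : SFun q N U) :
    pd A (lap E 0 f) = sg (ε A) • lap E 0 (pd A f) +
      (1 / 2 : ℝ) • ∑ M, ∑ K, sg (ε M + ε A * ε M) • pd M (pd A (E M K) * pd K f) := by
  simp only [lap_zero_apply, map_sum, map_smul, Finset.smul_sum, ← Finset.sum_add_distrib]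
  refine Finset.sum_congr rfl fun M _ => Finset.sum_congr rfl fun K _ => ?_
  rw [pd_comm A M, (hE.hp M K).pd_mul, pd_comm A K]
  simp only [map_add, map_smul, mul_smul_comm, smul_add, smul_smul]
  have h : sg (ε A * ε M) * (sg (ε A * (ε M + ε K + 1)) * sg (ε A * ε K)) = sg (ε A) := by
    simp only [← sg_add]
    apply sg_eq
    push_cast
    generalize (ε A : ZMod 2) = A', (ε K : ZMod 2) = K', (ε M : ZMod 2) = M'
    decide +revert
  rw [sg_add, add_comm]
  congr 2
  · linear_combination (sg (ε M) / 2) * h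
  · ring

/-- The quadratic part of `Δ₁²` on coordinates. -/
def quadY (E : Matrix (Idx p q) (Idx p q) (SFun q N U)) (C : Idx p q) : SFun q N U :=
  ∑ A, ∑ M, ∑ K, sg (ε M + ε M * ε K) • (pd A (E M K) * pd M (pd K (E A C)))

/-- The square of `Δ₁` on coordinates, up to a factor two: the sum `∂_A Δ₁ E^{AC}` is computed once
by commuting `∂_A` with `Δ₁`, and once by differentiating the antibracket `E^{AC}`. -/
theorem IsOddSkew.lap_divE (hE : IsOddSkew E) (hJ : JacobiBr E) (C : Idx p q) :
    lap E 0 (divE E C) = (1 / 4 : ℝ) • br E (nu1 E) (coord C) - (1 / 4 : ℝ) • quadY E C := by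
  have hd : ∀ A D : Idx p q, HP (ε D + (ε A + 1)) (pd D (divE E A)) := fun A D =>
    (hE.divE_hp A).pd D
  have h1 : ∑ A, pd A (lap E 0 (E A C)) = lap E 0 (divE E C) +
      (1 / 2 : ℝ) • (∑ A, ∑ K, pd A (divE E K) * pd K (E A C) + quadY E C) := by
    simp only [hE.pd_lap, Finset.sum_add_distrib]
    congr 1
    · simp only [divE, map_sum, map_smul]
    · rw [← Finset.smul_sum, quadY, ← Finset.sum_add_distrib]
      congr 1
      refine Finset.sum_congr rfl fun A _ => ?_
      have e : ∑ K, pd A (divE E K) * pd K (E A C) =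
          ∑ M, ∑ K, sg (ε M) • (pd A (pd M (E M K)) * pd K (E A C)) := by
        rw [Finset.sum_comm]
        simp only [divE, map_sum, map_smul, Finset.sum_mul, smul_mul_assoc]
      rw [e, ← Finset.sum_add_distrib]
      refine Finset.sum_congr rfl fun M _ => ?_
      rw [← Finset.sum_add_distrib]
      refine Finset.sum_congr rfl fun K _ => ?_
      rw [((hE.hp M K).pd A).pd_mul, pd_comm A M]
      simp only [smul_add, smul_smul, ← sg_add, smul_mul_assoc]
      congr 2
      apply sg_eq
      push_cast
      generalize (ε A : ZMod 2) = A', (ε K : ZMod 2) = K', (ε M : ZMod 2) = M'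
      decide +revert
  have h2 : ∑ A, pd A (lap E 0 (E A C)) = (1 / 2 : ℝ) • (br E (nu1 E) (coord C) +
      ∑ A, ∑ K, pd A (divE E K) * pd K (E A C)) - lap E 0 (divE E C) := by
    simp only [hE.lap_E hJ, map_smul, map_sub, smul_sub, Finset.sum_sub_distrib]
    congr 1
    · rw [← Finset.smul_sum]
      congr 1
      rw [br_coord_right, nu1_eq]
      simp only [map_sum, Finset.sum_mul, br_coord_right]
      rw [Finset.sum_comm, ← Finset.sum_add_distrib]
      refine Finset.sum_congr rfl fun D _ => ?_
      rw [← Finset.sum_add_distrib]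
      refine Finset.sum_congr rfl fun A _ => ?_
      rw [pd_comm D A, map_smul, (hd A D).tw, smul_mul_assoc, map_smul, (hd A D).pd_mul,
        ((hd A D).pd A).tw]
      simp only [smul_add, smul_mul_assoc, smul_smul, ← sg_add]
      congr 1
      · congr 1
        apply sg_eq
        push_cast
        generalize (ε A : ZMod 2) = A', (ε D : ZMod 2) = D'
        decide +revert
      · rw [sg_even, one_smul]
        rw [Nat.even_iff, ← Nat.even_iff, ← ZMod.natCast_eq_zero_iff_even]
        push_cast
        generalize (ε A : ZMod 2) = A', (ε D : ZMod 2) = D'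
        decide +revert
    · rw [lap_zero_eq_br, Finset.smul_sum]
  rw [h1, ← sub_eq_zero] at h2
  linear_combination (norm := module) (1 / 2 : ℝ) • h2

/-! ### The Hamiltonian vector field of `ν^{(2)}` -/

theorem sum4_reverse {ι X : Type*} [Fintype ι] [AddCommMonoid X] (f : ι → ι → ι → ι → X) :
    ∑ A, ∑ B, ∑ C, ∑ D, f A B C D = ∑ A, ∑ B, ∑ C, ∑ D, f D C B A := by
  simp only [← Fintype.sum_prod_type']
  exact Fintype.sum_equiv ⟨fun x => (x.2.2.2, x.2.2.1, x.2.1, x.1),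
    fun x => (x.2.2.2, x.2.2.1, x.2.1, x.1), fun _ => rfl, fun _ => rfl⟩ _ _ fun _ => rfl

theorem sum5_reverse {ι X : Type*} [Fintype ι] [AddCommMonoid X] (f : ι → ι → ι → ι → ι → X) :
    ∑ A, ∑ B, ∑ C, ∑ D, ∑ M, f A B C D M = ∑ A, ∑ B, ∑ C, ∑ D, ∑ M, f D C B A M := by
  simp only [← Fintype.sum_prod_type']
  exact Fintype.sum_equiv ⟨fun x => (x.2.2.2.1, x.2.2.1, x.2.1, x.1, x.2.2.2.2),
    fun x => (x.2.2.2.1, x.2.2.1, x.2.1, x.1, x.2.2.2.2), fun _ => rfl, fun _ => rfl⟩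
    _ _ fun _ => rfl

theorem sum5_swap {ι X : Type*} [Fintype ι] [AddCommMonoid X] (f : ι → ι → ι → ι → ι → X) :
    ∑ A, ∑ B, ∑ C, ∑ D, ∑ M, f A B C D M = ∑ A, ∑ B, ∑ C, ∑ D, ∑ M, f A M C D B := by
  simp only [← Fintype.sum_prod_type']
  exact Fintype.sum_equiv ⟨fun x => (x.1, x.2.2.2.2, x.2.2.1, x.2.2.2.1, x.2.1),
    fun x => (x.1, x.2.2.2.2, x.2.2.1, x.2.2.2.1, x.2.1), fun _ => rfl, fun _ => rfl⟩
    _ _ fun _ => rfl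

theorem sum5_cycle {ι X : Type*} [Fintype ι] [AddCommMonoid X] (f : ι → ι → ι → ι → ι → X) :
    ∑ A, ∑ B, ∑ C, ∑ D, ∑ M, f A B C D M = ∑ A, ∑ B, ∑ C, ∑ D, ∑ M, f D C B M A := by
  simp only [← Fintype.sum_prod_type']
  exact Fintype.sum_equiv ⟨fun x => (x.2.2.2.2, x.2.2.1, x.2.1, x.1, x.2.2.2.1),
    fun x => (x.2.2.2.1, x.2.2.1, x.2.1, x.2.2.2.2, x.1), fun _ => rfl, fun _ => rfl⟩
    _ _ fun _ => rfl

theorem sum5_second_last {ι X : Type*} [Fintype ι] [AddCommMonoid X] (f : ι → ι → ι → ι → ι → X) :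
    ∑ A, ∑ B, ∑ C, ∑ D, ∑ M, f A B C D M = ∑ A, ∑ C, ∑ D, ∑ M, ∑ B, f A B C D M := by
  simp only [← Fintype.sum_prod_type']
  exact Fintype.sum_equiv ⟨fun x => (x.1, x.2.2.1, x.2.2.2.1, x.2.2.2.2, x.2.1),
    fun x => (x.1, x.2.2.2.2, x.2.1, x.2.2.1, x.2.2.2.1), fun _ => rfl, fun _ => rfl⟩
    _ _ fun _ => rfl

theorem sum5_first_last {ι X : Type*} [Fintype ι] [AddCommMonoid X] (f : ι → ι → ι → ι → ι → X) :
    ∑ A, ∑ B, ∑ C, ∑ D, ∑ M, f A B C D M = ∑ B, ∑ C, ∑ D, ∑ M, ∑ A, f A B C D M := by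
  simp only [← Fintype.sum_prod_type']
  exact Fintype.sum_equiv ⟨fun x => (x.2.1, x.2.2.1, x.2.2.2.1, x.2.2.2.2, x.1),
    fun x => (x.2.2.2.2, x.1, x.2.1, x.2.2.1, x.2.2.2.1), fun _ => rfl, fun _ => rfl⟩
    _ _ fun _ => rfl

theorem HP.mul_reverse {a b c : ℕ} {f g h : SFun q N U} (hf : HP a f) (hg : HP b g)
    (hh : HP c h) : f * (g * h) = sg (a * (b + c) + b * c) • (h * (g * f)) := by
  rw [hf.comm (hg.mul hh), hg.comm hh, smul_mul_assoc, smul_smul, sg_add, mul_assoc]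

theorem HP.mul_reverse₄ {a b c d : ℕ} {f g h k : SFun q N U} (hf : HP a f) (hg : HP b g)
    (hh : HP c h) (hk : HP d k) : f * (g * (h * k)) =
      sg (a * (b + (c + d)) + b * (c + d) + c * d) • (k * (h * (g * f))) := by
  rw [hf.comm (hg.mul (hh.mul hk)), hg.mul_reverse hh hk]
  simp only [smul_mul_assoc, smul_smul, mul_assoc (G := SFun q N U), ← sg_add, add_assoc]

theorem IsOddSkew.br_coord_pd (hE : IsOddSkew E) (K D : Idx p q) (f : SFun q N U) :
    br E (coord K) (pd D f) = sg ((ε K + 1) * ε D) •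
      (pd D (br E (coord K) f) - ∑ M, pd D (E K M) * pd M f) := by
  rw [br_coord_left, br_coord_left, map_sum, ← Finset.sum_sub_distrib, Finset.smul_sum]
  refine Finset.sum_congr rfl fun M _ => ?_
  rw [(hE.hp K M).pd_mul, add_sub_cancel_left, pd_comm D M, mul_smul_comm, smul_smul, smul_smul]
  simp only [← sg_add]
  rw [sg_even, one_smul]
  rw [← ZMod.natCast_eq_zero_iff_even]
  push_cast
  generalize (ε K : ZMod 2) = A', (ε D : ZMod 2) = D', (ε M : ZMod 2) = M'
  decide +revert

theorem IsOddSkew.br_coord_E (hE : IsOddSkew E) (hJ : JacobiBr E) (K A B : Idx p q) :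
    br E (coord K) (E A B) = ∑ M, (sg (ε M * (ε K + ε A)) • (pd M (E K A) * E M B) +
      sg ((ε K + 1) * (ε A + 1)) • (E A M * pd M (E K B))) := by
  have h := hJ.leibniz hE (hp_coord K) (hp_coord A) (coord B)
  rw [br_coord_coord, br_coord_coord, br_coord_coord] at h
  rw [h, br_coord_left, br_coord_right, Finset.smul_sum, ← Finset.sum_add_distrib]
  refine Finset.sum_congr rfl fun M _ => ?_
  rw [((hE.hp K A).pd M).tw, smul_mul_assoc]
  congr 2
  apply sg_eq
  push_cast
  generalize (ε K : ZMod 2) = K', (ε A : ZMod 2) = A', (ε M : ZMod 2) = M'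
  decide +revert

/-- The Hamiltonian vector field of a coordinate, on the first derivatives of the antibracket. -/
theorem IsOddSkew.br_coord_pd_E (hE : IsOddSkew E) (hJ : JacobiBr E) (K D A B : Idx p q) :
    br E (coord K) (pd D (E A B)) = ∑ M,
      (sg ((ε K + 1) * ε D + ε M * (ε K + ε A)) • (pd D (pd M (E K A)) * E M B) +
      sg ((ε K + 1) * ε D + ε M * (ε K + ε A) + ε D * (ε M + ε K + ε A + 1)) •
        (pd M (E K A) * pd D (E M B)) +
      sg ((ε K + 1) * ε D + (ε K + 1) * (ε A + 1)) • (pd D (E A M) * pd M (E K B)) +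
      sg ((ε K + 1) * ε D + (ε K + 1) * (ε A + 1) + ε D * (ε A + ε M + 1)) •
        (E A M * pd D (pd M (E K B))) -
      sg ((ε K + 1) * ε D) • (pd D (E K M) * pd M (E A B))) := by
  rw [hE.br_coord_pd, hE.br_coord_E hJ, map_sum, ← Finset.sum_sub_distrib, Finset.smul_sum]
  refine Finset.sum_congr rfl fun M _ => ?_
  rw [map_add, map_smul, map_smul, ((hE.hp K A).pd M).pd_mul, (hE.hp A M).pd_mul]
  simp only [smul_sub, smul_add, smul_smul, sg_add, ← add_assoc, mul_assoc]

/-- The Hamiltonian vector field of a coordinate, on the inverse matrix. -/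
theorem IsOddSkew.br_coord_lower (hE : IsOddSkew E) (hU : IsUnit E) (hJ : JacobiBr E)
    (K D C : Idx p q) : br E (coord K) (lower E D C) = -∑ M,
      (sg ((ε K + 1) * (ε D + ε M + 1) + ε C * (ε K + ε M)) • (lower E D M * pd C (E K M)) +
        sg ((ε K + 1) * ε D) • (pd D (E K M) * lower E M C)) := by
  have h0 : ∀ B, ∑ A, (br E (coord K) (lower E D A) * E A B +
      sg ((ε K + 1) * (ε D + ε A + 1)) • (lower E D A * br E (coord K) (E A B))) = 0 := by
    intro B
    have := congrArg (br E (coord K)) (lower_mul hU D B)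
    rw [map_sum] at this
    simp only [hE.br_mul (hp_coord K) (hE.lower_hp hU _ _)] at this
    rw [this]
    split_ifs
    · rw [br_coord_left]; simp [pd_one]
    · exact map_zero _
  have h1 : ∑ B, (∑ A, (br E (coord K) (lower E D A) * E A B +
      sg ((ε K + 1) * (ε D + ε A + 1)) • (lower E D A * br E (coord K) (E A B)))) *
        lower E B C = 0 := by
    simp [h0]
  have h2 : ∑ B, (∑ A, br E (coord K) (lower E D A) * E A B) * lower E B C =
      br E (coord K) (lower E D C) := by
    simp only [Finset.sum_mul, mul_assoc]
    rw [Finset.sum_comm]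
    simp only [← Finset.mul_sum, mul_lower hU]
    simp
  have h3 : ∑ B, (∑ A, sg ((ε K + 1) * (ε D + ε A + 1)) •
      (lower E D A * ∑ M, sg (ε M * (ε K + ε A)) • (pd M (E K A) * E M B))) * lower E B C =
      ∑ A, sg ((ε K + 1) * (ε D + ε A + 1) + ε C * (ε K + ε A)) •
        (lower E D A * pd C (E K A)) := by
    simp only [Finset.sum_mul, Finset.mul_sum, Finset.smul_sum, mul_smul_comm, smul_mul_assoc,
      mul_assoc]
    rw [Finset.sum_comm]
    refine Finset.sum_congr rfl fun A _ => ?_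
    rw [Finset.sum_comm]
    simp only [← Finset.smul_sum, ← Finset.mul_sum, mul_lower hU]
    simp [smul_smul, sg_add]
  have h4 : ∑ B, (∑ A, sg ((ε K + 1) * (ε D + ε A + 1)) •
      (lower E D A * ∑ M, sg ((ε K + 1) * (ε A + 1)) • (E A M * pd M (E K B)))) * lower E B C =
      ∑ B, sg ((ε K + 1) * ε D) • (pd D (E K B) * lower E B C) := by
    refine Finset.sum_congr rfl fun B _ => ?_
    rw [← smul_mul_assoc]
    congr 1
    have h5 : ∀ A, sg ((ε K + 1) * (ε D + ε A + 1)) •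
      (lower E D A * ∑ M, sg ((ε K + 1) * (ε A + 1)) • (E A M * pd M (E K B))) =
        sg ((ε K + 1) * ε D) • (∑ M, lower E D A * E A M * pd M (E K B)) := by
      intro A
      simp only [← Finset.smul_sum, mul_smul_comm, smul_smul, Finset.mul_sum, mul_assoc]
      congr 1
      rw [← sg_add]
      apply sg_eq
      push_cast
      generalize (ε K : ZMod 2) = K', (ε A : ZMod 2) = A', (ε D : ZMod 2) = D'
      decide +revert
    simp only [h5]
    rw [← Finset.smul_sum, Finset.sum_comm]
    simp only [← Finset.sum_mul, lower_mul hU]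
    simp
  simp only [hE.br_coord_E hJ, Finset.sum_add_distrib, mul_add (R := SFun q N U), smul_add,
    add_mul (R := SFun q N U)] at h1
  rw [h2] at h1
  rw [eq_neg_iff_add_eq_zero, Finset.sum_add_distrib, ← h3, ← h4]
  exact h1

theorem IsOddSkew.pd_E_hp (hE : IsOddSkew E) (D A B : Idx p q) :
    HP (ε D + (ε A + ε B + 1)) (pd D (E A B)) := (hE.hp A B).pd D

theorem IsOddSkew.pd_E_skew (hE : IsOddSkew E) (D A B : Idx p q) :
    pd D (E A B) = -(sg ((ε A + 1) * (ε B + 1)) • pd D (E B A)) := by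
  conv_lhs => rw [hE.2 A B]
  rw [map_neg, map_smul]

/-- The Leibniz rule for `(Γ^K, ν^{(2)})`. Reversing the order of the factors identifies the terms
from the two outer factors with each other, and likewise the two terms from the middle one, whence
the factors two. -/
theorem IsOddSkew.br_coord_nu2 (hE : IsOddSkew E) (hU : IsUnit E) (hJ : JacobiBr E)
    (K : Idx p q) : br E (coord K) (nu2 E) =
      (2 : ℝ) • (∑ A, ∑ B, ∑ C, ∑ D, sg (ε A * ε C) •
        (br E (coord K) (pd D (E A B)) * (lower E B C * pd A (E C D)))) -
      (2 : ℝ) • (∑ A, ∑ B, ∑ C, ∑ D, ∑ M,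
        sg (ε A * ε C + (ε K + 1) * (ε D + ε A + 1)) •
          (pd D (E A B) * (pd B (E K M) * (lower E M C * pd A (E C D))))) := by
  have hx := hE.pd_E_hp
  have he := hE.lower_hp hU
  have hk := hp_coord (U := U) (N := N) K
  have hL := fun D A B => hE.br_hp hk (hx D A B)
  have h3 : ∑ A, ∑ B, ∑ C, ∑ D, sg (ε A * ε C + (ε K + 1) * (ε D + ε A + ε C)) •
        (pd D (E A B) * (lower E B C * br E (coord K) (pd A (E C D)))) =
      ∑ A, ∑ B, ∑ C, ∑ D, sg (ε A * ε C) •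
        (br E (coord K) (pd D (E A B)) * (lower E B C * pd A (E C D))) := by
    rw [sum4_reverse]
    refine Finset.sum_congr rfl fun A _ => Finset.sum_congr rfl fun B _ =>
      Finset.sum_congr rfl fun C _ => Finset.sum_congr rfl fun D _ => ?_
    rw [(hx A D C).mul_reverse (he C B) (hL D B A), hE.pd_E_skew A D C, hE.pd_E_skew D B A,
      hE.lower_skew hU C B]
    simp only [map_smul, mul_neg, neg_mul, mul_smul_comm, smul_mul_assoc, smul_smul,
      ← neg_smul, neg_neg]
    congr 1
    simp only [← sg_add, neg_sg]
    apply sg_eq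
    push_cast
    generalize (ε A : ZMod 2) = A', (ε B : ZMod 2) = B', (ε C : ZMod 2) = C',
      (ε D : ZMod 2) = D', (ε K : ZMod 2) = K'
    decide +revert
  have h2 : ∑ A, ∑ B, ∑ C, ∑ D, ∑ M, sg (ε A * ε C + (ε K + 1) * (ε D + ε A + ε B + 1) +
        (ε K + 1) * (ε B + ε M + 1) + ε C * (ε K + ε M)) •
        (pd D (E A B) * (lower E B M * (pd C (E K M) * pd A (E C D)))) =
      ∑ A, ∑ B, ∑ C, ∑ D, ∑ M,
        sg (ε A * ε C + (ε K + 1) * (ε D + ε A + 1)) •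
          (pd D (E A B) * (pd B (E K M) * (lower E M C * pd A (E C D)))) := by
    rw [sum5_reverse]
    refine Finset.sum_congr rfl fun A _ => Finset.sum_congr rfl fun B _ =>
      Finset.sum_congr rfl fun C _ => Finset.sum_congr rfl fun D _ =>
      Finset.sum_congr rfl fun M _ => ?_
    rw [(hx A D C).mul_reverse₄ (he C M) (hx B K M) (hx D B A), hE.pd_E_skew A D C,
      hE.pd_E_skew D B A, hE.lower_skew hU C M]
    simp only [mul_neg, neg_mul, mul_smul_comm, smul_mul_assoc, smul_smul,
      ← neg_smul, neg_neg]
    congr 1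
    simp only [← sg_add, neg_sg]
    apply sg_eq
    push_cast
    generalize (ε A : ZMod 2) = A', (ε B : ZMod 2) = B', (ε C : ZMod 2) = C',
      (ε D : ZMod 2) = D', (ε K : ZMod 2) = K', (ε M : ZMod 2) = M'
    decide +revert
  have h1 : ∀ A B C D, br E (coord K) (sg (ε A * ε C) • (pd D (E A B) * lower E B C *
      pd A (E C D))) =
      sg (ε A * ε C) • (br E (coord K) (pd D (E A B)) * (lower E B C * pd A (E C D))) -
      ∑ M, sg (ε A * ε C + (ε K + 1) * (ε D + ε A + ε B + 1) +
        (ε K + 1) * (ε B + ε M + 1) + ε C * (ε K + ε M)) •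
        (pd D (E A B) * (lower E B M * (pd C (E K M) * pd A (E C D)))) -
      ∑ M, sg (ε A * ε C + (ε K + 1) * (ε D + ε A + 1)) •
          (pd D (E A B) * (pd B (E K M) * (lower E M C * pd A (E C D)))) +
      sg (ε A * ε C + (ε K + 1) * (ε D + ε A + ε C)) •
        (pd D (E A B) * (lower E B C * br E (coord K) (pd A (E C D)))) := by
    intro A B C D
    rw [map_smul, mul_assoc, hE.br_mul hk (hx D A B), hE.br_mul hk (he B C),
      hE.br_coord_lower hU hJ K B C, Finset.sum_add_distrib, neg_mul, add_mul (R := SFun q N U),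
      mul_add (pd D (E A B)), mul_neg, mul_add (R := SFun q N U), Finset.sum_mul,
      Finset.sum_mul, Finset.mul_sum, Finset.mul_sum, smul_add, smul_add, smul_add, smul_neg,
      smul_neg, smul_add, smul_add]
    have e : ∀ {w x y z x' y' z' : SFun q N U}, x = x' → y = y' → z = z' →
        w + (-(x + y) + z) = w - x' - y' + z' := by
      rintro w x y z _ _ _ rfl rfl rfl; abel
    simp only [Finset.smul_sum, mul_smul_comm, smul_mul_assoc, smul_smul,
      mul_assoc (G := SFun q N U)]
    refine e (Finset.sum_congr rfl fun M _ => ?_) (Finset.sum_congr rfl fun M _ => ?_) ?_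
    all_goals
      congr 1
      simp only [← sg_add]
      apply sg_eq
      push_cast
      generalize (ε A : ZMod 2) = A', (ε B : ZMod 2) = B', (ε C : ZMod 2) = C',
        (ε D : ZMod 2) = D', (ε K : ZMod 2) = K'
      try generalize (ε M : ZMod 2) = M'
      decide +revert
  simp only [nu2, map_sum, h1, Finset.sum_add_distrib, Finset.sum_sub_distrib]
  rw [h2, h3]
  module

theorem sum_contract (hU : IsUnit E) (M C : Idx p q) (s : ℝ) (X Z : SFun q N U) :
    ∑ B, s • (X * E M B * (lower E B C * Z)) = if M = C then s • (X * Z) else 0 := by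
  have : ∀ B, s • (X * E M B * (lower E B C * Z)) = s • (X * ((E M B * lower E B C) * Z)) :=
    fun B => by simp only [mul_assoc]
  simp only [this, ← Finset.smul_sum, ← Finset.mul_sum, ← Finset.sum_mul, mul_lower hU]
  split_ifs <;> simp

/-- The terms of `(Γ^K, ν^{(2)})` in which `E^{KA}` is differentiated twice, with a contraction
`E^{MB} E_{BC}`. -/
theorem IsOddSkew.nu2_secondDeriv₁ (hE : IsOddSkew E) (hU : IsUnit E) (K : Idx p q) :
    ∑ A, ∑ B, ∑ C, ∑ D, ∑ M,
      sg (ε A * ε C + ((ε K + 1) * ε D + ε M * (ε K + ε A))) •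
        (pd D (pd M (E K A)) * E M B * (lower E B C * pd A (E C D))) = -quadY E K := by
  rw [sum5_second_last]
  simp only [sum_contract hU, Finset.sum_ite_eq', Finset.mem_univ, if_true]
  rw [quadY, ← Finset.sum_neg_distrib]
  refine Finset.sum_congr rfl fun A _ => ?_
  rw [← Finset.sum_neg_distrib]
  refine Finset.sum_congr rfl fun C _ => ?_
  rw [← Finset.sum_neg_distrib]
  refine Finset.sum_congr rfl fun D _ => ?_
  rw [(((hE.hp K A).pd C).pd D).comm ((hE.hp C D).pd A), hE.pd_E_skew C K A, pd_comm C D,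
    map_neg, map_smul]
  simp only [mul_neg, mul_smul_comm, smul_smul, ← neg_smul]
  congr 1
  simp only [← sg_add, neg_sg]
  apply sg_eq
  push_cast
  generalize (ε A : ZMod 2) = A', (ε C : ZMod 2) = C', (ε D : ZMod 2) = D', (ε K : ZMod 2) = K'
  decide +revert

/-- The terms of `(Γ^K, ν^{(2)})` in which `E^{KB}` is differentiated twice and contracted with
`E_{BC}`. Symmetrizing in the two derivatives, the Jacobi identity for the remaining factors
`E^{AM} ∂_A E^{CD}` reduces them to `nu2_secondDeriv₁`. -/
theorem IsOddSkew.nu2_secondDeriv₂ (hE : IsOddSkew E) (hU : IsUnit E) (hJ : JacobiBr E)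
    (K : Idx p q) :
    ∑ A, ∑ B, ∑ C, ∑ D, ∑ M,
      sg (ε A * ε C + ((ε K + 1) * ε D + (ε K + 1) * (ε A + 1) + ε D * (ε A + ε M + 1))) •
        (E A M * pd D (pd M (E K B)) * (lower E B C * pd A (E C D))) =
      -((1 / 2 : ℝ) • quadY E K) := by
  have hC := hE.jacobiBr_iff.mp hJ
  have hX : ∀ D M B, HP (ε D + (ε M + (ε K + ε B + 1))) (pd D (pd M (E K B))) :=
    fun D M B => ((hE.hp K B).pd M).pd D
  have he := hE.lower_hp hU
  have h1 : ∀ A B C D M,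
      sg (ε A * ε C + ((ε K + 1) * ε D + (ε K + 1) * (ε A + 1) + ε D * (ε A + ε M + 1))) •
        (E A M * pd D (pd M (E K B)) * (lower E B C * pd A (E C D))) =
      sg (1 + ε C + ε D + ε M + ε K * ε D + ε K * ε M + ε M * ε C) •
        (pd D (pd M (E K B)) * (lower E B C * (E M A * pd A (E C D)))) := by
    intro A B C D M
    rw [← mul_assoc, mul_assoc (E A M), (hE.hp A M).comm ((hX D M B).mul (he B C)), hE.2 A M]
    simp only [mul_neg, mul_smul_comm, smul_mul_assoc, smul_smul,
      mul_assoc (G := SFun q N U), ← neg_smul]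
    congr 1
    simp only [← sg_add, neg_sg]
    apply sg_eq
    push_cast
    generalize (ε A : ZMod 2) = A', (ε B : ZMod 2) = B', (ε C : ZMod 2) = C',
      (ε D : ZMod 2) = D', (ε K : ZMod 2) = K', (ε M : ZMod 2) = M'
    decide +revert
  simp only [h1]
  rw [sum5_first_last]
  simp only [← Finset.smul_sum, ← Finset.mul_sum, ← br_coord_left]
  set S := ∑ B, ∑ C, ∑ D, ∑ M, sg (1 + ε C + ε D + ε M + ε K * ε D + ε K * ε M + ε M * ε C) •
    (pd D (pd M (E K B)) * (lower E B C * br E (coord M) (E C D))) with hS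
  have h2 : S = ∑ B, ∑ C, ∑ D, ∑ M,
      sg (1 + ε D + ε K * ε D + ε K * ε M + ε D * ε M + ε C * (ε D + ε M)) •
    (pd D (pd M (E K B)) * (lower E B C * br E (coord D) (E M C))) := by
    rw [hS]
    refine Finset.sum_congr rfl fun B _ => Finset.sum_congr rfl fun C _ => ?_
    rw [Finset.sum_comm]
    refine Finset.sum_congr rfl fun D _ => Finset.sum_congr rfl fun M _ => ?_
    rw [pd_comm M D, hE.2 C M]
    simp only [map_smul, mul_smul_comm, smul_mul_assoc, smul_smul,
      ← neg_smul]
    congr 1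
    simp only [← sg_add, neg_sg]
    apply sg_eq
    push_cast
    generalize (ε C : ZMod 2) = C', (ε D : ZMod 2) = D', (ε K : ZMod 2) = K', (ε M : ZMod 2) = M'
    decide +revert
  -- adding the two forms of `S` leaves two terms of a cyclic sum; the third one is `quadY`
  have h3 : S + S = -quadY E K := by
    have h4 : ∀ B D M, ∑ C, lower E B C * br E (coord C) (E D M) = pd B (E D M) := by
      intro B D M
      simp only [br_coord_left, Finset.mul_sum, ← mul_assoc]
      rw [Finset.sum_comm]
      simp only [← Finset.sum_mul, lower_mul hU]
      simp
    have h5 : quadY E K = ∑ B, ∑ C, ∑ D, ∑ M,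
        sg (1 + ε K * ε D + ε K * ε M + ε D * ε M + ε M) •
          (pd D (pd M (E K B)) * (lower E B C * br E (coord C) (E D M))) := by
      rw [quadY]
      refine Finset.sum_congr rfl fun B _ => ?_
      refine Eq.trans ?_ (sum_rotate fun D M C => sg (1 + ε K * ε D + ε K * ε M + ε D * ε M + ε M) •
          (pd D (pd M (E K B)) * (lower E B C * br E (coord C) (E D M))))
      refine Finset.sum_congr rfl fun D _ => Finset.sum_congr rfl fun M _ => ?_
      rw [← Finset.smul_sum, ← Finset.mul_sum, h4, (hX D M B).comm (hE.pd_E_hp B D M),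
        hE.pd_E_skew M K B]
      simp only [map_smul, mul_neg, mul_smul_comm, smul_smul, ← neg_smul]
      congr 1
      simp only [← sg_add, neg_sg]
      apply sg_eq
      push_cast
      generalize (ε B : ZMod 2) = B', (ε D : ZMod 2) = D', (ε K : ZMod 2) = K',
        (ε M : ZMod 2) = M'
      decide +revert
    conv_lhs => arg 2; rw [h2]
    rw [hS, h5]
    simp only [← Finset.sum_add_distrib, ← Finset.sum_neg_distrib]
    refine Finset.sum_congr rfl fun B _ => Finset.sum_congr rfl fun C _ =>
      Finset.sum_congr rfl fun D _ => Finset.sum_congr rfl fun M _ => ?_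
    have h6 := congrArg (fun y => sg (ε C + ε K * ε D + ε K * ε M + ε M * ε C + ε M * ε D) •
      (pd D (pd M (E K B)) * (lower E B C * y))) (hC M C D)
    simp only [mul_add (R := SFun q N U), mul_smul_comm, smul_add, smul_smul, mul_zero, smul_zero,
      ← sg_add] at h6
    have e : ∀ {x y z x' y' z' : SFun q N U}, x + y + z = 0 → x' = x → z' = z → y' = y →
        x' + z' = -y' := by
      rintro x y z _ _ _ h rfl rfl rfl
      rw [eq_neg_iff_add_eq_zero, ← h]; abel
    refine e h6 ?_ ?_ ?_
    all_goals
      congr 1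
      apply sg_eq
      push_cast
      generalize (ε C : ZMod 2) = C', (ε D : ZMod 2) = D', (ε K : ZMod 2) = K',
        (ε M : ZMod 2) = M'
      decide +revert
  rw [← sub_eq_zero]
  linear_combination (norm := module) (1 / 2 : ℝ) • h3

/-- Given the Jacobi identity, the Hamiltonian vector field of `ν^{(2)}` is the quadratic part of
`Δ₁²`: the terms that are cubic in first derivatives of `E` cancel, and the two kinds of second
derivatives remain. -/
theorem IsOddSkew.br_coord_nu2_eq (hE : IsOddSkew E) (hU : IsUnit E) (hJ : JacobiBr E)
    (K : Idx p q) : br E (coord K) (nu2 E) = -((3 : ℝ) • quadY E K) := by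
  have hx := hE.pd_E_hp
  have he := hE.lower_hp hU
  have h1 : ∀ A B C D, sg (ε A * ε C) •
        (br E (coord K) (pd D (E A B)) * (lower E B C * pd A (E C D))) = ∑ M,
      (sg (ε A * ε C + ((ε K + 1) * ε D + ε M * (ε K + ε A))) •
        (pd D (pd M (E K A)) * E M B * (lower E B C * pd A (E C D))) +
      sg (ε A * ε C + ((ε K + 1) * ε D + ε M * (ε K + ε A) + ε D * (ε M + ε K + ε A + 1))) •
        (pd M (E K A) * pd D (E M B) * (lower E B C * pd A (E C D))) +
      sg (ε A * ε C + ((ε K + 1) * ε D + (ε K + 1) * (ε A + 1))) •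
        (pd D (E A M) * pd M (E K B) * (lower E B C * pd A (E C D))) +
      sg (ε A * ε C + ((ε K + 1) * ε D + (ε K + 1) * (ε A + 1) + ε D * (ε A + ε M + 1))) •
        (E A M * pd D (pd M (E K B)) * (lower E B C * pd A (E C D))) -
      sg (ε A * ε C + (ε K + 1) * ε D) •
        (pd D (E K M) * pd M (E A B) * (lower E B C * pd A (E C D)))) := by
    intro A B C D
    rw [hE.br_coord_pd_E hJ, Finset.sum_mul, Finset.smul_sum]
    refine Finset.sum_congr rfl fun M _ => ?_
    simp only [add_mul (R := SFun q N U), sub_mul (α := SFun q N U), smul_add, smul_sub,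
      smul_mul_assoc, smul_smul, sg_add]
  have h2 : ∑ A, ∑ B, ∑ C, ∑ D, ∑ M,
      sg (ε A * ε C + ((ε K + 1) * ε D + ε M * (ε K + ε A) + ε D * (ε M + ε K + ε A + 1))) •
        (pd M (E K A) * pd D (E M B) * (lower E B C * pd A (E C D))) =
      ∑ A, ∑ B, ∑ C, ∑ D, ∑ M, sg (ε A * ε C + (ε K + 1) * ε D) •
        (pd D (E K M) * pd M (E A B) * (lower E B C * pd A (E C D))) := by
    rw [sum5_cycle fun A B C D M => sg (ε A * ε C + (ε K + 1) * ε D) •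
        (pd D (E K M) * pd M (E A B) * (lower E B C * pd A (E C D)))]
    refine Finset.sum_congr rfl fun A _ => Finset.sum_congr rfl fun B _ =>
      Finset.sum_congr rfl fun C _ => Finset.sum_congr rfl fun D _ =>
      Finset.sum_congr rfl fun M _ => ?_
    rw [mul_assoc, mul_assoc, (hx A D C).mul_reverse (he C B) (hx D B M), hE.pd_E_skew D B M,
      hE.pd_E_skew A D C, hE.lower_skew hU C B]
    simp only [mul_neg, neg_mul, mul_smul_comm, smul_mul_assoc, smul_smul,
      ← neg_smul, neg_neg]
    congr 1
    simp only [← sg_add, neg_sg]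
    apply sg_eq
    push_cast
    generalize (ε A : ZMod 2) = A', (ε B : ZMod 2) = B', (ε C : ZMod 2) = C',
      (ε D : ZMod 2) = D', (ε K : ZMod 2) = K', (ε M : ZMod 2) = M'
    decide +revert
  have h3 : ∑ A, ∑ B, ∑ C, ∑ D, ∑ M,
      sg (ε A * ε C + ((ε K + 1) * ε D + (ε K + 1) * (ε A + 1))) •
        (pd D (E A M) * pd M (E K B) * (lower E B C * pd A (E C D))) =
      ∑ A, ∑ B, ∑ C, ∑ D, ∑ M,
        sg (ε A * ε C + (ε K + 1) * (ε D + ε A + 1)) •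
          (pd D (E A B) * (pd B (E K M) * (lower E M C * pd A (E C D)))) := by
    rw [sum5_swap]
    refine Finset.sum_congr rfl fun A _ => Finset.sum_congr rfl fun B _ =>
      Finset.sum_congr rfl fun C _ => Finset.sum_congr rfl fun D _ =>
      Finset.sum_congr rfl fun M _ => ?_
    rw [mul_assoc]
    congr 2
    ring
  rw [hE.br_coord_nu2 hU hJ]
  simp only [h1, Finset.sum_add_distrib, Finset.sum_sub_distrib]
  rw [h2, h3, hE.nu2_secondDeriv₁ hU, hE.nu2_secondDeriv₂ hU hJ]
  module

/-! ### The square of the Laplacian without connection as a Hamiltonian vector field -/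

/-- The part `ν^{(1)}/8 - ν^{(2)}/24` of `ν_F` that does not depend on `F`. -/
def nuC (E : Matrix (Idx p q) (Idx p q) (SFun q N U)) : SFun q N U :=
  (1 / 8 : ℝ) • nu1 E - (1 / 24 : ℝ) • nu2 E

theorem IsOddSkew.nu1_hp (hE : IsOddSkew E) : HP 1 (nu1 E) :=
  HP.sum fun A _ => HP.sum fun B _ => HP.smul ((((hE.hp A B).pd A).pd B).congr (by omega)) _

theorem IsOddSkew.nu2_hp (hE : IsOddSkew E) (hU : IsUnit E) : HP 1 (nu2 E) :=
  HP.sum fun A _ => HP.sum fun B _ => HP.sum fun C _ => HP.sum fun D _ =>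
    HP.smul ((((hE.hp A B).pd D).mul (hE.lower_hp hU B C)).mul ((hE.hp C D).pd A) |>.congr
      (by omega)) _

theorem IsOddSkew.nuC_hp (hE : IsOddSkew E) (hU : IsUnit E) : HP 1 (nuC E) :=
  (hE.nu1_hp.smul _).sub ((hE.nu2_hp hU).smul _)

theorem IsOddSkew.br_odd_comm (hE : IsOddSkew E) {b : ℕ} {f g : SFun q N U} (hf : HP 1 f)
    (hg : HP b g) : br E g f = -br E f g := by
  rw [hE.br_skew hf hg, sg_even ⟨b + 1, by ring⟩, neg_smul, one_smul]

theorem IsOddSkew.lap_divE_eq (hE : IsOddSkew E) (hU : IsUnit E) (hJ : JacobiBr E)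
    (C : Idx p q) : lap E 0 (divE E C) = (2 : ℝ) • br E (nuC E) (coord C) := by
  have h := hE.br_coord_nu2_eq hU hJ C
  rw [hE.br_odd_comm (hE.nu2_hp hU) (hp_coord C), neg_inj] at h
  simp only [hE.lap_divE hJ, nuC, map_sub, map_smul, LinearMap.sub_apply, LinearMap.smul_apply, h]
  module

/-- Given the Jacobi identity, `Δ₁²` is the Hamiltonian vector field of `ν^{(1)}/8 - ν^{(2)}/24`. -/
theorem IsOddSkew.lap_zero_sq (hE : IsOddSkew E) (hU : IsUnit E) (hJ : JacobiBr E)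
    (f : SFun q N U) : lap E 0 (lap E 0 f) = br E (nuC E) f := by
  have key : lap E 0 ∘ₗ lap E 0 - br E (nuC E) = 0 := by
    refine tw_derivation_eq_zero 0 _ (fun a f g hf => ?_) (fun A => ?_) fun c => ?_
    · simp only [LinearMap.sub_apply, LinearMap.comp_apply]
      rw [hE.lap_lap_mul hJ hf, hE.br_mul (hE.nuC_hp hU) hf, zero_mul, sg_zero, one_smul,
        sg_even ⟨a, by ring⟩, one_smul, sub_mul, mul_sub]
      abel
    · simp only [LinearMap.sub_apply, LinearMap.comp_apply, lap_coord, map_smul,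
        hE.lap_divE_eq hU hJ]
      module
    · simp [lap_sconst, br_sconst_right]
  exact sub_eq_zero.mp (LinearMap.congr_fun key f)

/-- The triple divergence of the Jacobi identity for the coordinates: relabelling identifies its
three terms with each other, so that each of them vanishes. -/
theorem IsOddSkew.sum_pd_jacobi (hE : IsOddSkew E) (hJ : JacobiBr E) :
    ∑ A, ∑ M, ∑ D, sg (ε A + ε M + ε D * ε M) •
      pd A (pd M (pd D (br E (coord M) (E D A)))) = 0 := by
  have hC := hE.jacobiBr_iff.mp hJ
  set X := ∑ A, ∑ M, ∑ D, sg (ε A + ε M + ε D * ε M) •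
      pd A (pd M (pd D (br E (coord M) (E D A)))) with hX
  have h1 : X = ∑ A, ∑ M, ∑ D, sg (ε M + ε D + ε A * ε M) •
      pd A (pd M (pd D (br E (coord D) (E A M)))) := by
    rw [hX, sum_rotate]
    refine Finset.sum_congr rfl fun A _ => Finset.sum_congr rfl fun M _ =>
      Finset.sum_congr rfl fun D _ => ?_
    rw [pd_comm D A, map_smul, pd_comm M A, smul_smul, smul_smul]
    congr 1
    simp only [← sg_add]
    apply sg_eq
    push_cast
    generalize (ε A : ZMod 2) = A', (ε D : ZMod 2) = D', (ε M : ZMod 2) = M'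
    decide +revert
  have h2 : X = ∑ A, ∑ M, ∑ D, sg (ε D + ε A + ε M * ε A + ε D * ε A + ε D * ε M) •
      pd A (pd M (pd D (br E (coord A) (E M D)))) := by
    rw [hX, sum_rotate, sum_rotate]
    refine Finset.sum_congr rfl fun A _ => Finset.sum_congr rfl fun M _ =>
      Finset.sum_congr rfl fun D _ => ?_
    rw [pd_comm D A, pd_comm D M, map_smul, smul_smul, smul_smul]
    simp only [← sg_add]
  have h3 : X + X + X = 0 := by
    conv_lhs => arg 2; rw [h2]
    conv_lhs => arg 1; arg 2; rw [h1]
    rw [hX]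
    simp only [← Finset.sum_add_distrib]
    refine Finset.sum_eq_zero fun A _ => Finset.sum_eq_zero fun M _ =>
      Finset.sum_eq_zero fun D _ => ?_
    have h := congrArg (fun x => sg (ε D * ε M + ε M * ε A + 1) • pd A (pd M (pd D x))) (hC M D A)
    simp only [map_add, map_smul, smul_add, smul_smul, map_zero, smul_zero, ← sg_add] at h
    rw [← h]
    have e : ∀ {x y z x' y' z' : SFun q N U}, x = x' → y = y' → z = z' →
        x + y + z = x' + y' + z' := by
      rintro x y z _ _ _ rfl rfl rfl; rfl
    apply e
    all_goals
      congr 1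
      apply sg_eq
      push_cast
      generalize (ε A : ZMod 2) = A', (ε D : ZMod 2) = D', (ε M : ZMod 2) = M'
      decide +revert
  have : (3 : ℝ) • X = 0 := by rw [← h3]; module
  simpa using this

/-- This sum changes its sign when its two factors are exchanged. -/
theorem IsOddSkew.sum_pd_quad (hE : IsOddSkew E) :
    ∑ A, ∑ D, ∑ M, ∑ K, sg (ε A + ε M + ε D * ε M) •
      pd A (pd M (pd D (E M K) * pd K (E D A))) = 0 := by
  set X := ∑ A, ∑ D, ∑ M, ∑ K, sg (ε A + ε M + ε D * ε M) •
      pd A (pd M (pd D (E M K) * pd K (E D A))) with hX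
  have h1 : X = -X := by
    conv_lhs => rw [hX]
    rw [hX]
    simp only [← Finset.sum_neg_distrib, ← Fintype.sum_prod_type']
    refine Fintype.sum_equiv ⟨fun x => (x.2.2.1, x.2.2.2, x.1, x.2.1),
      fun x => (x.2.2.1, x.2.2.2, x.1, x.2.1), fun _ => rfl, fun _ => rfl⟩ _ _ fun x => ?_
    obtain ⟨A, D, M, K⟩ := x
    simp only [Equiv.coe_fn_mk]
    rw [pd_comm M A, (hE.pd_E_hp D M K).comm (hE.pd_E_hp K D A), hE.pd_E_skew D M K,
      hE.pd_E_skew K D A]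
    simp only [map_smul, mul_neg, neg_mul, mul_smul_comm, smul_mul_assoc, smul_smul,
      neg_neg, ← neg_smul]
    congr 1
    simp only [← sg_add, neg_sg]
    apply sg_eq
    push_cast
    generalize (ε A : ZMod 2) = A', (ε D : ZMod 2) = D', (ε K : ZMod 2) = K',
      (ε M : ZMod 2) = M'
    decide +revert
  have : (2 : ℝ) • X = 0 := by rw [two_smul]; nth_rw 1 [h1]; abel
  simpa using this

/-- Given the Jacobi identity, `Δ₁` annihilates `ν^{(1)}/8 - ν^{(2)}/24`. Its
antibrackets with the coordinates are `Δ₁` of divergences (`lap_divE_eq`), which makes the claim a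
triple divergence of the Jacobi identity, up to a sum that vanishes by symmetry. -/
theorem IsOddSkew.lap_nuC (hE : IsOddSkew E) (hU : IsUnit E) (hJ : JacobiBr E) :
    lap E 0 (nuC E) = 0 := by
  have h1 : ∀ A, br E (coord A) (nuC E) = -((1 / 2 : ℝ) • lap E 0 (divE E A)) := by
    intro A
    rw [hE.br_odd_comm (hE.nuC_hp hU) (hp_coord A), hE.lap_divE_eq hU hJ, smul_smul]
    norm_num
  have h2 : ∀ A, lap E 0 (divE E A) = (1 / 2 : ℝ) • ∑ M, ∑ D, (sg (ε M + ε D * ε M) •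
      pd M (pd D (br E (coord M) (E D A))) - ∑ K, sg (ε M + ε D * ε M) •
      pd M (pd D (E M K) * pd K (E D A))) := by
    intro A
    rw [lap_zero_eq_br]
    congr 1
    refine Finset.sum_congr rfl fun M _ => ?_
    rw [divE, map_sum, map_sum, Finset.smul_sum]
    refine Finset.sum_congr rfl fun D _ => ?_
    rw [map_smul, map_smul, hE.br_coord_pd, map_smul, map_sub, map_sum, smul_smul, smul_smul,
      smul_sub, Finset.smul_sum]
    have e : sg (ε M) * sg (ε D) * sg ((ε M + 1) * ε D) = sg (ε M + ε D * ε M) := by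
      simp only [← sg_add]
      apply sg_eq
      push_cast
      generalize (ε D : ZMod 2) = D', (ε M : ZMod 2) = M'
      decide +revert
    rw [e]
  have h3 : ∑ A, sg (ε A) • pd A (br E (coord A) (nuC E)) = -((1 / 4 : ℝ) •
      (∑ A, ∑ M, ∑ D, sg (ε A + ε M + ε D * ε M) •
        pd A (pd M (pd D (br E (coord M) (E D A)))) -
      ∑ A, ∑ D, ∑ M, ∑ K, sg (ε A + ε M + ε D * ε M) •
        pd A (pd M (pd D (E M K) * pd K (E D A))))) := by
    rw [← Finset.sum_sub_distrib, Finset.smul_sum, ← Finset.sum_neg_distrib]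
    refine Finset.sum_congr rfl fun A _ => ?_
    rw [Finset.sum_comm (f := fun D M => ∑ K, sg (ε A + ε M + ε D * ε M) •
        pd A (pd M (pd D (E M K) * pd K (E D A)))), h1, h2, smul_smul, map_neg, map_smul,
        smul_neg, smul_smul, map_sum, ← Finset.sum_sub_distrib]
    rw [show sg (ε A) * (1 / 2 * (1 / 2)) = 1 / 4 * sg (ε A) by ring, mul_smul]
    congr 2
    rw [Finset.smul_sum]
    refine Finset.sum_congr rfl fun M _ => ?_
    rw [map_sum, Finset.smul_sum, ← Finset.sum_sub_distrib]
    refine Finset.sum_congr rfl fun D _ => ?_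
    simp only [map_sub, map_sum, map_smul, smul_sub, Finset.smul_sum, smul_smul, ← sg_add,
      ← add_assoc]
  rw [lap_zero_eq_br, h3, hE.sum_pd_jacobi hJ, hE.sum_pd_quad]
  simp

end Square

section Density

variable {p q N : ℕ} {U V : Opens (Fin p → ℝ)}
variable {E : Matrix (Idx p q) (Idx p q) (SFun q N U)}

/-! ### Densities -/

theorem HP.commute {f : SFun q N U} (hf : HP 0 f) (g : SFun q N U) : Commute f g := by
  have := hf.mul_eq_tw g
  rwa [tw_zero] at this

theorem hp_ofSmooth (f : SmoothFn U) : HP 0 (ofSmooth f : SFun q N U) := by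
  rw [HP, HasParity, parity_ofSmooth, sg_zero, one_smul]

theorem body_ofSmooth (f : SmoothFn U) : body (ofSmooth f : SFun q N U) = f := by
  rw [ofSmooth_apply, body_tm, map_one, one_smul]

/-- An even superfunction differs from its body by a nilpotent one. -/
theorem HP.isNilpotent_sub_body {f : SFun q N U} (hf : HP 0 f) :
    IsNilpotent (f - ofSmooth (body f)) := by
  have key : ∀ f : SFun q N U, IsNilpotent (f + parity f - (2 : ℝ) • ofSmooth (body f)) := by
    intro f
    induction f using SFun.induction with
    | tmul f l =>
      obtain ⟨k, hk⟩ := isNilpotent_even_sub_body l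
      refine ⟨k, ?_⟩
      have h1 : (tm f l : SFun q N U) + parity (tm f l) - (2 : ℝ) • ofSmooth (body (tm f l)) =
          tm f (l + invol l - algebraMap ℝ _ (2 * ExteriorAlgebra.algebraMapInv l)) := by
        rw [parity_tm, tm_sub, tm_add, body_tm, ofSmooth_apply, tm_smul_left, smul_smul,
          Algebra.algebraMap_eq_smul_one, tm_smul]
      rw [h1]
      have h2 : ∀ (m : ExteriorAlgebra ℝ (Fin q ⊕ Fin N → ℝ)) (k : ℕ),
          (tm f m : SFun q N U) ^ k = tm (f ^ k) (m ^ k) := fun m k => by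
        induction k with
        | zero => simp [tm_one]
        | succ k ih => rw [pow_succ, ih, tm_mul, pow_succ, pow_succ]
      rw [h2, hk, tm_zero]
    | add x y hx hy =>
      have hz : HP 0 (x + parity x - (2 : ℝ) • ofSmooth (body x) : SFun q N U) := by
        refine HP.sub ?_ ((hp_ofSmooth _).smul _)
        rw [HP, HasParity, map_add, parity_parity, sg_zero, one_smul, add_comm]
      have := (hz.commute _).isNilpotent_add hx hy
      convert this using 1
      simp only [map_add, smul_add]
      abel
  have h := key f
  rw [HP, HasParity, sg_zero, one_smul] at hf
  rw [hf, ← two_smul ℝ, ← smul_sub] at h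
  simpa using h.smul (2 : ℝ)⁻¹

theorem IsDensity.even {ρ : SFun q N U} (hρ : IsDensity ρ) : HP 0 ρ := hρ.1

theorem IsDensity.isUnit {ρ : SFun q N U} (hρ : IsDensity ρ) : IsUnit ρ := by
  have h1 : IsUnit (ofSmooth (body ρ) : SFun q N U) :=
    (smoothFn_isUnit (body ρ) fun x => (hρ.2 x).ne').map ofSmooth
  have h2 := hρ.even.isNilpotent_sub_body
  have := h2.isUnit_add_left_of_commute h1 ((hp_ofSmooth _).commute _).symm
  rwa [add_sub_cancel] at this

theorem IsDensity.mul_inverse {ρ : SFun q N U} (hρ : IsDensity ρ) : ρ * Ring.inverse ρ = 1 :=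
  Ring.mul_inverse_cancel _ hρ.isUnit

theorem IsDensity.inverse_mul {ρ : SFun q N U} (hρ : IsDensity ρ) : Ring.inverse ρ * ρ = 1 :=
  Ring.inverse_mul_cancel _ hρ.isUnit

theorem IsDensity.mul_left_cancel {ρ f g : SFun q N U} (hρ : IsDensity ρ) (h : ρ * f = ρ * g) :
    f = g := hρ.isUnit.mul_left_cancel h

theorem IsDensity.isDLog_iff {ρ : SFun q N U} (hρ : IsDensity ρ) {F : Idx p q → SFun q N U} :
    IsDLog F ρ ↔ ∀ A, ρ * F A = pd A ρ := by
  refine forall_congr' fun A => ⟨fun h => ?_, fun h => ?_⟩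
  · rw [h, ← mul_assoc, hρ.mul_inverse, one_mul]
  · rw [← h, ← mul_assoc, hρ.inverse_mul, one_mul]

theorem IsDLog.isConnParity {ρ : SFun q N U} (hρ : IsDensity ρ) {F : Idx p q → SFun q N U}
    (h : IsDLog F ρ) : IsConnParity F := by
  rw [hρ.isDLog_iff] at h
  intro A
  rw [HasParity]
  refine hρ.mul_left_cancel ?_
  have := congrArg parity (h A)
  have h1 : parity ρ = ρ := by have := hρ.1; rwa [HasParity, sg_zero, one_smul] at this
  rw [map_mul, h1, parity_pd, h1] at this
  rw [this, mul_smul_comm, h]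

/-- A logarithmic derivative is flat. -/
theorem IsDLog.isFlatConn {ρ : SFun q N U} (hρ : IsDensity ρ) {F : Idx p q → SFun q N U}
    (h : IsDLog F ρ) : IsFlatConn F := by
  have hF := h.isConnParity hρ
  rw [hρ.isDLog_iff] at h
  intro A B
  refine hρ.mul_left_cancel ?_
  have h1 : ∀ A B, ρ * pd A (F B) = pd A (pd B ρ) - ρ * (F A * F B) := by
    intro A B
    rw [← h B, HP.pd_mul hρ.even, ← h A, mul_zero, sg_zero, one_smul, mul_assoc]
    abel
  rw [mul_sub, mul_smul_comm, h1, h1, pd_comm A B, (HP.comm (hF A) (hF B) : F A * F B = _)]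
  rw [mul_smul_comm, smul_sub, sub_self, mul_zero]

/-- The commutative algebra of even superfunctions. -/
def evenPart (q N : ℕ) (U : Opens (Fin p → ℝ)) : Subalgebra ℝ (SFun q N U) :=
  AlgHom.equalizer parity (AlgHom.id ℝ (SFun q N U))

theorem mem_evenPart {f : SFun q N U} : f ∈ evenPart q N U ↔ HP 0 f := by
  rw [HP, HasParity, sg_zero, one_smul]; rfl

instance : CommRing (evenPart q N U) :=
  { (inferInstance : Ring (evenPart q N U)) with
    mul_comm := fun f g => Subtype.ext ((mem_evenPart.mp f.2).commute g.1) }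

/-- A density has a square root. -/
theorem IsDensity.exists_sqrt {ρ : SFun q N U} (hρ : IsDensity ρ) :
    ∃ r : SFun q N U, IsDensity r ∧ r * r = ρ := by
  let b : SmoothFn U := ⟨fun x => Real.sqrt ((body ρ).1 x), by
    have h : ContDiffOn ℝ ∞ (fun x => Real.sqrt (ext0 (body ρ).1 x)) U :=
      (ext0_contDiffOn (body ρ)).sqrt fun x hx => by
        rw [ext0_apply _ hx]; exact (hρ.2 _).ne'
    exact h.congr fun x hx => by rw [ext0_apply _ hx, ext0_apply _ hx]⟩
  have hb : b * b = body ρ := smoothFn_ext fun x => Real.mul_self_sqrt (hρ.2 x).le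
  have hb0 : ∀ x, 0 < b.1 x := fun x => Real.sqrt_pos.mpr (hρ.2 x)
  let x : evenPart q N U := ⟨ofSmooth b, mem_evenPart.mpr (hp_ofSmooth b)⟩
  let y : evenPart q N U := ⟨ρ, mem_evenPart.mpr hρ.1⟩
  have hxu : IsUnit x := by
    obtain ⟨c, hc⟩ := (smoothFn_isUnit b fun x => (hb0 x).ne').exists_right_inv
    refine IsUnit.of_mul_eq_one (⟨ofSmooth c, mem_evenPart.mpr (hp_ofSmooth c)⟩ : evenPart q N U)
      (Subtype.ext ?_)
    change ofSmooth b * ofSmooth c = (1 : SFun q N U)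
    rw [← map_mul, hc, map_one]
  have hn : IsNilpotent (x * x - y) := by
    obtain ⟨k, hk⟩ := hρ.even.isNilpotent_sub_body
    refine ⟨k, Subtype.ext ?_⟩
    change (ofSmooth b * ofSmooth b - ρ) ^ k = 0
    rw [← map_mul, hb, ← neg_sub, neg_pow, hk, mul_zero]
  -- Newton's method improves the root `x` of `X² = ρ` modulo nilpotents to an exact one
  let P : Polynomial (evenPart q N U) := Polynomial.X * Polynomial.X - Polynomial.C y
  obtain ⟨r, ⟨hr1, hr2⟩, -⟩ := Polynomial.existsUnique_nilpotent_sub_and_aeval_eq_zero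
    (P := P) (x := x) (by simpa [P] using hn) (by
      have : Polynomial.aeval x (Polynomial.derivative P) = (2 : ℝ) • x := by
        simp [P, two_smul]
      rw [this, Algebra.smul_def]
      exact ((IsUnit.mk0 (2 : ℝ) two_ne_zero).map (algebraMap ℝ _)).mul hxu)
  have hr3 : r.1 * r.1 = ρ := by
    have : r * r - y = 0 := by simpa [P] using hr2
    exact congrArg Subtype.val (sub_eq_zero.mp this)
  refine ⟨r.1, ⟨mem_evenPart.mp r.2, fun t => ?_⟩, hr3⟩
  have h1 : IsNilpotent (body (x - r).1) := by
    obtain ⟨k, hk⟩ := hr1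
    refine ⟨k, ?_⟩
    rw [← map_pow, ← map_zero body]
    exact congrArg body (congrArg Subtype.val hk)
  have h2 : (body (x - r).1).1 t = 0 := by
    obtain ⟨k, hk⟩ := h1
    have : ((body (x - r).1).1 t) ^ k = 0 := congrFun (congrArg Subtype.val hk) t
    exact IsNilpotent.eq_zero ⟨k, this⟩
  have h3 : (body (x - r).1).1 t = b.1 t - (body r.1).1 t := by
    have : body (x - r).1 = b - body r.1 := by
      change body (ofSmooth b - r.1) = _
      rw [map_sub, body_ofSmooth]
    rw [this]; rfl
  rw [h2] at h3
  rw [← sub_eq_zero.mp h3.symm]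
  exact hb0 t

theorem HP.pow {f : SFun q N U} (hf : HP 0 f) (k : ℕ) : HP 0 (f ^ k) :=
  mem_evenPart.mp (pow_mem (mem_evenPart.mpr hf) k)

theorem HP.pd_pow {f : SFun q N U} (hf : HP 0 f) (A : Idx p q) (k : ℕ) :
    BV.pd A (f ^ (k + 1)) = ((k : ℝ) + 1) • (f ^ k * BV.pd A f) := by
  induction k with
  | zero => simp
  | succ k ih =>
    rw [pow_succ, (hf.pow (k + 1)).pd_mul, ih, mul_zero, sg_zero, one_smul, smul_mul_assoc,
      mul_assoc, ← (hf.commute (BV.pd A f)).eq, ← mul_assoc, ← pow_succ]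
    push_cast
    module

/-- Every even superfunction is the logarithm of a density. -/
theorem HP.exists_exp {ψ : SFun q N U} (hψ : HP 0 ψ) :
    ∃ ρ : SFun q N U, IsDensity ρ ∧ ∀ A, BV.pd A ρ = ρ * BV.pd A ψ := by
  obtain ⟨k, hk⟩ := hψ.isNilpotent_sub_body
  have hn : HP 0 (ψ - ofSmooth (body ψ)) := hψ.sub (hp_ofSmooth _)
  have hbn : body (ψ - ofSmooth (body ψ)) = 0 := by rw [map_sub, body_ofSmooth, sub_self]
  have hψ' : ψ = ofSmooth (body ψ) + (ψ - ofSmooth (body ψ)) := by abel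
  set n := ψ - ofSmooth (body ψ) with hn_def
  set b := body ψ with hb
  -- the exponential of the body, as a smooth function
  let c : SmoothFn U := ⟨fun x => Real.exp (b.1 x), by
    have h : ContDiffOn ℝ ∞ (fun x => Real.exp (ext0 b.1 x)) U := (ext0_contDiffOn b).exp
    exact h.congr fun x hx => by rw [ext0_apply _ hx, ext0_apply _ hx]⟩
  have hc : ∀ i, smoothPd U i c = c * smoothPd U i b := fun i => smoothFn_ext fun x => by
    have e : ext0 c.1 =ᶠ[nhds x.1] fun y => Real.exp (ext0 b.1 y) := by
      filter_upwards [U.isOpen.mem_nhds x.2] with y hy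
      rw [ext0_apply _ hy, ext0_apply _ hy]
    have e2 : (c * smoothPd U i b).1 x = Real.exp (b.1 x) * (smoothPd U i b).1 x := rfl
    rw [e2, smoothPd_apply, smoothPd_apply, e.fderiv_eq,
      fderiv_exp (ext0_differentiableAt b x), ext0_apply _ x.2]
    rfl
  have hc' : ∀ A, BV.pd A (ofSmooth c : SFun q N U) = ofSmooth c * BV.pd A (ofSmooth b) := by
    rintro (i | a)
    · rw [ofSmooth_apply, ofSmooth_apply, pd_inl_tm, pd_inl_tm, tm_mul, hc, mul_one]
    · rw [ofSmooth_apply, ofSmooth_apply, pd_inr_tm, pd_inr_tm, ← map_one (algebraMap ℝ _),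
        contr_algebraMap, tm_zero, tm_zero, mul_zero]
  -- the exponential of the nilpotent part
  let e : SFun q N U := ∑ i ∈ Finset.range (k + 1), ((i.factorial : ℝ)⁻¹) • n ^ i
  have he0 : HP 0 e := HP.sum fun i _ => (hn.pow i).smul _
  have he : ∀ A, BV.pd A e = e * BV.pd A n := by
    intro A
    have h1 : BV.pd A e = ∑ i ∈ Finset.range k, ((i.factorial : ℝ)⁻¹) • (n ^ i * BV.pd A n) := by
      simp only [e]
      rw [Finset.sum_range_succ', map_add, map_smul, pow_zero, pd_one, smul_zero, add_zero,
        map_sum]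
      refine Finset.sum_congr rfl fun i _ => ?_
      rw [map_smul, hn.pd_pow, smul_smul]
      congr 1
      rw [Nat.factorial_succ]
      push_cast
      have : ((i : ℝ) + 1) ≠ 0 := by positivity
      field_simp
    rw [h1]
    simp only [e]
    rw [Finset.sum_range_succ, hk, smul_zero, add_zero, Finset.sum_mul]
    simp only [smul_mul_assoc]
  have heb : body e = 1 := by
    simp only [e]
    rw [Finset.sum_range_succ', map_add, map_sum, Finset.sum_eq_zero fun i _ => ?_]
    · simp
    · rw [map_smul, map_pow, hbn, zero_pow i.succ_ne_zero, smul_zero]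
  refine ⟨ofSmooth c * e, ⟨((hp_ofSmooth c).mul he0).congr rfl, fun x => ?_⟩, fun A => ?_⟩
  · rw [map_mul, heb, body_ofSmooth, mul_one]
    exact Real.exp_pos _
  · rw [(hp_ofSmooth c).pd_mul, hc', he, mul_zero, sg_zero, one_smul, mul_assoc,
      ← (he0.commute _).eq, ← mul_assoc, ← mul_assoc, ← mul_add, ← map_add]
    rw [← hψ']

end Density

section Gauge

variable {p q N : ℕ} {U V : Opens (Fin p → ℝ)}
variable {E : Matrix (Idx p q) (Idx p q) (SFun q N U)} {F : Idx p q → SFun q N U}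
variable {ρ r : SFun q N U}

/-! ### Removing a logarithmic connection by conjugation -/

theorem IsDensity.lapRho_apply (hρ : IsDensity ρ) (f : SFun q N U) :
    ρ * lapRho E ρ f = ∑ A, ∑ B, (sg (ε A) / 2) • pd A (ρ * (E A B * pd B f)) := by
  simp only [lapRho, LinearMap.sum_apply, LinearMap.smul_apply, LinearMap.comp_apply,
    LinearMap.mulLeft_apply, Finset.mul_sum, mul_smul_comm]
  simp only [← mul_assoc, hρ.mul_inverse, one_mul]

theorem isDensity_one : IsDensity (1 : SFun q N U) :=
  ⟨HP.one, fun x => by rw [map_one]; exact one_pos⟩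

theorem lapRho_one : lapRho E 1 = lap E 0 := by
  refine LinearMap.ext fun f => ?_
  rw [← one_mul (lapRho E 1 f), isDensity_one.lapRho_apply, lap_zero_apply]
  simp only [one_mul]

theorem IsDLog.lap_eq_lapRho (hρ : IsDensity ρ) (h : IsDLog F ρ) : lap E F = lapRho E ρ := by
  rw [hρ.isDLog_iff] at h
  refine LinearMap.ext fun f => hρ.mul_left_cancel ?_
  rw [hρ.lapRho_apply, lap_apply]
  simp only [Finset.mul_sum, mul_smul_comm, hρ.even.pd_mul, mul_zero, sg_zero, one_smul, ← h,
    mul_add ρ, mul_assoc]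
  simp only [add_comm]

theorem lap_eq_lap_zero_add (f : SFun q N U) : lap E F f = lap E 0 f +
    ∑ A, ∑ B, (sg (ε A) / 2) • (F A * (E A B * pd B f)) := by
  rw [lap_apply, lap_zero_apply]
  simp only [smul_add, Finset.sum_add_distrib]

/-- The equation `F = ∂ ln ρ` in terms of `r = √ρ`, without denominators. -/
theorem IsDLog.sqrt (hr : IsDensity r) (hρ : IsDensity ρ) (hrr : r * r = ρ) (h : IsDLog F ρ)
    (A : Idx p q) : r * F A = (2 : ℝ) • pd A r := by
  rw [hρ.isDLog_iff] at h
  refine hr.mul_left_cancel ?_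
  rw [← mul_assoc, hrr, h, ← hrr, hr.even.pd_mul, mul_zero, sg_zero, one_smul,
    ← (hr.even.commute (pd A r)).eq, mul_smul_comm, two_smul]

/-- The function `ν_F^{(0)}` is `(1/√ρ) (Δ₁ √ρ)`; here `r = √ρ` is given by `r F_A = 2 ∂_A r`. -/
theorem mul_nuF0 (hr : IsDensity r) (h : ∀ A, r * F A = (2 : ℝ) • pd A r) :
    r * nuF0 E F = lap E 0 r := by
  rw [nuF0, lap_zero_apply]
  simp only [Finset.mul_sum]
  refine Finset.sum_congr rfl fun A _ => Finset.sum_congr rfl fun B _ => ?_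
  have hc := fun g => (hr.even.commute g).eq
  have h1 : r * pd A (E A B * F B) = (2 : ℝ) • pd A (E A B * pd B r) -
      (1 / 2 : ℝ) • (r * (F A * (E A B * F B))) := by
    rw [← mul_assoc r (F A), h]
    have h2 := hr.even.pd_mul A (E A B * F B)
    rw [mul_zero, sg_zero, one_smul, ← mul_assoc r, hc, mul_assoc, h, mul_smul_comm,
      map_smul] at h2
    rw [h2, smul_mul_assoc]
    module
  rw [mul_smul_comm, mul_add r, h1, mul_smul_comm]
  module

/-- Conjugation with `√ρ` turns `Δ_F + ν_F^{(0)}` into `Δ₁`. -/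
theorem mul_lap_add (hE : IsOddSkew E) (hr : IsDensity r) (h : ∀ A, r * F A = (2 : ℝ) • pd A r)
    (f : SFun q N U) : r * (lap E F f + nuF0 E F * f) = lap E 0 (r * f) := by
  rw [mul_add r, ← mul_assoc, mul_nuF0 hr h, hE.lap_mul isConnParity_zero hr.even,
    lap_eq_lap_zero_add f, sg_zero, one_smul, one_smul, mul_add r, hr.even.br_apply]
  have : r * ∑ A, ∑ B, (sg (ε A) / 2) • (F A * (E A B * pd B f)) =
      ∑ A, ∑ B, sg (ε A * (ε A + 0)) • (pd A r * (E A B * pd B f)) := by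
    simp only [Finset.mul_sum]
    refine Finset.sum_congr rfl fun A _ => Finset.sum_congr rfl fun B _ => ?_
    rw [mul_smul_comm, ← mul_assoc, h, smul_mul_assoc, smul_smul]
    congr 1
    rcases ε_cases A with hA | hA <;> rw [hA] <;> simp [sg]
  rw [this]
  abel

theorem nuRho0_eq (hr : IsDensity r) (h : ∀ A, r * F A = (2 : ℝ) • pd A r) :
    nuRho0 E r = nuF0 E F := by
  rw [nuRho0, lapRho_one, ← mul_nuF0 hr h, ← mul_assoc, hr.inverse_mul, one_mul]

theorem nuF_eq : nuF E F = nuF0 E F + nuC E := by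
  rw [nuF, nuC]; abel

theorem nuF0_hp (hE : IsOddSkew E) (hF : IsConnParity F) : HP 1 (nuF0 E F) := by
  refine HP.sum fun A _ => HP.sum fun B _ => HP.smul (HP.add ?_ (HP.smul ?_ _)) _
  · exact (((hE.hp A B).mul (hF B)).pd A).congr (by omega)
  · exact (HP.mul (hF A) ((hE.hp A B).mul (hF B))).congr (by omega)

theorem nuF_hp (hE : IsOddSkew E) (hU : IsUnit E) (hF : IsConnParity F) : HP 1 (nuF E F) := by
  rw [nuF_eq]; exact (nuF0_hp hE hF).add (hE.nuC_hp hU)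

theorem HP.odd_mul_self {f : SFun q N U} (hf : HP 1 f) : f * f = 0 := by
  have h := hf.comm hf
  rw [mul_one, sg_one, neg_smul, one_smul] at h
  have : (2 : ℝ) • (f * f) = 0 := by rw [two_smul]; nth_rw 1 [h]; abel
  simpa using this

/-- The square of `Δ_F + ν`, for an odd function `ν`; the term `ν²` vanishes. -/
theorem IsOddSkew.lap_add_sq (hE : IsOddSkew E) (hF : IsConnParity F) {ν : SFun q N U}
    (hν : HP 1 ν) (f : SFun q N U) :
    lap E F (lap E F f + ν * f) + ν * (lap E F f + ν * f) =
      lap E F (lap E F f) - br E ν f + lap E F ν * f := by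
  rw [map_add, hE.lap_mul hF hν, mul_add ν, ← mul_assoc, hν.odd_mul_self, zero_mul, sg_one]
  module

/-- Where the connection is logarithmic, `Δ_F + ν_F` squares to zero. -/
theorem lap_add_nuF_sq (hE : IsOddSkew E) (hU : IsUnit E) (hJ : JacobiBr E) (hr : IsDensity r)
    (h : ∀ A, r * F A = (2 : ℝ) • pd A r) (f : SFun q N U) :
    lap E F (lap E F f + nuF E F * f) + nuF E F * (lap E F f + nuF E F * f) = 0 := by
  have hν := hE.nuC_hp hU
  have h1 : ∀ g, r * (lap E F g + nuF E F * g) = lap E 0 (r * g) + nuC E * (r * g) := by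
    intro g
    rw [nuF_eq, add_mul, ← add_assoc, mul_add r, mul_lap_add hE hr h, ← mul_assoc r,
      (hr.even.commute (nuC E)).eq, mul_assoc]
  refine hr.mul_left_cancel ?_
  rw [h1, h1, hE.lap_add_sq isConnParity_zero hν, hE.lap_zero_sq hU hJ, hE.lap_nuC hU hJ, mul_zero]
  simp

theorem lap_nuF_of_dlog (hE : IsOddSkew E) (hU : IsUnit E) (hF : IsConnParity F) (hJ : JacobiBr E)
    (hr : IsDensity r) (h : ∀ A, r * F A = (2 : ℝ) • pd A r) : lap E F (nuF E F) = 0 := by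
  have h1 := lap_add_nuF_sq hE hU hJ hr h 1
  rw [hE.lap_add_sq hF (nuF_hp hE hU hF), lap_one, map_zero, mul_one] at h1
  have : br E (nuF E F) 1 = 0 := by
    rw [← map_one sconst]; exact br_sconst_right _ _
  rwa [this, sub_zero, zero_add] at h1

theorem lap_sq_of_dlog (hE : IsOddSkew E) (hU : IsUnit E) (hF : IsConnParity F) (hJ : JacobiBr E)
    (hr : IsDensity r) (h : ∀ A, r * F A = (2 : ℝ) • pd A r) (f : SFun q N U) :
    lap E F (lap E F f) = br E (nuF E F) f := by
  have h1 := lap_add_nuF_sq hE hU hJ hr h f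
  rw [hE.lap_add_sq hF (nuF_hp hE hU hF), lap_nuF_of_dlog hE hU hF hJ hr h, zero_mul,
    add_zero] at h1
  exact sub_eq_zero.mp h1

/-! ### Restriction to smaller domains -/

theorem sres_lap (h : V ≤ U) (f : SFun q N U) :
    sres h (lap E F f) = lap (E.map (sres h)) (fun A => sres h (F A)) (sres h f) := by
  simp only [lap_apply, map_sum, map_smul, map_add, map_mul, sres_pd, Matrix.map_apply]

theorem sres_br (h : V ≤ U) (f g : SFun q N U) :
    sres h (br E f g) = br (E.map (sres h)) (sres h f) (sres h g) := by
  have ht : ∀ n (f : SFun q N U), sres h (tw n f) = tw n (sres h f) := by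
    intro n f
    induction n with
    | zero => rfl
    | succ n ih => rw [add_comm, tw_add, tw_add, tw_one, tw_one, sres_parity, ih]
  simp only [br_apply, map_sum, map_mul, sres_pd, Matrix.map_apply, ht]

theorem IsOddSkew.sres (hE : IsOddSkew E) (h : V ≤ U) : IsOddSkew (E.map (sres h)) :=
  ⟨fun A B => HP.sres (hE.1 A B) h, fun A B => by
    simp only [Matrix.map_apply]
    rw [← map_smul, ← map_neg, ← hE.2]⟩

theorem IsConnParity.sres (hF : IsConnParity F) (h : V ≤ U) :
    IsConnParity fun A => sres h (F A) := fun A => HP.sres (hF A) h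

theorem IsFlatConn.sres (hF : IsFlatConn F) (h : V ≤ U) : IsFlatConn fun A => sres h (F A) :=
  fun A B => by
    have := congrArg (BV.sres h) (hF A B)
    rwa [map_sub, map_smul, sres_pd, sres_pd, map_zero] at this

theorem lower_sres (hU : IsUnit E) (h : V ≤ U) :
    lower (E.map (sres h)) = (lower E).map (sres h) := by
  refine eq_lower (hU.map (AlgHom.mapMatrix (sres h))) fun A C => ?_
  have := congrArg (sres h) (mul_lower hU A C)
  simp only [map_sum, map_mul] at this
  refine this.trans ?_
  split_ifs
  · exact map_one _
  · exact map_zero _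

theorem isUnit_sres (hU : IsUnit E) (h : V ≤ U) : IsUnit (E.map (sres h)) :=
  hU.map (AlgHom.mapMatrix (sres h))

theorem sres_nuF (hU : IsUnit E) (h : V ≤ U) :
    sres h (nuF E F) = nuF (E.map (sres h)) fun A => sres h (F A) := by
  simp only [nuF, nuF0, nu1, nu2, map_add, map_sub, map_smul, map_sum, map_mul, sres_pd,
    Matrix.map_apply, lower_sres hU]

theorem JacobiCoord.sres (hJ : JacobiCoord E) (h : V ≤ U) : JacobiCoord (E.map (sres h)) := by
  intro A B C
  have := congrArg (BV.sres h) (hJ A B C)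
  simpa only [map_add, map_smul, sres_br, sres_coord, map_zero,
    Matrix.map_apply] using this

end Gauge

section Poincare

variable {p q N : ℕ} {U V : Opens (Fin p → ℝ)}

/-! ### The Poincaré lemma -/

theorem fderiv_ext0_apply (f : SmoothFn U) {x : Fin p → ℝ} (hx : x ∈ U) (v : Fin p → ℝ) :
    fderiv ℝ (ext0 f.1) x v = ∑ i, v i * (smoothPd U i f).1 ⟨x, hx⟩ := by
  conv_lhs => rw [pi_eq_sum_univ' v, map_sum]
  refine Finset.sum_congr rfl fun i _ => ?_
  rw [map_smul, smul_eq_mul]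
  rfl

/-- A closed one-form with smooth coefficients on a convex domain is exact. -/
theorem exists_smoothPd_eq (hU : Convex ℝ (U : Set (Fin p → ℝ))) (f : Fin p → SmoothFn U)
    (hf : ∀ i j, smoothPd U i (f j) = smoothPd U j (f i)) :
    ∃ g : SmoothFn U, ∀ i, smoothPd U i g = f i := by
  let w : (Fin p → ℝ) → (Fin p → ℝ) →L[ℝ] ℝ := fun x =>
    ∑ i, ext0 (f i).1 x • ContinuousLinearMap.proj (R := ℝ) (φ := fun _ : Fin p => ℝ) i
  have hw : ContDiffOn ℝ ∞ w U :=
    ContDiffOn.sum fun i _ => (ext0_contDiffOn (f i)).smul contDiffOn_const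
  have hwd : ∀ (a) (ha : a ∈ U), ∀ x y, fderiv ℝ w a x y =
      ∑ i, ∑ j, x j * y i * (smoothPd U j (f i)).1 ⟨a, ha⟩ := by
    intro a ha x y
    have hd : ∀ i, DifferentiableAt ℝ (ext0 (f i).1) a := fun i =>
      ext0_differentiableAt (f i) ⟨a, ha⟩
    have : HasFDerivAt w (∑ i, (fderiv ℝ (ext0 (f i).1) a).smulRight
        (ContinuousLinearMap.proj (R := ℝ) (φ := fun _ : Fin p => ℝ) i)) a := by
      have h := HasFDerivAt.fun_sum (u := Finset.univ) fun i (_ : i ∈ Finset.univ) =>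
        (hd i).hasFDerivAt.smul_const
          (ContinuousLinearMap.proj (R := ℝ) (φ := fun _ : Fin p => ℝ) i)
      exact h
    rw [this.fderiv]
    simp only [sum_apply, ContinuousLinearMap.smulRight_apply,
      smul_apply, ContinuousLinearMap.proj_apply, smul_eq_mul,
      fderiv_ext0_apply _ ha, Finset.sum_mul]
    refine Finset.sum_congr rfl fun i _ => Finset.sum_congr rfl fun j _ => ?_
    ring
  obtain ⟨g, hg⟩ := hU.exists_forall_hasFDerivAt_of_fderiv_symmetric U.isOpen
    (hw.differentiableOn (by simp)) fun a ha x y => by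
      rw [hwd a ha, hwd a ha, Finset.sum_comm]
      refine Finset.sum_congr rfl fun i _ => Finset.sum_congr rfl fun j _ => ?_
      rw [hf]; ring
  have hgs : ContDiffOn ℝ ∞ g U := by
    rw [contDiffOn_infty_iff_fderiv_of_isOpen U.isOpen]
    exact ⟨fun x hx => (hg x hx).differentiableAt.differentiableWithinAt,
      hw.congr fun x hx => (hg x hx).fderiv⟩
  let G : SmoothFn U := ⟨fun x => g x.1, hgs.congr fun x hx => ext0_apply _ hx⟩
  refine ⟨G, fun i => smoothFn_ext fun x => ?_⟩
  have e : ext0 G.1 =ᶠ[nhds x.1] g := by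
    filter_upwards [U.isOpen.mem_nhds x.2] with y hy using ext0_apply _ hy
  rw [smoothPd_apply, e.fderiv_eq, (hg x.1 x.2).fderiv]
  simp [w, Pi.single_apply, ext0_apply _ x.2]

/-- On a convex domain, the even components of a flat connection can be integrated. -/
theorem IsFlatConn.exists_pd_inl (hU : Convex ℝ (U : Set (Fin p → ℝ))) {F : Idx p q → SFun q N U}
    (hF : IsFlatConn F) : ∃ ψ : SFun q N U, ∀ i, pd (Sum.inl i) ψ = F (Sum.inl i) := by
  classical
  have h : ∀ k, ∃ g : SmoothFn U, ∀ i, smoothPd U i g = comp k (F (Sum.inl i)) := fun k =>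
    exists_smoothPd_eq hU _ fun i j => by
      have := hF (Sum.inl i) (Sum.inl j)
      simp only [ε, mul_zero, sg_zero, one_smul, sub_eq_zero] at this
      rw [← comp_pd_inl, ← comp_pd_inl, this]
  choose g hg using h
  choose s hs0 hs using fun i => SFun.exists_eq_sum (F (Sum.inl i))
  let b := Module.Basis.ofVectorSpace ℝ (ExteriorAlgebra ℝ (Fin q ⊕ Fin N → ℝ))
  refine ⟨∑ k ∈ Finset.univ.biUnion s, tm (g k) (b k), fun i => ?_⟩
  rw [map_sum, hs i, ← Finset.sum_subset (Finset.subset_biUnion_of_mem s (Finset.mem_univ i))]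
  · refine Finset.sum_congr rfl fun k _ => ?_
    rw [pd_inl_tm, hg]
  · intro k _ hk
    rw [pd_inl_tm, hg, hs0 i k hk, tm_zero_left]

theorem isFlatConn_pd (ψ : SFun q N U) : IsFlatConn fun A => pd A ψ := fun A B => by
  rw [pd_comm A B, sub_self]

theorem IsFlatConn.sub {F G : Idx p q → SFun q N U} (hF : IsFlatConn F) (hG : IsFlatConn G) :
    IsFlatConn fun A => F A - G A := fun A B => by
  have h1 := hF A B
  have h2 := hG A B
  rw [map_sub, map_sub, smul_sub]
  linear_combination (norm := module) h1 - h2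

/-- A flat connection without even components is exact: the odd components are integrated one
after the other, the primitive of the `a`-th one being `θ^a F_a`. -/
theorem IsFlatConn.exists_pd_inr (s : Finset (Fin q)) {F : Idx p q → SFun q N U}
    (hF : IsFlatConn F) (h0 : ∀ i, F (Sum.inl i) = 0) :
    ∃ ψ : SFun q N U, (∀ i, pd (Sum.inl i) ψ = 0) ∧ ∀ a ∈ s, pd (Sum.inr a) ψ = F (Sum.inr a) := by
  classical
  induction s using Finset.induction_on with
  | empty => exact ⟨0, by simp, by simp⟩
  | insert a s ha ih =>
    obtain ⟨ψ, h1, h2⟩ := ih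
    have hG := hF.sub (isFlatConn_pd ψ)
    set G : Idx p q → SFun q N U := fun A => F A - pd A ψ with hGdef
    have hG0 : ∀ i, G (Sum.inl i) = 0 := fun i => by rw [hGdef]; simp only [h0, h1, sub_zero]
    have hGs : ∀ b ∈ s, G (Sum.inr b) = 0 := fun b hb => by
      rw [hGdef]; simp only [h2 b hb, sub_self]
    have hz : ∀ B, G B = 0 → pd B (G (Sum.inr a)) = 0 := fun B hB => by
      have := hG B (Sum.inr a)
      rwa [hB, map_zero, smul_zero, sub_zero] at this
    have hp : ∀ B, pd B (coord (Sum.inr a) * G (Sum.inr a)) =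
        (if B = Sum.inr a then G (Sum.inr a) else 0) +
        sg (ε B * 1) • (coord (Sum.inr a) * pd B (G (Sum.inr a))) := fun B => by
      have h := (hp_coord (U := U) (N := N) (Sum.inr a : Idx p q)).pd_mul B (G (Sum.inr a))
      rw [h, pd_coord, ite_mul, one_mul, zero_mul]; rfl
    refine ⟨ψ + coord (Sum.inr a) * G (Sum.inr a), fun i => ?_, fun b hb => ?_⟩
    · rw [map_add, h1, hp, hz _ (hG0 i)]; simp
    · rw [map_add, hp]
      rcases Finset.mem_insert.mp hb with rfl | hb
      · have h3 := hG (Sum.inr b) (Sum.inr b)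
        simp only [ε, mul_one, sg_one, neg_smul, one_smul, sub_neg_eq_add, ← two_smul ℝ] at h3
        have h4 : pd (Sum.inr b) (G (Sum.inr b)) = 0 := by simpa using h3
        rw [h4, if_pos rfl, mul_zero, smul_zero, add_zero, hGdef]
        simp
      · have hne : (Sum.inr b : Idx p q) ≠ Sum.inr a := by
          rintro h; cases h; exact ha hb
        rw [hz _ (hGs b hb), if_neg hne, h2 b hb]; simp

/-- The Poincaré lemma for superfunctions. -/
theorem IsFlatConn.exists_pd_eq (hU : Convex ℝ (U : Set (Fin p → ℝ))) {F : Idx p q → SFun q N U}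
    (hF : IsFlatConn F) (hp : IsConnParity F) : ∃ ψ : SFun q N U, HP 0 ψ ∧ ∀ A, pd A ψ = F A := by
  obtain ⟨ψ, hψ⟩ := hF.exists_pd_inl hU
  obtain ⟨φ, h1, h2⟩ := (hF.sub (isFlatConn_pd ψ)).exists_pd_inr Finset.univ
    fun i => by rw [hψ, sub_self]
  have h3 : ∀ A, pd A (ψ + φ) = F A := by
    rintro (i | a)
    · rw [map_add, h1, hψ, add_zero]
    · rw [map_add, h2 a (Finset.mem_univ a)]; abel
  refine ⟨(1 / 2 : ℝ) • (ψ + φ + parity (ψ + φ)), ?_, fun A => ?_⟩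
  · rw [HP, HasParity, map_smul, map_add parity (ψ + φ), parity_parity, sg_zero, one_smul, add_comm]
  · have h4 : pd A (parity (ψ + φ)) = F A := by
      have := parity_pd A (ψ + φ)
      rw [h3, hp A] at this
      have h5 := congrArg (fun x => sg (ε A) • x) this
      simp only [smul_smul, sg_mul_self, one_smul] at h5
      exact h5.symm
    rw [map_smul, map_add, h3, h4, ← two_smul ℝ, smul_smul]
    norm_num

/-- A flat connection is locally the logarithmic derivative of a density. -/
theorem IsFlatConn.exists_isDLog {F : Idx p q → SFun q N U} (hF : IsFlatConn F)
    (hp : IsConnParity F) {x : Fin p → ℝ} (hx : x ∈ U) :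
    ∃ (V : Opens (Fin p → ℝ)) (hV : V ≤ U), x ∈ V ∧ ∃ ρ : SFun q N V, IsDensity ρ ∧
      IsDLog (fun A => BV.sres hV (F A)) ρ := by
  obtain ⟨r, hr, hrU⟩ := Metric.isOpen_iff.mp U.isOpen x hx
  let V : Opens (Fin p → ℝ) := ⟨Metric.ball x r, Metric.isOpen_ball⟩
  have hV : V ≤ U := hrU
  obtain ⟨ψ, hψ, h⟩ := (hF.sres hV).exists_pd_eq (convex_ball x r) (hp.sres hV)
  obtain ⟨ρ, hρ, hd⟩ := hψ.exists_exp
  refine ⟨V, hV, Metric.mem_ball_self hr, ρ, hρ, hρ.isDLog_iff.mpr fun A => ?_⟩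
  rw [hd, h]

/-- A connection that is locally a logarithmic derivative is flat. -/
theorem isFlatConn_of_local {F : Idx p q → SFun q N U}
    (h : ∀ x ∈ U, ∃ (V : Opens (Fin p → ℝ)) (hV : V ≤ U), x ∈ V ∧
      ∃ ρ : SFun q N V, IsDensity ρ ∧ IsDLog (fun A => sres hV (F A)) ρ) : IsFlatConn F := by
  intro A B
  refine SFun.ext_local fun x hx => ?_
  obtain ⟨V, hV, hxV, ρ, hρ, hd⟩ := h x hx
  refine ⟨V, hV, hxV, ?_⟩
  rw [map_sub, map_smul, sres_pd, sres_pd, map_zero]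
  exact hd.isFlatConn hρ A B

/-! ### Functions with vanishing derivatives -/

/-- A smooth function with vanishing derivatives on a connected domain is constant. -/
theorem smoothFn_eq_const (hU : IsPreconnected (U : Set (Fin p → ℝ))) (f : SmoothFn U)
    (hf : ∀ i, smoothPd U i f = 0) (x y : U) : f.1 x = f.1 y := by
  have h := U.isOpen.is_const_of_fderiv_eq_zero (𝕜 := ℝ) hU
    ((ext0_contDiffOn f).differentiableOn (by simp)) (fun z hz => by
      ext v
      rw [fderiv_ext0_apply _ hz]
      simp only [hf]
      simp) x.2 y.2
  rwa [ext0_apply _ x.2, ext0_apply _ y.2] at h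

theorem evalAt_pd_inr (x : U) (a : Fin q) (f : SFun q N U) :
    evalAt x (pd (Sum.inr a) f) = contr (LinearMap.proj (Sum.inl a)) (evalAt x f) := by
  induction f using SFun.induction with
  | tmul f l => rw [pd_inr_tm, evalAt_tm, evalAt_tm, map_smul]
  | add y z hy hz => simp only [map_add, hy, hz]

/-- The projection that sets the odd coordinates in `s` to zero. -/
def killOdd (N : ℕ) (s : Finset (Fin q)) : (Fin q ⊕ Fin N → ℝ) →ₗ[ℝ] (Fin q ⊕ Fin N → ℝ) :=
  LinearMap.id - ∑ a ∈ s, (LinearMap.proj (Sum.inl a) :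
    Module.Dual ℝ (Fin q ⊕ Fin N → ℝ)).smulRight (Pi.single (Sum.inl a) 1)

theorem killOdd_apply (s : Finset (Fin q)) (v : Fin q ⊕ Fin N → ℝ) :
    killOdd N s v = v - ∑ a ∈ s, v (Sum.inl a) • Pi.single (Sum.inl a) (1 : ℝ) := by
  simp only [killOdd, LinearMap.sub_apply, LinearMap.id_apply, LinearMap.sum_apply,
    LinearMap.smulRight_apply, LinearMap.proj_apply]

/-- A form whose contractions with all odd coordinates vanish does not contain them. -/
theorem map_killOdd_of_contr_eq_zero (s : Finset (Fin q))
    (l : ExteriorAlgebra ℝ (Fin q ⊕ Fin N → ℝ))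
    (h : ∀ a : Fin q, contr (LinearMap.proj (Sum.inl a)) l = 0) :
    ExteriorAlgebra.map (killOdd N s) l = l := by
  classical
  induction s using Finset.induction_on with
  | empty =>
    have : killOdd N (∅ : Finset (Fin q)) = LinearMap.id := by simp [killOdd]
    rw [this, ExteriorAlgebra.map_id]; rfl
  | insert a s ha ih =>
    have e : killOdd N (insert a s) = (LinearMap.id - (LinearMap.proj (Sum.inl a) :
        Module.Dual ℝ (Fin q ⊕ Fin N → ℝ)).smulRight (Pi.single (Sum.inl a) 1)) ∘ₗ
          killOdd N s := by
      refine LinearMap.ext fun v => ?_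
      have h0 : (killOdd N s v) (Sum.inl a) = v (Sum.inl a) := by
        rw [killOdd_apply, Pi.sub_apply, Finset.sum_apply, Finset.sum_eq_zero, sub_zero]
        intro b hb
        have : a ≠ b := fun h => ha (h ▸ hb)
        simp [this]
      rw [LinearMap.comp_apply, LinearMap.sub_apply, LinearMap.smulRight_apply,
        LinearMap.proj_apply, h0, LinearMap.id_apply, killOdd_apply, killOdd_apply,
        Finset.sum_insert ha]
      abel
    have h2 := eq_map_add_ι_mul_contr (LinearMap.proj (Sum.inl a) :
        Module.Dual ℝ (Fin q ⊕ Fin N → ℝ)) (Pi.single (Sum.inl a) 1) l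
    rw [h, mul_zero, add_zero] at h2
    rw [e, ← ExteriorAlgebra.map_comp_map, AlgHom.comp_apply, ih, ← h2]

/-- A superfunction with vanishing derivatives on a connected domain is a constant. -/
theorem exists_eq_sconst (hU : _root_.IsConnected (U : Set (Fin p → ℝ))) (f : SFun q N U)
    (hf : ∀ A, pd A f = 0) : ∃ c, f = sconst c := by
  obtain ⟨x₀, hx₀⟩ := hU.nonempty
  -- the coefficients are constant
  have h1 : f = tm 1 (evalAt ⟨x₀, hx₀⟩ f) := by
    refine SFun.ext_comp fun k => smoothFn_ext fun x => ?_
    rw [smoothFn_eq_const hU.isPreconnected (comp k f) (fun i => by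
      rw [← comp_pd_inl, hf, map_zero]) x ⟨x₀, hx₀⟩, comp_evalAt, comp_tm]
    exact (mul_one _).symm
  set l := evalAt ⟨x₀, hx₀⟩ f with hl
  have h2 := map_killOdd_of_contr_eq_zero Finset.univ l fun a => by
    rw [hl, ← evalAt_pd_inr, hf, map_zero]
  refine ⟨ExteriorAlgebra.map (LinearMap.funLeft ℝ ℝ Sum.inr) l, ?_⟩
  have e : (Function.ExtendByZero.linearMap ℝ (Sum.inr : Fin N → Fin q ⊕ Fin N)) ∘ₗ
      LinearMap.funLeft ℝ ℝ Sum.inr = killOdd N Finset.univ := by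
    refine LinearMap.ext fun v => funext fun j => ?_
    rw [killOdd_apply, LinearMap.comp_apply]
    rcases j with a | b
    · have h0 : ¬ ∃ b : Fin N, (Sum.inr b : Fin q ⊕ Fin N) = Sum.inl a := by simp
      refine (Function.extend_apply' _ (0 : Fin q ⊕ Fin N → ℝ) _ h0).trans ?_
      simp [Pi.single_apply]
    · refine (Sum.inr_injective.extend_apply _ (0 : Fin q ⊕ Fin N → ℝ) b).trans ?_
      simp [LinearMap.funLeft]
  rw [sconst_eq, ← AlgHom.comp_apply, ExteriorAlgebra.map_comp_map, e, h2]
  exact h1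

/-- The constants embed into the superfunctions on a non-empty domain. -/
theorem sconst_injective (x : U) : Function.Injective (sconst : Grass N → SFun q N U) := by
  have h : ∀ c : Grass N, ExteriorAlgebra.map (LinearMap.funLeft ℝ ℝ Sum.inr)
      (evalAt x (sconst c : SFun q N U)) = c := by
    intro c
    have e : LinearMap.funLeft ℝ ℝ Sum.inr ∘ₗ
        (Function.ExtendByZero.linearMap ℝ (Sum.inr : Fin N → Fin q ⊕ Fin N)) = LinearMap.id :=
      LinearMap.ext fun v => funext fun b =>
        Sum.inr_injective.extend_apply v (0 : Fin q ⊕ Fin N → ℝ) b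
    rw [sconst_eq, evalAt_tm]
    refine (congrArg _ (one_smul ℝ _)).trans ?_
    rw [← AlgHom.comp_apply, ExteriorAlgebra.map_comp_map, e, ExteriorAlgebra.map_id]
    rfl
  intro c d hcd
  rw [← h c, hcd, h]

end Poincare

section Operators

variable {p q N : ℕ} {U V : Opens (Fin p → ℝ)}
variable {E : Matrix (Idx p q) (Idx p q) (SFun q N U)} {F : Idx p q → SFun q N U}
variable {D : SFun q N U →ₗ[ℝ] SFun q N U}

/-! ### Odd second-order operators -/

/-- `D` is Grassmann-odd. -/
def IsOddOp (D : SFun q N U →ₗ[ℝ] SFun q N U) : Prop :=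
  ∀ f, parity (D f) = -D (parity f)

theorem IsOddOp.hp (hD : IsOddOp D) {a : ℕ} {f : SFun q N U} (hf : HP a f) : HP (a + 1) (D f) := by
  rw [HP, HasParity, hD, hf, map_smul, sg_add, sg_one, mul_neg_one, neg_smul]

theorem IsOddOp.hp_one (hD : IsOddOp D) : HP 1 (D 1) := by
  have := hD.hp HP.one
  rwa [zero_add] at this

theorem IsSecondOrderOp.sub {D' : SFun q N U →ₗ[ℝ] SFun q N U} (hD : IsSecondOrderOp D)
    (hD' : IsSecondOrderOp D') : IsSecondOrderOp (D - D') := by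
  obtain ⟨a, b, c, h⟩ := hD
  obtain ⟨a', b', c', h'⟩ := hD'
  refine ⟨fun A B => a A B - a' A B, fun A => b A - b' A, c - c', fun f => ?_⟩
  rw [LinearMap.sub_apply, h, h']
  simp only [sub_mul, Finset.sum_sub_distrib]
  abel

theorem pd_pd_coord (A B C : Idx p q) : pd A (pd B (coord C : SFun q N U)) = 0 := by
  rw [pd_coord]
  split_ifs
  · exact pd_one A
  · exact map_zero _

theorem pd_pd_coord_mul (A B C K : Idx p q) :
    pd A (pd B (coord C * coord K : SFun q N U)) =
      (if A = K ∧ B = C then 1 else 0) + if A = C ∧ B = K then sg (ε C * ε K) • 1 else 0 := by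
  rw [(hp_coord C).pd_mul, pd_coord, pd_coord, map_add, map_smul]
  have e1 : pd A ((if B = C then (1 : SFun q N U) else 0) * coord K) =
      if A = K ∧ B = C then 1 else 0 := by
    by_cases h : B = C
    · simp only [h, if_true, one_mul, pd_coord, and_true]
    · simp [h]
  have e2 : sg (ε B * ε C) • pd A ((coord C : SFun q N U) * if B = K then 1 else 0) =
      if A = C ∧ B = K then sg (ε C * ε K) • 1 else 0 := by
    by_cases h : B = K
    · simp only [h, if_true, mul_one, pd_coord, and_true, smul_ite, smul_zero, mul_comm]
    · simp [h]
  rw [e1, e2]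

/-- A second-order operator is determined by its values on constants, coordinates, and products of
two coordinates. -/
theorem IsSecondOrderOp.eq_zero (hD : IsSecondOrderOp D) (h1 : D 1 = 0)
    (hc : ∀ C, D (coord C) = 0) (hcc : ∀ C K, D (coord C * coord K) = 0) : D = 0 := by
  obtain ⟨a, b, c, h⟩ := hD
  have hc0 : c = 0 := by
    have := h 1
    simpa [pd_one, h1] using this.symm
  have hb0 : ∀ C, b C = 0 := by
    intro C
    have := h (coord C)
    simp only [hc, pd_pd_coord, mul_zero, Finset.sum_const_zero, zero_add, hc0, zero_mul,
      add_zero] at this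
    simp only [pd_coord, mul_ite, mul_zero, mul_one, Finset.sum_ite_eq', Finset.mem_univ, if_true] at this
    exact this.symm
  -- only the graded symmetric part of the leading coefficients acts, and it vanishes
  have ha0 : ∀ C K, a K C + sg (ε C * ε K) • a C K = 0 := by
    intro C K
    have := h (coord C * coord K)
    simp only [hcc, hb0, hc0, zero_mul, Finset.sum_const_zero, add_zero, pd_pd_coord_mul,
      mul_add (R := SFun q N U), mul_ite, mul_one, mul_zero, Finset.sum_add_distrib, ite_and,
      mul_smul_comm, Finset.sum_ite_eq', Finset.sum_ite_irrel, Finset.mem_univ, if_true,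
      Finset.sum_const_zero] at this
    exact this.symm
  refine LinearMap.ext fun f => ?_
  rw [h, hc0]
  simp only [hb0, zero_mul, Finset.sum_const_zero, add_zero, LinearMap.zero_apply]
  set X := ∑ A, ∑ B, a A B * pd A (pd B f) with hX
  have h2 : X = -X := by
    conv_lhs => rw [hX, Finset.sum_comm]
    rw [hX, ← Finset.sum_neg_distrib]
    refine Finset.sum_congr rfl fun A _ => ?_
    rw [← Finset.sum_neg_distrib]
    refine Finset.sum_congr rfl fun B _ => ?_
    rw [pd_comm B A, eq_neg_of_add_eq_zero_left (ha0 A B), neg_mul, smul_mul_assoc, mul_smul_comm,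
      smul_smul, mul_comm (ε A), sg_mul_self, one_smul]
  have : (2 : ℝ) • X = 0 := by rw [two_smul]; nth_rw 1 [h2]; abel
  simpa using this

theorem IsOddSkew.lap_isSecondOrderOp (hE : IsOddSkew E) (F : Idx p q → SFun q N U)
    (ν : SFun q N U) : IsSecondOrderOp (lap E F + LinearMap.mulLeft ℝ ν) := by
  refine ⟨fun A B => (sg (ε A) / 2) • sg (ε A * (ε A + ε B + 1)) • E A B,
    fun B => ∑ A, (sg (ε A) / 2) • (pd A (E A B) + F A * E A B), ν, fun f => ?_⟩
  rw [LinearMap.add_apply, LinearMap.mulLeft_apply, lap_apply]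
  congr 1
  simp only [Finset.sum_mul]
  rw [Finset.sum_comm (f := fun B A => (sg (ε A) / 2) • (pd A (E A B) + F A * E A B) * pd B f),
    ← Finset.sum_add_distrib]
  refine Finset.sum_congr rfl fun A _ => ?_
  rw [← Finset.sum_add_distrib]
  refine Finset.sum_congr rfl fun B _ => ?_
  rw [(hE.hp A B).pd_mul]
  simp only [smul_mul_assoc, add_mul (R := SFun q N U), mul_assoc]
  module

/-- The antibracket of `Δ_F + ν` is the one with components `E^{AB}`. -/
theorem antibracket_eq_br (hE : IsOddSkew E) (hF : IsConnParity F) {ν : SFun q N U} (hν : HP 1 ν)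
    (hD : ∀ f, D f = lap E F f + ν * f) (f g : SFun q N U) : antibracket parity D f g = br E f g := by
  have hν1 : D 1 = ν := by rw [hD, lap_one, zero_add, mul_one]
  have hlin : ∀ f f' g, antibracket parity D (f + f') g =
      antibracket parity D f g + antibracket parity D f' g := fun f f' g => by
    simp only [antibracket, map_add, add_mul]; abel
  have hlin' : ∀ f g g', antibracket parity D f (g + g') =
      antibracket parity D f g + antibracket parity D f g' := fun f g g' => by
    simp only [antibracket, map_add, mul_add, add_mul]; abel
  have key : ∀ {a b : ℕ} {f g : SFun q N U}, HP a f → HP b g →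
      antibracket parity D f g = br E f g := by
    intro a b f g hf hg
    rw [antibracket, hν1, hf, hg, smul_mul_assoc, map_smul, map_smul, hD, hD, hD,
      hE.lap_mul hF hf, smul_mul_assoc, mul_smul_comm, mul_add f, smul_mul_assoc, mul_assoc f g,
      hg.comm hν, mul_one, mul_smul_comm, smul_smul, sg_mul_self, one_smul, add_mul, mul_assoc ν]
    have ha := sg_mul_self a
    linear_combination (norm := module) ha • (f * lap E F g) + ha • br E f g
  obtain ⟨f₀, f₁, h0, h1, rfl⟩ := exists_even_add_odd f
  obtain ⟨g₀, g₁, k0, k1, rfl⟩ := exists_even_add_odd g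
  rw [hlin, hlin', hlin', key h0 k0, key h0 k1, key h1 k0, key h1 k1]
  simp only [map_add, LinearMap.add_apply]
  abel

theorem IsOddOp.opE_eq (hD : IsOddOp D) (A B : Idx p q) :
    D (coord A * coord B) = sg (ε A) • opE D A B + D (coord A) * coord B +
      sg (ε A) • (coord A * D (coord B)) - D 1 * (coord A * coord B) := by
  have hA := hp_coord (U := U) (N := N) A
  have hB := hp_coord (U := U) (N := N) B
  have e : coord A * coord B * D 1 = sg (ε A + ε B) • (D 1 * (coord A * coord B)) := by
    rw [(hA.mul hB).comm hD.hp_one, mul_one]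
  rw [opE, Matrix.of_apply, antibracket, hA, hB, smul_mul_assoc, map_smul, map_smul,
    smul_mul_assoc, mul_smul_comm, smul_mul_assoc, e, sg_add]
  have h1 := sg_mul_self (ε A)
  have h2 := sg_mul_self (ε B)
  linear_combination (norm := module) (-h1) • D (coord A * coord B) +
    h1 • (D (coord A) * coord B) - (sg (ε B) * sg (ε B) * h1 + h2) • (D 1 * (coord A * coord B))

theorem IsOddOp.opE_isOddSkew (hD : IsOddOp D) : IsOddSkew (opE D) := by
  have hc := fun A => hp_coord (U := U) (N := N) (A : Idx p q)
  have key : ∀ A B, opE D A B = sg (ε A) • (D (coord A * coord B) - D (coord A) * coord B -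
      sg (ε A) • (coord A * D (coord B)) + D 1 * (coord A * coord B)) := by
    intro A B
    have h1 := sg_mul_self (ε A)
    rw [hD.opE_eq A B]
    linear_combination (norm := module) (-h1) • opE D A B
  refine ⟨fun A B => ?_, fun A B => ?_⟩
  · rw [key]
    refine HP.smul (HP.add (HP.sub (HP.sub ?_ ?_) (HP.smul ?_ _)) ?_) _
    · exact hD.hp ((hc A).mul (hc B))
    · exact ((hD.hp (hc A)).mul (hc B)).congr (by omega)
    · exact ((hc A).mul (hD.hp (hc B))).congr (by omega)
    · exact (hD.hp_one.mul ((hc A).mul (hc B))).congr (by omega)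
  · rw [key, key, (hc A).comm (hc B), map_smul, (hD.hp (hc A)).comm (hc B),
      (hc A).comm (hD.hp (hc B)), mul_smul_comm]
    simp only [smul_sub, smul_add, smul_smul]
    rw [← sub_eq_zero]
    have e1 : sg ((ε A + 1) * (ε B + 1)) = -(sg (ε A * ε B) * sg (ε A) * sg (ε B)) := by
      rw [← sg_add, ← sg_add, neg_sg]; congr 1; ring
    have e2 : sg ((ε A + 1) * ε B) = sg (ε A * ε B) * sg (ε B) := by
      rw [← sg_add]; congr 1; ring
    have e3 : sg (ε A * (ε B + 1)) = sg (ε A * ε B) * sg (ε A) := by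
      rw [← sg_add]; congr 1
    rw [e1, e2, e3]
    have h1 := sg_mul_self (ε A)
    have h2 := sg_mul_self (ε B)
    generalize sg (ε A) = s at h1 ⊢
    generalize sg (ε B) = t at h2 ⊢
    generalize sg (ε A * ε B) = z
    linear_combination (norm := module) ((z * s) • -h2) • (D (coord B * coord A)) +
      ((z * s * t) • h2) • (coord B * D (coord A)) +
      ((z * s) • h2 - (z * s) • h1) • (D (coord B) * coord A) -
      ((z * s) • h2) • (D 1 * (coord B * coord A))

theorem IsOddOp.opF_isConnParity (hD : IsOddOp D) (hU : IsUnit (opE D)) :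
    IsConnParity (opF D) := by
  have hE := hD.opE_isOddSkew
  have hc := fun A => hp_coord (U := U) (N := N) (A : Idx p q)
  intro C
  refine HP.smul (HP.sum fun B _ => ?_) _
  refine (HP.mul (a := ε B + 1) (HP.sub (HP.smul (HP.sub (hD.hp (hc B)) ?_) _)
    (HP.sum fun A _ => HP.smul ?_ _)) (hE.lower_hp hU B C)).congr (by omega)
  · exact (hD.hp_one.mul (hc B)).congr (by omega)
  · exact ((hE.hp A B).pd A).congr (by omega)

theorem lap_coord_eq (F : Idx p q → SFun q N U) (B : Idx p q) :
    lap E F (coord B) = ∑ A, (sg (ε A) / 2) • (pd A (E A B) + F A * E A B) := by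
  rw [lap_apply]
  refine Finset.sum_congr rfl fun A _ => ?_
  simp only [pd_coord]
  rw [Finset.sum_eq_single B]
  · simp
  · intro C _ hC; simp [hC]
  · simp

/-- The components `opF` are chosen so that `Δ_F` and `D - D1` agree on coordinates. -/
theorem lap_opF_coord (hU : IsUnit (opE D)) (B : Idx p q) :
    lap (opE D) (opF D) (coord B) = D (coord B) - D 1 * coord B := by
  have h1 : ∑ A, sg (ε A) • (opF D A * opE D A B) =
      (2 : ℝ) • (D (coord B) - D 1 * coord B) - ∑ A, sg (ε A) • pd A (opE D A B) := by
    simp only [opF, smul_mul_assoc, smul_smul, sg_mul_self, one_smul, Finset.sum_mul, mul_assoc]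
    rw [Finset.sum_comm]
    simp only [← Finset.mul_sum, lower_mul hU]
    simp
  have h2 : lap (opE D) (opF D) (coord B) = (1 / 2 : ℝ) • (∑ A, sg (ε A) • pd A (opE D A B) +
      ∑ A, sg (ε A) • (opF D A * opE D A B)) := by
    rw [lap_coord_eq, ← Finset.sum_add_distrib, Finset.smul_sum]
    refine Finset.sum_congr rfl fun A _ => ?_
    module
  rw [h2, h1]
  module

/-- An odd second-order operator is `Δ_F + ν`. -/
theorem IsOddOp.eq_lap_add (hD : IsOddOp D) (h2 : IsSecondOrderOp D) (hU : IsUnit (opE D))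
    (f : SFun q N U) : D f = lap (opE D) (opF D) f + D 1 * f := by
  have hE := hD.opE_isOddSkew
  have hF := hD.opF_isConnParity hU
  have hc := fun A => hp_coord (U := U) (N := N) (A : Idx p q)
  have key : D - (lap (opE D) (opF D) + LinearMap.mulLeft ℝ (D 1)) = 0 := by
    refine (h2.sub (hE.lap_isSecondOrderOp _ _)).eq_zero ?_ (fun C => ?_) (fun C K => ?_)
    all_goals simp only [LinearMap.sub_apply, LinearMap.add_apply, LinearMap.mulLeft_apply]
    · rw [lap_one, mul_one, zero_add, sub_self]
    · rw [lap_opF_coord hU]; abel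
    · rw [hE.lap_mul hF (hc C), lap_opF_coord hU, lap_opF_coord hU, br_coord_coord, hD.opE_eq,
        mul_sub (coord C), ← mul_assoc (coord C) (D 1), (hc C).comm hD.hp_one, mul_one, sub_mul]
      simp only [smul_mul_assoc, mul_assoc]
      have h1 := sg_mul_self (ε C)
      linear_combination (norm := module) h1 • (D 1 * (coord C * coord K))
  have := LinearMap.congr_fun key f
  simp only [LinearMap.sub_apply, LinearMap.add_apply, LinearMap.mulLeft_apply,
    LinearMap.zero_apply] at this
  exact sub_eq_zero.mp this

/-- The components of `Δ_F + ν` are determined by the operator. -/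
theorem components_unique (hU : IsUnit (opE D)) (hD : IsOddOp D)
    (hE : IsOddSkew E) (hF : IsConnParity F) {ν : SFun q N U}
    (h : ∀ f, D f = lap E F f + ν * f) : E = opE D ∧ F = opF D ∧ ν = D 1 := by
  have hν : D 1 = ν := by rw [h, lap_one, zero_add, mul_one]
  have hEE : opE D = E := by
    ext A B : 2
    rw [opE, Matrix.of_apply, antibracket_eq_br hE hF (hν ▸ hD.hp_one) h, br_coord_coord]
  refine ⟨hEE.symm, ?_, hν.symm⟩
  have h1 : ∀ B, ∑ A, (sg (ε A) • (F A - opF D A)) * opE D A B = 0 := by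
    intro B
    have h2 := h (coord B)
    have h3 := lap_opF_coord (D := D) hU B
    rw [h2, hν, add_sub_cancel_right, ← hEE, lap_coord_eq, lap_coord_eq, ← sub_eq_zero,
      ← Finset.sum_sub_distrib] at h3
    have h4 : ∑ A, (sg (ε A) • (F A - opF D A)) * opE D A B = (-2 : ℝ) •
        ∑ A, ((sg (ε A) / 2) • (pd A (opE D A B) + opF D A * opE D A B) -
          (sg (ε A) / 2) • (pd A (opE D A B) + F A * opE D A B)) := by
      rw [Finset.smul_sum]
      refine Finset.sum_congr rfl fun A _ => ?_
      rw [smul_mul_assoc, sub_mul]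
      module
    rw [h4, h3, smul_zero]
  funext A
  have h5 := eq_zero_of_sum_mul hU h1 A
  have h6 := congrArg (fun x => sg (ε A) • x) h5
  simp only [smul_smul, sg_mul_self, one_smul, smul_zero] at h6
  exact sub_eq_zero.mp h6

end Operators

section Nilpotent

variable {p q N : ℕ} {U V : Opens (Fin p → ℝ)}
variable {E : Matrix (Idx p q) (Idx p q) (SFun q N U)} {F : Idx p q → SFun q N U}
variable {ν : SFun q N U}

/-! ### Integrability and nilpotency on a superdomain -/

/-- The derivatives of a function, recovered from its antibrackets with the coordinates. -/
theorem pd_eq_sum_br (hU : IsUnit E) (ν : SFun q N U) (B : Idx p q) :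
    tw (ε B) (pd B ν) = ∑ A, br E ν (coord A) * lower E A B := by
  simp only [br_coord_right, Finset.sum_mul, mul_assoc]
  rw [Finset.sum_comm]
  simp only [← Finset.mul_sum, mul_lower hU]
  simp

/-- The antibracket is non-degenerate. -/
theorem pd_eq_zero_of_br_eq_zero (hU : IsUnit E) (h : ∀ f, br E ν f = 0) (B : Idx p q) :
    pd B ν = 0 := by
  have h1 := pd_eq_sum_br hU ν B
  simp only [h, zero_mul, Finset.sum_const_zero] at h1
  rw [← tw_tw_self (ε B) (pd B ν), h1, map_zero]

theorem lap_eq_zero_of_pd_eq_zero (h : ∀ B, pd B ν = 0) : lap E F ν = 0 := by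
  rw [lap_apply]
  simp [h]

/-- A flat connection is locally `∂ ln ρ`; this is stated as `r F_A = 2 ∂_A r` for `r = √ρ`. -/
theorem exists_sqrt_dlog (hp : IsConnParity F) (hF : IsFlatConn F) {x : Fin p → ℝ} (hx : x ∈ U) :
    ∃ (V : Opens (Fin p → ℝ)) (hV : V ≤ U), x ∈ V ∧ ∃ r : SFun q N V, IsDensity r ∧
      ∀ A, r * sres hV (F A) = (2 : ℝ) • pd A r := by
  obtain ⟨V, hV, hxV, ρ, hρ, hd⟩ := hF.exists_isDLog hp hx
  obtain ⟨r, hr, hrr⟩ := hρ.exists_sqrt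
  exact ⟨V, hV, hxV, r, hr, hd.sqrt hr hρ hrr⟩

theorem JacobiBr.sres (hJ : JacobiBr E) (hE : IsOddSkew E) (h : V ≤ U) :
    JacobiBr (E.map (sres h)) :=
  (hE.sres h).jacobiBr_iff.mpr ((hE.jacobiBr_iff.mp hJ).sres h)

/-- Given the Jacobi identity and the flatness of `F`, the square of `Δ_F` is the Hamiltonian
vector field of `ν_F`. -/
theorem lap_sq_eq (hE : IsOddSkew E) (hU : IsUnit E) (hp : IsConnParity F) (hJ : JacobiBr E)
    (hF : IsFlatConn F) (f : SFun q N U) : lap E F (lap E F f) = br E (nuF E F) f := by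
  refine SFun.ext_local fun x hx => ?_
  obtain ⟨V, hV, hxV, r, hr, h⟩ := exists_sqrt_dlog hp hF hx
  refine ⟨V, hV, hxV, ?_⟩
  rw [sres_lap, sres_lap, sres_br, sres_nuF hU]
  exact lap_sq_of_dlog (hE.sres hV) (isUnit_sres hU hV) (hp.sres hV) (hJ.sres hE hV) hr h _

theorem lap_nuF_eq_zero (hE : IsOddSkew E) (hU : IsUnit E) (hp : IsConnParity F) (hJ : JacobiBr E)
    (hF : IsFlatConn F) : lap E F (nuF E F) = 0 := by
  refine SFun.ext_local fun x hx => ?_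
  obtain ⟨V, hV, hxV, r, hr, h⟩ := exists_sqrt_dlog hp hF hx
  refine ⟨V, hV, hxV, ?_⟩
  rw [sres_lap, sres_nuF hU, map_zero]
  exact lap_nuF_of_dlog (hE.sres hV) (isUnit_sres hU hV) (hp.sres hV) (hJ.sres hE hV) hr h

/-- Two solutions of `Δ_F² = (ν, ·)` have the same derivatives. -/
theorem pd_sub_eq_zero {ν' : SFun q N U} (hU : IsUnit E) (h : ∀ f, lap E F (lap E F f) = br E ν f)
    (h' : ∀ f, lap E F (lap E F f) = br E ν' f) (B : Idx p q) : pd B (ν - ν') = 0 := by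
  refine pd_eq_zero_of_br_eq_zero hU (fun f => ?_) B
  rw [map_sub, LinearMap.sub_apply, ← h, ← h', sub_self]

/-- Every solution satisfies the zeroth-order condition: it has the same derivatives as `ν_F`. -/
theorem lap_eq_zero_of_lap_sq (hE : IsOddSkew E) (hU : IsUnit E) (hp : IsConnParity F)
    (hJ : JacobiBr E) (hF : IsFlatConn F) (h : ∀ f, lap E F (lap E F f) = br E ν f) :
    lap E F ν = 0 := by
  have h1 := lap_eq_zero_of_pd_eq_zero (E := E) (F := F)
    (pd_sub_eq_zero hU h (lap_sq_eq hE hU hp hJ hF))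
  rwa [map_sub, lap_nuF_eq_zero hE hU hp hJ hF, sub_zero] at h1

/-- An odd function with vanishing derivatives on a connected domain is an odd constant. -/
theorem exists_odd_const (hU : _root_.IsConnected (U : Set (Fin p → ℝ))) {f : SFun q N U}
    (hf : HP 1 f) (h : ∀ A, pd A f = 0) : ∃ c : Grass N, grassParity N c = -c ∧ f = sconst c := by
  obtain ⟨c, hc⟩ := exists_eq_sconst hU f h
  obtain ⟨x, hx⟩ := hU.nonempty
  refine ⟨c, sconst_injective (q := q) ⟨x, hx⟩ ?_, hc⟩
  rw [← parity_sconst, map_neg, ← hc, hf, sg_one, neg_smul, one_smul]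

/-- If `Δ_F²` is a Hamiltonian vector field, then `Δ_F` is a derivation of the antibracket. -/
theorem IsOddSkew.lap_br_of_lap_sq (hE : IsOddSkew E) (hF : IsConnParity F) (hν : HP 1 ν)
    (h : ∀ f, lap E F (lap E F f) = br E ν f) {a b : ℕ} {f g : SFun q N U} (hf : HP a f)
    (_ : HP b g) : lap E F (br E f g) = br E (lap E F f) g - sg a • br E f (lap E F g) := by
  have h1 := h (f * g)
  rw [hE.br_mul hν hf, ← h, ← h, hE.lap_mul hF hf, map_add, map_add, map_smul, map_smul,
    hE.lap_mul hF (hE.lap_hp hF hf), hE.lap_mul hF hf, sg_add, sg_one,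
    sg_even (n := (1 + 1) * a) ⟨a, by ring⟩, one_smul] at h1
  have ha := sg_mul_self a
  generalize sg a = s at ha h1 ⊢
  linear_combination (norm := module) s • h1 - ha • (lap E F (br E f g)) +
    (ha • br E (lap E F f) g) - (s • ha) • (f * lap E F (lap E F g))
    - (s • ha) • (br E f (lap E F g))

/-- If `Δ_F` is a derivation of the antibracket, then the Jacobi identity holds. -/
theorem IsOddSkew.jacobiBr_of_lap_br (hE : IsOddSkew E) (hF : IsConnParity F)
    (h : ∀ {a b : ℕ} {f g : SFun q N U}, HP a f → HP b g →
      lap E F (br E f g) = br E (lap E F f) g - sg a • br E f (lap E F g)) : JacobiBr E := by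
  intro a b c f g k hf hg hk
  rw [hE.jacobi_cyclic_eq hf hg hk]
  refine smul_eq_zero_of_right _ ?_
  have h1 := h hf (hg.mul hk)
  have hf' := hE.lap_hp hF hf
  rw [hE.br_mul hf hg, map_add, map_smul, hE.lap_mul hF (hE.br_hp hf hg), hE.lap_mul hF hg,
    hE.lap_mul hF hg, hE.br_mul hf' hg, map_add, map_add, map_smul, map_smul,
    hE.br_mul hf (hE.lap_hp hF hg), hE.br_mul hf hg, h hf hg, h hf hk] at h1
  have e1 : sg (a + b + 1) = -(sg a * sg b) := by rw [sg_add, sg_add, sg_one]; ring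
  have e2 : sg ((a + 1) * b) = sg (a * b) * sg b := by rw [← sg_add]; congr 1; ring
  have e3 : sg ((a + 1) * (b + 1)) = -(sg (a * b) * sg a * sg b) := by
    rw [← sg_add, ← sg_add, neg_sg]; congr 1; ring
  have e4 : sg ((a + 1 + 1) * b) = sg (a * b) := by
    rw [add_assoc, add_mul, sg_add, sg_even (n := (1 + 1) * b) (by simp [parity_simps]),
      mul_one]
  rw [e1, e2, e3, e4] at h1
  rw [e3]
  have ha := sg_mul_self a
  have hb := sg_mul_self b
  generalize sg a = s at ha h1 ⊢
  generalize sg b = t at hb h1 ⊢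
  generalize sg (a * b) = z at h1 ⊢
  simp only [sub_mul (α := SFun q N U), mul_sub g, smul_mul_assoc, mul_smul_comm, smul_sub,
    smul_add, smul_smul] at h1
  linear_combination (norm := module) (s * t) • h1
    - ((t * t) • ha + hb) • (br E f (br E g k)) + ((t * t) • ha + hb) • (br E (br E f g) k)
    - ((z * s * t) • hb) • (br E g (br E f k)) + ((s * t * z * t) • ha) • (lap E F g * br E f k)
    - ((s * t * z) • hb) • (g * br E (lap E F f) k)

/-- If `Δ_F` is a derivation of the antibracket, then `F` is flat. -/
theorem IsOddSkew.isFlatConn_of_lap_br (hE : IsOddSkew E) (hU : IsUnit E) (hF : IsConnParity F)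
    (hJ : JacobiBr E)
    (h : ∀ C K, lap E F (E C K) = br E (lap E F (coord C)) (coord K) -
      sg (ε C) • br E (coord C) (lap E F (coord K))) : IsFlatConn F := by
  have hpF : ∀ M A, HP (ε M + ε A) (pd M (F A)) := fun M A => HP.pd (hF A) M
  have hFc : ∀ A, HP (ε A) (F A) := hF
  -- the vector field `V = (-1)^{ε_A} F_A (Γ^A, ·) = 2 (Δ_F - Δ₁)`
  have hV : ∀ f, lap E F f = lap E 0 f +
      (1 / 2 : ℝ) • ∑ A, sg (ε A) • (F A * br E (coord A) f) := by
    intro f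
    rw [lap_eq_lap_zero_add, Finset.smul_sum]
    congr 1
    refine Finset.sum_congr rfl fun A _ => ?_
    rw [br_coord_left, Finset.mul_sum, smul_smul, Finset.smul_sum]
    refine Finset.sum_congr rfl fun B _ => ?_
    congr 1; ring
  -- `Δ₁` is a derivation of the antibracket as well, hence so is `V`
  have h1 : ∀ C K, ∑ A, sg (ε A) • (F A * br E (coord A) (E C K)) =
      br E (∑ A, sg (ε A) • (F A * E A C)) (coord K) -
      sg (ε C) • br E (coord C) (∑ A, sg (ε A) • (F A * E A K)) := by
    intro C K
    have h0 := h C K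
    have h0' := hE.lap_br hJ (hp_coord C) (coord K)
    rw [br_coord_coord] at h0'
    simp only [hV, map_add, map_smul, LinearMap.add_apply, LinearMap.smul_apply, h0',
      br_coord_coord] at h0
    linear_combination (norm := module) (2 : ℝ) • h0
  have h2 : ∀ A C K, br E (F A * E A C) (coord K) = F A * br E (E A C) (coord K) +
      ∑ M, sg (ε M * (ε M + ε C + 1)) • (pd M (F A) * (E A C * E M K)) := by
    intro A C K
    rw [br_coord_right, br_coord_right, Finset.mul_sum, ← Finset.sum_add_distrib]
    refine Finset.sum_congr rfl fun M _ => ?_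
    rw [(hFc A).pd_mul, map_add, map_smul, map_mul, map_mul, (hpF M A).tw, (hE.hp A C).tw,
      (hFc A).tw, add_mul (R := SFun q N U), add_comm]
    simp only [smul_mul_assoc, mul_smul_comm, smul_smul, mul_assoc (G := SFun q N U)]
    rw [sg_mul_self, one_smul]
    congr 2
    rw [← sg_add]
    apply sg_eq
    push_cast
    generalize (ε A : ZMod 2) = A', (ε C : ZMod 2) = C', (ε M : ZMod 2) = M'
    decide +revert
  -- by the Jacobi identity, only derivatives of `F` remain
  have h3 : ∀ C K, ∑ A, ∑ M, sg (ε A + ε M * (ε M + ε C + 1)) •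
      (pd M (F A) * (E A C * E M K)) -
      ∑ A, ∑ M, sg (ε C + ε A) • (E C M * (pd M (F A) * E A K)) = 0 := by
    intro C K
    have h0 := h1 C K
    have e1 : ∀ A, br E (coord A) (E C K) = br E (E A C) (coord K) +
        sg ((ε A + 1) * (ε C + 1)) • br E (coord C) (E A K) := fun A => by
      have := hJ.leibniz hE (hp_coord A) (hp_coord C) (coord K)
      simpa only [br_coord_coord] using this
    rw [← sub_eq_zero, ← neg_eq_zero] at h0
    rw [← h0, map_sum, map_sum, LinearMap.sum_apply, Finset.smul_sum, ← Finset.sum_sub_distrib,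
      ← Finset.sum_sub_distrib, ← Finset.sum_sub_distrib, ← Finset.sum_neg_distrib]
    refine Finset.sum_congr rfl fun A _ => ?_
    rw [e1, map_smul, map_smul, LinearMap.smul_apply, h2, hE.br_mul (hp_coord C) (hFc A),
      br_coord_left (g := F A)]
    have e2 : ∑ M, sg (ε A + ε M * (ε M + ε C + 1)) • (pd M (F A) * (E A C * E M K)) =
        sg (ε A) • ∑ M, sg (ε M * (ε M + ε C + 1)) • (pd M (F A) * (E A C * E M K)) := by
      rw [Finset.smul_sum]
      simp only [smul_smul, ← sg_add]
    have e3 : ∑ M, sg (ε C + ε A) • (E C M * (pd M (F A) * E A K)) =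
        (sg (ε C) * sg (ε A)) • ((∑ M, E C M * pd M (F A)) * E A K) := by
      rw [Finset.sum_mul, Finset.smul_sum]
      simp only [← sg_add, mul_assoc]
    have e4 : sg (ε A) * sg ((ε A + 1) * (ε C + 1)) =
        -(sg (ε C) * sg (ε A) * sg ((ε C + 1) * ε A)) := by
      simp only [← sg_add, neg_sg]
      apply sg_eq
      push_cast
      generalize (ε A : ZMod 2) = A', (ε C : ZMod 2) = C'
      decide +revert
    rw [e2, e3, mul_add (F A), mul_smul_comm]
    linear_combination (norm := module) e4 • (F A * br E (coord C) (E A K))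
  -- this is the curvature of `F`, with its indices raised
  have h4 : ∀ C K, ∑ A, (∑ M, E C M * (sg (ε C + ε A) •
      (pd M (F A) - sg (ε M * ε A) • pd A (F M)))) * E A K = 0 := by
    intro C K
    rw [← neg_eq_zero, ← h3 C K]
    rw [Finset.sum_comm, ← Finset.sum_neg_distrib, ← Finset.sum_sub_distrib]
    refine Finset.sum_congr rfl fun A _ => ?_
    rw [Finset.sum_mul, ← Finset.sum_neg_distrib, ← Finset.sum_sub_distrib]
    refine Finset.sum_congr rfl fun M _ => ?_
    rw [← mul_assoc (pd A (F M)), (hpF A M).comm (hE.hp M C), hE.2 M C]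
    simp only [smul_sub, smul_smul, mul_sub (E C M), sub_mul (α := SFun q N U), mul_smul_comm,
      smul_mul_assoc, mul_assoc (G := SFun q N U), neg_sub, ← neg_smul]
    congr 2
    simp only [← sg_add, neg_sg]
    apply sg_eq
    push_cast
    generalize (ε A : ZMod 2) = A', (ε C : ZMod 2) = C', (ε M : ZMod 2) = M'
    decide +revert
  intro M A
  refine eq_zero_of_sum_mul_left hU (y := fun M => pd M (F A) - sg (ε M * ε A) • pd A (F M))
    (fun C => ?_) M
  have h5 := eq_zero_of_sum_mul hU (h4 C) A
  simp only [mul_smul_comm, ← Finset.smul_sum] at h5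
  have h6 := congrArg (fun x => sg (ε C + ε A) • x) h5
  simpa only [smul_smul, sg_mul_self, one_smul, smul_zero] using h6

/-- The nilpotency conditions on a superdomain. The condition `Δ_F ν = 0`, which the square of
`Δ_F + ν` contributes besides these, follows from them. -/
theorem IsOddSkew.sq_eq_zero_iff (hE : IsOddSkew E) (hU : IsUnit E) (hF : IsConnParity F)
    (hν : HP 1 ν) :
    (∀ f, lap E F (lap E F f + ν * f) + ν * (lap E F f + ν * f) = 0) ↔
      JacobiBr E ∧ IsFlatConn F ∧ ∀ f, lap E F (lap E F f) = br E ν f := by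
  simp only [hE.lap_add_sq hF hν]
  constructor
  · intro h
    have h0 : lap E F ν = 0 := by
      have h1 := h 1
      have : br E ν 1 = 0 := by rw [← map_one sconst]; exact br_sconst_right _ _
      rwa [lap_one, map_zero, this, sub_zero, zero_add, mul_one] at h1
    have h1 : ∀ f, lap E F (lap E F f) = br E ν f := fun f => by
      have := h f
      rw [h0, zero_mul, add_zero] at this
      exact sub_eq_zero.mp this
    have hJ := hE.jacobiBr_of_lap_br hF fun hf hg => hE.lap_br_of_lap_sq hF hν h1 hf hg
    refine ⟨hJ, hE.isFlatConn_of_lap_br hU hF hJ fun C K => ?_, h1⟩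
    have := hE.lap_br_of_lap_sq hF hν h1 (hp_coord C) (hp_coord K)
    rwa [br_coord_coord] at this
  · rintro ⟨hJ, hflat, h⟩ f
    rw [h, lap_eq_zero_of_lap_sq hE hU hF hJ hflat h, zero_mul, sub_self, add_zero]

end Nilpotent

section Curves

variable {p q N K : ℕ} {U : Opens (Fin p → ℝ)}
variable {E : Matrix (Idx p q) (Idx p q) (SFun q N U)} {F : Idx p q → SFun q N U}

/-! ### Contour integrals -/

/-- The fundamental theorem of calculus. -/
theorem lineInt_pd (f : SFun 0 K line) :
    lineInt (pd (Sum.inl 0) f) = evalAt (linePt 1) f - evalAt (linePt 0) f := by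
  induction f using SFun.induction with
  | tmul f l =>
    have h : ∫ t in (0 : ℝ)..1, (smoothPd line 0 f).1 (linePt t) =
        f.1 (linePt 1) - f.1 (linePt 0) := by
      refine intervalIntegral.integral_eq_sub_of_hasDerivAt (f := fun t => f.1 (linePt t))
        (f' := fun t => (smoothPd line 0 f).1 (linePt t)) (fun t _ => ?_)
        ((continuous_line _).intervalIntegrable _ _)
      have h1 := (ext0_differentiableAt f (linePt t)).hasFDerivAt
      have h2 : HasDerivAt (fun t : ℝ => (linePt t).1) (Pi.single 0 1) t := by
        rw [hasDerivAt_pi]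
        intro i
        rw [Subsingleton.elim i 0, Pi.single_eq_same]
        exact hasDerivAt_id t
      have h3 := h1.comp_hasDerivAt t h2
      refine h3.congr_of_eventuallyEq (Filter.Eventually.of_forall fun s => ?_)
      exact (ext0_apply f.1 (x := (linePt s).1) trivial).symm
    rw [pd_inl_tm, evalAt_tm, evalAt_tm, ← sub_smul, ← h]
    rfl
  | add x y hx hy => rw [map_add, map_add, hx, hy, map_add, map_add]; abel

/-- The chain rule along a curve of superpoints. -/
theorem SuperCurve.pd_pull (γ : SuperCurve q N U K) (f : SFun q N U) :
    pd (Sum.inl 0) (γ.pull f) =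
      ∑ B, pd (Sum.inl 0) (γ.pull (coord B)) * γ.pull (pd B f) := by
  have hpull : ∀ {a : ℕ} {f : SFun q N U}, HP a f → HP a (γ.pull f) := fun {a f} hf => by
    rw [HP, HasParity, ← γ.pull_parity, hf, map_smul]
  have hd : ∀ B, HP (ε B) (pd (Sum.inl 0 : Idx 1 0) (γ.pull (coord B))) := fun B =>
    ((hpull (hp_coord B)).pd _).congr (by simp [ε])
  have key : (pd (Sum.inl 0 : Idx 1 0)) ∘ₗ γ.pull.toLinearMap -
      ∑ B, LinearMap.mulLeft ℝ (pd (Sum.inl 0 : Idx 1 0) (γ.pull (coord B))) ∘ₗ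
        γ.pull.toLinearMap ∘ₗ pd B = 0 := by
    refine derivation_eq_zero γ.pull γ.pull _ (fun f => ?_) (fun f => rfl) (fun f g => ?_)
      (fun A => ?_) fun c => ?_
    · rw [← γ.pull_parity, parity_ofSmooth]
    · simp only [LinearMap.sub_apply, LinearMap.sum_apply, LinearMap.comp_apply,
        LinearMap.mulLeft_apply, AlgHom.toLinearMap_apply]
      have h1 : pd (Sum.inl 0 : Idx 1 0) (γ.pull (f * g)) =
          pd (Sum.inl 0) (γ.pull f) * γ.pull g + γ.pull f * pd (Sum.inl 0) (γ.pull g) := by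
        rw [map_mul, pd_mul]; rfl
      have h2 : ∀ B, pd (Sum.inl 0 : Idx 1 0) (γ.pull (coord B)) * γ.pull (pd B (f * g)) =
          pd (Sum.inl 0 : Idx 1 0) (γ.pull (coord B)) * γ.pull (pd B f) * γ.pull g +
          γ.pull f * (pd (Sum.inl 0 : Idx 1 0) (γ.pull (coord B)) * γ.pull (pd B g)) := by
        intro B
        have ht : ∀ n, γ.pull (tw n f) = tw n (γ.pull f) := by
          intro n
          induction n with
          | zero => rfl
          | succ n ih => rw [add_comm, tw_add, tw_add, tw_one, tw_one, γ.pull_parity, ih]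
        rw [pd_mul, map_add, map_mul, map_mul, mul_add (R := SFun 0 K line), ht, ← mul_assoc,
          ← mul_assoc, (hd B).mul_eq_tw (tw (ε B) (γ.pull f)), tw_tw_self, mul_assoc (γ.pull f)]
      simp only [h1, h2, Finset.sum_add_distrib, sub_mul (α := SFun 0 K line), mul_sub (γ.pull f),
        Finset.sum_mul, Finset.mul_sum]
      abel
    · simp only [LinearMap.sub_apply, LinearMap.sum_apply, LinearMap.comp_apply,
        LinearMap.mulLeft_apply, AlgHom.toLinearMap_apply, pd_coord]
      rw [Finset.sum_eq_single A (fun B _ hB => by rw [if_neg hB, map_zero, mul_zero]) (by simp),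
        if_pos rfl, map_one, mul_one, sub_self]
    · simp [pd_sconst, γ.pull_const]
  have := LinearMap.congr_fun key f
  simpa only [LinearMap.sub_apply, LinearMap.sum_apply, LinearMap.comp_apply,
    LinearMap.mulLeft_apply, AlgHom.toLinearMap_apply, LinearMap.zero_apply, sub_eq_zero] using this

/-- Odd solutions of `Δ_F² = (ν, ·)` are given by contour integrals. -/
theorem SuperCurve.value_eq (γ : SuperCurve q N U K) (hU : IsUnit E) {ν : SFun q N U}
    (hν : HP 1 ν) (h : ∀ f, lap E F (lap E F f) = br E ν f) :
    γ.value 1 ν = γ.value 0 ν +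
      γ.integral fun B => ∑ A, lap E F (lap E F (coord A)) * lower E A B := by
  have h1 : ∀ B, ∑ A, lap E F (lap E F (coord A)) * lower E A B = pd B ν := by
    intro B
    simp only [h, ← pd_eq_sum_br hU]
    rw [(hν.pd B).tw, sg_even, one_smul]
    rcases ε_cases B with hB | hB <;> rw [hB] <;> decide
  have h2 : ∀ B, γ.pull (pd B ν) * pd (Sum.inl 0 : Idx 1 0) (γ.pull (coord B)) =
      pd (Sum.inl 0 : Idx 1 0) (γ.pull (coord B)) * γ.pull (pd B ν) := by
    intro B
    have hpull : ∀ {a : ℕ} {f : SFun q N U}, HP a f → HP a (γ.pull f) := fun {a f} hf => by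
      rw [HP, HasParity, ← γ.pull_parity, hf, map_smul]
    rw [(hpull (hν.pd B)).comm ((hpull (hp_coord B)).pd _), sg_even, one_smul]
    rcases ε_cases B with hB | hB <;> rw [hB] <;> simp [ε]
  rw [SuperCurve.integral, SuperCurve.value, SuperCurve.value]
  simp only [h1, h2]
  rw [← γ.pd_pull, lineInt_pd]
  abel

end Curves

/-! ### Charts of a supermanifold and locality -/

namespace SuperSpace

variable {N p q : ℕ} {M : SuperSpace.{u} N}

open CategoryTheory in
theorem res_res {V W Y : Opens M.X} (h : V ≤ W) (h' : W ≤ Y) (f : M.Fn Y) :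
    M.res h (M.res h' f) = M.res (h.trans h') f := by
  have e : (CategoryTheory.homOfLE (h.trans h')).op =
      (CategoryTheory.homOfLE h').op ≫ (CategoryTheory.homOfLE h).op := rfl
  simp only [res]
  rw [e, CategoryTheory.Functor.map_comp]
  rfl

theorem res_refl {W : Opens M.X} (f : M.Fn W) : M.res le_rfl f = f := by
  have e : (CategoryTheory.homOfLE (le_refl W)).op = CategoryTheory.CategoryStruct.id _ := rfl
  simp only [res]
  rw [e, CategoryTheory.Functor.map_id]
  rfl

/-- Restriction between equal open sets. -/
def resEquiv {V W : Opens M.X} (h : V = W) : M.Fn W ≃ₐ[ℝ] M.Fn V :=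
  AlgEquiv.ofAlgHom (M.res h.le) (M.res h.ge)
    (AlgHom.ext fun f => (res_res _ _ f).trans (res_refl f))
    (AlgHom.ext fun f => (res_res _ _ f).trans (res_refl f))

theorem resEquiv_apply {V W : Opens M.X} (h : V = W) (f : M.Fn W) :
    resEquiv h f = M.res h.le f := rfl

/-- Functions that agree locally are equal. -/
theorem fn_ext_local {W : Opens M.X} {f g : M.Fn W}
    (h : ∀ x ∈ W, ∃ (V : Opens M.X) (hV : V ≤ W), x ∈ V ∧ M.res hV f = M.res hV g) : f = g := by
  choose V hV hxV hfg using h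
  exact M.sheaf.eq_of_locally_eq' (fun x : W => V x.1 x.2) W
    (fun x => CategoryTheory.homOfLE (hV x.1 x.2))
    (fun x hx => Opens.mem_iSup.mpr ⟨⟨x, hx⟩, hxV x hx⟩) f g fun x => hfg x.1 x.2

namespace Chart

/-- The coordinate domain, as an open subset of the space. -/
def dom (κ : M.Chart p q) : Opens M.X := openImage κ.emb κ.tgt

/-- The coordinate expression of a function on the coordinate domain. -/
def read (κ : M.Chart p q) : M.Fn κ.dom ≃ₐ[ℝ] SFun q N κ.tgt := κ.iso κ.tgt le_rfl

theorem read_par (κ : M.Chart p q) (f : M.Fn κ.dom) : κ.read (M.par _ f) = parity (κ.read f) :=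
  κ.iso_par κ.tgt le_rfl f

theorem read_const (κ : M.Chart p q) (c : Grass N) : κ.read (M.const _ c) = sconst c :=
  κ.iso_const κ.tgt le_rfl c

theorem hp_read (κ : M.Chart p q) {a : ℕ} {f : M.Fn κ.dom} (hf : HasParity (M.par _) a f) :
    HP a (κ.read f) := by
  rw [HP, HasParity, ← read_par, hf, map_smul]

theorem hasParity_read_symm (κ : M.Chart p q) {a : ℕ} {f : SFun q N κ.tgt} (hf : HP a f) :
    HasParity (M.par _) a (κ.read.symm f) := by
  apply κ.read.injective
  rw [read_par, map_smul, κ.read.apply_symm_apply]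
  exact hf

/-- The restriction of a coordinate system to an open subset of its range. -/
def restrict (κ : M.Chart p q) (V : Opens (Fin p → ℝ)) (hV : V ≤ κ.tgt) : M.Chart p q :=
  have hemb : Topology.IsOpenEmbedding fun y : V => κ.toX ⟨y.1, hV y.2⟩ :=
    κ.emb.comp (Opens.isOpenEmbedding_of_le hV)
  have e : ∀ V', V' ≤ V → openImage κ.emb V' = openImage hemb V' := fun V' hV' => by
    ext x
    constructor
    · rintro ⟨y, hy, rfl⟩
      exact ⟨⟨y.1, hV' hy⟩, hy, rfl⟩
    · rintro ⟨y, hy, rfl⟩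
      exact ⟨⟨y.1, hV y.2⟩, hy, rfl⟩
  { tgt := V
    toX := fun y => κ.toX ⟨y.1, hV y.2⟩
    emb := hemb
    iso := fun V' hV' => (resEquiv (e V' hV')).trans (κ.iso V' (hV'.trans hV))
    iso_res := fun h hW f => by
      rw [AlgEquiv.trans_apply, AlgEquiv.trans_apply, resEquiv_apply, resEquiv_apply,
        ← κ.iso_res h, res_res, res_res]
    iso_par := fun V' hV' f => by
      rw [AlgEquiv.trans_apply, AlgEquiv.trans_apply, resEquiv_apply, resEquiv_apply,
        ← κ.iso_par]
      exact congrArg _ (M.res_par _ f)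
    iso_const := fun V' hV' c => by
      rw [AlgEquiv.trans_apply, resEquiv_apply, ← κ.iso_const _ (hV'.trans hV)]
      exact congrArg _ (M.res_const _ c) }

theorem const_injective (κ : M.Chart p q) (hκ : (κ.tgt : Set (Fin p → ℝ)).Nonempty) :
    Function.Injective (M.const κ.dom) := by
  obtain ⟨x, hx⟩ := hκ
  intro c c' h
  have := congrArg κ.read h
  rw [read_const, read_const] at this
  exact sconst_injective (q := q) ⟨x, hx⟩ this

end Chart

end SuperSpace

namespace SuperManifold

variable {p q N : ℕ} {M : SuperManifold.{u} p q N}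

open SuperSpace

/-- Coordinate systems with connected domain form a basis of the topology. -/
theorem exists_chart_le {W : Opens M.X} {x : M.X} (hx : x ∈ W) :
    ∃ κ : M.Chart, x ∈ κ.dom ∧ κ.dom ≤ W ∧ _root_.IsConnected (κ.tgt : Set (Fin p → ℝ)) := by
  obtain ⟨κ, y, rfl⟩ := M.exists_chart x
  have hopen : IsOpen (Subtype.val '' (κ.toX ⁻¹' (W : Set M.X))) :=
    κ.tgt.isOpen.isOpenMap_subtype_val _ (W.isOpen.preimage κ.emb.continuous)
  obtain ⟨r, hr, hball⟩ := Metric.isOpen_iff.mp hopen y.1 ⟨y, hx, rfl⟩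
  have hV : (⟨Metric.ball y.1 r, Metric.isOpen_ball⟩ : Opens (Fin p → ℝ)) ≤ κ.tgt := by
    intro z hz
    obtain ⟨w, -, rfl⟩ := hball hz
    exact w.2
  refine ⟨κ.restrict _ hV, ⟨⟨y.1, Metric.mem_ball_self hr⟩, Metric.mem_ball_self hr, rfl⟩, ?_,
    (convex_ball _ _).isConnected ⟨y.1, Metric.mem_ball_self hr⟩⟩
  rintro _ ⟨z, -, rfl⟩
  obtain ⟨w, hw, hwz⟩ := hball z.2
  have : (⟨z.1, hV z.2⟩ : κ.tgt) = w := Subtype.ext hwz.symm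
  exact (congrArg κ.toX this ▸ hw : κ.toX ⟨z.1, hV z.2⟩ ∈ W)

/-- Functions with the same coordinate expressions are equal. -/
theorem fn_ext {W : Opens M.X} {f g : M.Fn W}
    (h : ∀ (κ : M.Chart) (hκ : κ.dom ≤ W), κ.read (M.res hκ f) = κ.read (M.res hκ g)) : f = g := by
  refine SuperSpace.fn_ext_local fun x hx => ?_
  obtain ⟨κ, hxκ, hκ, -⟩ := M.exists_chart_le hx
  exact ⟨κ.dom, hκ, hxκ, κ.read.injective (h κ hκ)⟩

/-- On a connected supermanifold, a function all of whose coordinate derivatives vanish is a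
constant. -/
theorem exists_eq_const [ConnectedSpace M.X] {d : M.Fn ⊤}
    (h : ∀ (κ : M.Chart) A, pd A (κ.read (M.res le_top d)) = 0) : ∃ c, d = M.const ⊤ c := by
  have h1 : ∀ x : M.X, ∃ (c : Grass N) (W : Opens M.X), x ∈ W ∧
      M.res le_top d = M.const W c := by
    intro x
    obtain ⟨κ, hxκ, -, hκ⟩ := M.exists_chart_le (Opens.mem_top x)
    obtain ⟨c, hc⟩ := exists_eq_sconst hκ _ (h κ)
    refine ⟨c, κ.dom, hxκ, κ.read.injective ?_⟩
    rw [hc, κ.read_const]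
  choose c W hxW hW using h1
  -- the constants at `x` and `y` agree on a chart inside the intersection of `W x` and `W y`
  have hloc : ∀ x, ∀ y ∈ W x, c y = c x := by
    intro x y hy
    obtain ⟨κ, -, hκ, hc⟩ := M.exists_chart_le (W := W x ⊓ W y) (x := y) ⟨hy, hxW y⟩
    refine κ.const_injective hc.nonempty ?_
    have e : ∀ z (hz : κ.dom ≤ W z), M.const κ.dom (c z) = M.res le_top d := fun z hz => by
      rw [← res_res hz le_top, hW z]
      exact (M.res_const hz (c z)).symm
    rw [e y (hκ.trans inf_le_right), e x (hκ.trans inf_le_left)]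
  have hlc : IsLocallyConstant c := (IsLocallyConstant.iff_exists_open c).mpr fun x =>
    ⟨W x, (W x).isOpen, hxW x, hloc x⟩
  obtain ⟨x₀⟩ := (inferInstance : Nonempty M.X)
  refine ⟨c x₀, SuperSpace.fn_ext_local fun x _ => ⟨W x, le_top, hxW x, ?_⟩⟩
  rw [hW x, hlc.apply_eq_of_preconnectedSpace x x₀]
  exact (M.res_const le_top _).symm

end SuperManifold

/-! ### Operators in coordinates -/

namespace SuperManifold

variable {p q N : ℕ} {M : SuperManifold.{u} p q N} {Δ : M.Operator}

open SuperSpace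

namespace Operator

theorem read_app (κ : M.Chart) (f : M.Fn κ.dom) :
    κ.read (Δ.app _ f) = Δ.inChart κ (κ.read f) := by
  have : (κ.iso κ.tgt le_rfl).symm (κ.iso κ.tgt le_rfl f) = f := AlgEquiv.symm_apply_apply _ f
  exact congrArg (fun g => κ.read (Δ.app _ g)) this.symm

theorem IsOdd.inChart (hodd : Δ.IsOdd) (κ : M.Chart) : IsOddOp (Δ.inChart κ) := by
  intro f
  obtain ⟨f, rfl⟩ := κ.read.surjective f
  rw [← read_app, ← κ.read_par, ← κ.read_par, ← read_app, hodd, map_neg]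

theorem res_nu {V W : Opens M.X} (h : V ≤ W) : M.res h (Δ.nu W) = Δ.nu V := by
  rw [nu, nu, Δ.app_res, map_one]

theorem read_nu (κ : M.Chart) : κ.read (Δ.nu κ.dom) = Δ.inChart κ 1 := by
  rw [nu, read_app, map_one]

theorem lapF_apply {W : Opens M.X} (f : M.Fn W) : Δ.lapF W f = Δ.app W f - Δ.nu W * f := rfl

theorem res_lapF {V W : Opens M.X} (h : V ≤ W) (f : M.Fn W) :
    M.res h (Δ.lapF W f) = Δ.lapF V (M.res h f) := by
  rw [lapF_apply, lapF_apply, map_sub, map_mul, res_nu, Δ.app_res]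

theorem res_bracket {V W : Opens M.X} (h : V ≤ W) (f g : M.Fn W) :
    M.res h (Δ.bracket f g) = Δ.bracket (M.res h f) (M.res h g) := by
  have hp : ∀ f, M.res h (M.par W f) = M.par V (M.res h f) := M.res_par h
  simp only [bracket, antibracket, map_add, map_sub, map_mul, Δ.app_res, hp, map_one]

theorem isOddSkew_E (hodd : Δ.IsOdd) (κ : M.Chart) : IsOddSkew (Δ.E κ) :=
  (hodd.inChart κ).opE_isOddSkew

theorem isConnParity_F (hodd : Δ.IsOdd) (hnd : Δ.IsNondegenerate) (κ : M.Chart) :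
    IsConnParity (Δ.F κ) :=
  (hodd.inChart κ).opF_isConnParity (hnd κ)

theorem inChart_apply (hodd : Δ.IsOdd) (h2 : Δ.IsSecondOrder) (hnd : Δ.IsNondegenerate)
    (κ : M.Chart) (f : SFun q N κ.tgt) :
    Δ.inChart κ f = lap (Δ.E κ) (Δ.F κ) f + Δ.inChart κ 1 * f :=
  (hodd.inChart κ).eq_lap_add (h2 κ) (hnd κ) f

theorem antibracket_inChart (hodd : Δ.IsOdd) (h2 : Δ.IsSecondOrder) (hnd : Δ.IsNondegenerate)
    (κ : M.Chart) (f g : SFun q N κ.tgt) :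
    antibracket parity (Δ.inChart κ) f g = br (Δ.E κ) f g :=
  antibracket_eq_br (isOddSkew_E hodd κ) (isConnParity_F hodd hnd κ) (hodd.inChart κ).hp_one
    (inChart_apply hodd h2 hnd κ) f g

theorem read_lapF (hodd : Δ.IsOdd) (h2 : Δ.IsSecondOrder) (hnd : Δ.IsNondegenerate)
    (κ : M.Chart) (f : M.Fn κ.dom) :
    κ.read (Δ.lapF _ f) = lap (Δ.E κ) (Δ.F κ) (κ.read f) := by
  rw [lapF_apply, map_sub, map_mul, read_nu, read_app, inChart_apply hodd h2 hnd,
    add_sub_cancel_right]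

theorem read_bracket (hodd : Δ.IsOdd) (h2 : Δ.IsSecondOrder) (hnd : Δ.IsNondegenerate)
    (κ : M.Chart) (f g : M.Fn κ.dom) :
    κ.read (Δ.bracket f g) = br (Δ.E κ) (κ.read f) (κ.read g) := by
  rw [← antibracket_inChart hodd h2 hnd]
  have hp : ∀ f, κ.read (M.par _ f) = parity (κ.read f) := κ.read_par
  simp only [bracket, antibracket, map_add, map_sub, map_mul, read_app, hp, map_one]

theorem isNilpotent_iff : Δ.IsNilpotent ↔
    ∀ (κ : M.Chart) (f : SFun q N κ.tgt), Δ.inChart κ (Δ.inChart κ f) = 0 := by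
  constructor
  · intro h κ f
    obtain ⟨f, rfl⟩ := κ.read.surjective f
    rw [← read_app, ← read_app, h, map_zero]
  · intro h W f
    refine fn_ext fun κ hκ => ?_
    rw [Δ.app_res, Δ.app_res, read_app, read_app, h, map_zero, map_zero]

theorem jacobi_iff (hodd : Δ.IsOdd) (h2 : Δ.IsSecondOrder) (hnd : Δ.IsNondegenerate) :
    Δ.Jacobi ↔ ∀ κ : M.Chart, JacobiBr (Δ.E κ) := by
  constructor
  · intro h κ a b c f g k hf hg hk
    have := congrArg κ.read (h κ.dom a b c _ _ _ (κ.hasParity_read_symm hf)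
      (κ.hasParity_read_symm hg) (κ.hasParity_read_symm hk))
    simpa only [map_add, map_smul, read_bracket hodd h2 hnd, κ.read.apply_symm_apply,
      map_zero] using this
  · intro h W a b c f g k hf hg hk
    refine fn_ext fun κ hκ => ?_
    have hp : ∀ {a : ℕ} {f : M.Fn W}, HasParity (M.par W) a f → HP a (κ.read (M.res hκ f)) :=
      fun {a f} hf => κ.hp_read <| by
        have e : M.res hκ (M.par W f) = M.par _ (M.res hκ f) := M.res_par hκ f
        rw [HasParity, ← e, hf, map_smul]
    have := h κ a b c _ _ _ (hp hf) (hp hg) (hp hk)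
    simpa only [map_add, map_smul, res_bracket, read_bracket hodd h2 hnd, map_zero] using this

theorem nuEq_iff (hodd : Δ.IsOdd) (h2 : Δ.IsSecondOrder) (hnd : Δ.IsNondegenerate)
    {ν : M.Fn ⊤} : Δ.NuEq ν ↔ ∀ (κ : M.Chart) (f : SFun q N κ.tgt),
      lap (Δ.E κ) (Δ.F κ) (lap (Δ.E κ) (Δ.F κ) f) =
        br (Δ.E κ) (κ.read (M.res le_top ν)) f := by
  constructor
  · intro h κ f
    obtain ⟨f, rfl⟩ := κ.read.surjective f
    rw [← read_bracket hodd h2 hnd, ← h, read_lapF hodd h2 hnd, read_lapF hodd h2 hnd]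
  · intro h W f
    refine fn_ext fun κ hκ => ?_
    rw [res_lapF, res_lapF, res_bracket, res_res, read_bracket hodd h2 hnd,
      read_lapF hodd h2 hnd, read_lapF hodd h2 hnd, h]

theorem jacobi_iff_eClosed (hodd : Δ.IsOdd) (h2 : Δ.IsSecondOrder) (hnd : Δ.IsNondegenerate) :
    Δ.Jacobi ↔ Δ.EClosed := by
  rw [jacobi_iff hodd h2 hnd]
  exact forall_congr' fun κ => (isOddSkew_E hodd κ).jacobiBr_iff.trans
    ((isOddSkew_E hodd κ).jacobiCoord_iff (hnd κ))

theorem isNilpotent_iff_jacobi (hodd : Δ.IsOdd) (h2 : Δ.IsSecondOrder)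
    (hnd : Δ.IsNondegenerate) :
    Δ.IsNilpotent ↔ Δ.Jacobi ∧ Δ.FFlat ∧ Δ.NuEq (Δ.nu ⊤) := by
  rw [isNilpotent_iff, jacobi_iff hodd h2 hnd, nuEq_iff hodd h2 hnd, FFlat, ← forall_and,
    ← forall_and]
  refine forall_congr' fun κ => ?_
  rw [res_nu, read_nu, ← (isOddSkew_E hodd κ).sq_eq_zero_iff (hnd κ)
    (isConnParity_F hodd hnd κ) (hodd.inChart κ).hp_one]
  refine forall_congr' fun f => ?_
  rw [inChart_apply hodd h2 hnd κ f, inChart_apply hodd h2 hnd κ (_ + _)]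

/-- Global odd solutions of `Δ_F² = (ν, ·)` differ by an odd constant. -/
theorem exists_eq_add_const [ConnectedSpace M.X] (hodd : Δ.IsOdd) (h2 : Δ.IsSecondOrder)
    (hnd : Δ.IsNondegenerate) {ν₁ ν₂ : M.Fn ⊤} (hp₁ : HasParity (M.par ⊤) 1 ν₁)
    (hp₂ : HasParity (M.par ⊤) 1 ν₂) (h₁ : Δ.NuEq ν₁) (h₂ : Δ.NuEq ν₂) :
    ∃ c : Grass N, grassParity N c = -c ∧ ν₁ = ν₂ + M.const ⊤ c := by
  rw [nuEq_iff hodd h2 hnd] at h₁ h₂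
  obtain ⟨c, hc⟩ := M.exists_eq_const (d := ν₁ - ν₂) fun κ A => by
    rw [map_sub, map_sub]
    exact pd_sub_eq_zero (hnd κ) (h₁ κ) (h₂ κ) A
  refine ⟨c, ?_, by rw [← hc, add_sub_cancel]⟩
  -- the parity of the constant is seen in any coordinate system
  obtain ⟨x⟩ := (inferInstance : Nonempty M.X)
  obtain ⟨κ, -, -, hκ⟩ := M.exists_chart_le (Opens.mem_top x)
  obtain ⟨y, hy⟩ := hκ.nonempty
  have e : sconst c = κ.read (M.res le_top (ν₁ - ν₂)) := by
    rw [hc, ← κ.read_const]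
    exact congrArg κ.read (M.res_const le_top c).symm
  have e' : M.par ⊤ (ν₁ - ν₂) = -(ν₁ - ν₂) := by
    rw [map_sub, hp₁, hp₂, ← smul_sub, sg_one, neg_smul, one_smul]
  refine sconst_injective (q := q) ⟨y, hy⟩ ?_
  have e'' : M.res le_top (M.par ⊤ (ν₁ - ν₂)) = M.par κ.dom (M.res le_top (ν₁ - ν₂)) :=
    M.res_par le_top _
  rw [← parity_sconst, map_neg, e, ← κ.read_par, ← e'', e', map_neg, map_neg]

end Operator

end SuperManifold

theorem nuRho_eq {p q N : ℕ} {U V : Opens (Fin p → ℝ)}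
    {E : Matrix (Idx p q) (Idx p q) (SFun q N U)} {F : Idx p q → SFun q N U} (hU : IsUnit E)
    (hV : V ≤ U) {r : SFun q N V} (hr : IsDensity r)
    (h : ∀ A, r * sres hV (F A) = (2 : ℝ) • pd A r) :
    nuRho (E.map (sres hV)) r = sres hV (nuF E F) := by
  rw [sres_nuF hU hV, nuRho, nuF, nuRho0_eq hr h]

end BV

end

theorem mainTheorem4 {p q N : ℕ} (M : BV.SuperManifold.{u} p q N) (Δ : M.Operator)
    (hodd : Δ.IsOdd) (h2 : Δ.IsSecondOrder) (hnd : Δ.IsNondegenerate) :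
    -- in every coordinate system `Δ = Δ_F + ν` with uniquely determined `E`, `F`, `ν`
    (∀ κ : M.Chart,
      (BV.IsOddSkew (Δ.E κ) ∧ BV.IsConnParity (Δ.F κ) ∧
        BV.HasParity BV.parity 1 (Δ.inChart κ 1) ∧
        ∀ f, Δ.inChart κ f = BV.lap (Δ.E κ) (Δ.F κ) f + Δ.inChart κ 1 * f) ∧
      ∀ E' F' ν', BV.IsOddSkew E' → BV.IsConnParity F' →
        (∀ f, Δ.inChart κ f = BV.lap E' F' f + ν' * f) →
          E' = Δ.E κ ∧ F' = Δ.F κ ∧ ν' = Δ.inChart κ 1) ∧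
    -- the three conditions for nilpotency
    (Δ.IsNilpotent ↔ Δ.Jacobi ∧ Δ.FFlat ∧ Δ.NuEq (Δ.nu ⊤)) ∧
    -- the Jacobi identity means that `E` is closed
    (Δ.Jacobi ↔ Δ.EClosed) ∧
    -- flatness means that locally `F = ∂ ln ρ`
    (∀ κ : M.Chart, BV.IsFlatConn (Δ.F κ) ↔
      ∀ x ∈ κ.tgt, ∃ (V : Opens (Fin p → ℝ)) (hV : V ≤ κ.tgt), x ∈ V ∧
        ∃ ρ : BV.SFun q N V, BV.IsDensity ρ ∧
          BV.IsDLog (fun A => BV.sres hV (Δ.F κ A)) ρ) ∧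
    -- where `F = ∂ ln ρ`, one has `Δ_F = Δ_ρ` and `ν_F = ν_ρ`
    (∀ (κ : M.Chart) (V : Opens (Fin p → ℝ)) (hV : V ≤ κ.tgt) (ρ : BV.SFun q N V),
      BV.IsDensity ρ → BV.IsDLog (fun A => BV.sres hV (Δ.F κ A)) ρ →
        BV.lap ((Δ.E κ).map (BV.sres hV)) (fun A => BV.sres hV (Δ.F κ A)) =
          BV.lapRho ((Δ.E κ).map (BV.sres hV)) ρ ∧
        (∃ r, BV.IsDensity r ∧ r * r = ρ) ∧
        ∀ r, BV.IsDensity r → r * r = ρ →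
          BV.nuRho ((Δ.E κ).map (BV.sres hV)) r = BV.sres hV (BV.nuF (Δ.E κ) (Δ.F κ))) ∧
    -- granted the first two conditions, the equation for `ν` is integrable in every coordinate
    -- system: its odd solutions are `ν_ρ` plus odd constants, they are given by the contour
    -- integral, and they satisfy the zeroth-order condition
    (Δ.Jacobi → Δ.FFlat →
      (∀ κ : M.Chart,
        BV.HasParity BV.parity 1 (BV.nuF (Δ.E κ) (Δ.F κ)) ∧
        (∀ c : BV.Grass N, BV.grassParity N c = -c →
          ∀ f, BV.lap (Δ.E κ) (Δ.F κ) (BV.lap (Δ.E κ) (Δ.F κ) f) =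
            BV.antibracket BV.parity (Δ.inChart κ)
              (BV.nuF (Δ.E κ) (Δ.F κ) + BV.sconst c) f) ∧
        ∀ ν' : BV.SFun q N κ.tgt, BV.HasParity BV.parity 1 ν' →
          (∀ f, BV.lap (Δ.E κ) (Δ.F κ) (BV.lap (Δ.E κ) (Δ.F κ) f) =
            BV.antibracket BV.parity (Δ.inChart κ) ν' f) →
          BV.lap (Δ.E κ) (Δ.F κ) ν' = 0 ∧
          (_root_.IsConnected (κ.tgt : Set (Fin p → ℝ)) →
            ∃ c : BV.Grass N, BV.grassParity N c = -c ∧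
              ν' = BV.nuF (Δ.E κ) (Δ.F κ) + BV.sconst c) ∧
          ∀ (K : ℕ) (γ : BV.SuperCurve q N κ.tgt K),
            γ.value 1 ν' = γ.value 0 ν' +
              γ.integral fun B => ∑ A, BV.lap (Δ.E κ) (Δ.F κ)
                (BV.lap (Δ.E κ) (Δ.F κ) (BV.coord A)) * BV.lower (Δ.E κ) A B) ∧
      -- globally: the zeroth-order condition, and uniqueness up to an odd constant
      (∀ ν' : M.Fn ⊤, BV.HasParity (M.par ⊤) 1 ν' → Δ.NuEq ν' →
        ∀ W, Δ.lapF W (M.res le_top ν') = 0) ∧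
      (ConnectedSpace M.X → ∀ ν₁ ν₂ : M.Fn ⊤,
        BV.HasParity (M.par ⊤) 1 ν₁ → BV.HasParity (M.par ⊤) 1 ν₂ →
        Δ.NuEq ν₁ → Δ.NuEq ν₂ →
          ∃ c : BV.Grass N, BV.grassParity N c = -c ∧ ν₁ = ν₂ + M.const ⊤ c)) ∧
    -- hence a nilpotent `Δ` is `Δ_ρ + ν_ρ` up to an odd constant
    (Δ.IsNilpotent → ∀ κ : M.Chart, _root_.IsConnected (κ.tgt : Set (Fin p → ℝ)) →
      ∃ c : BV.Grass N, BV.grassParity N c = -c ∧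
        ∀ f, Δ.inChart κ f = BV.lap (Δ.E κ) (Δ.F κ) f +
          (BV.nuF (Δ.E κ) (Δ.F κ) + BV.sconst c) * f) := by
  have hE := BV.SuperManifold.Operator.isOddSkew_E hodd
  have hF := BV.SuperManifold.Operator.isConnParity_F hodd hnd
  have happ := BV.SuperManifold.Operator.inChart_apply hodd h2 hnd
  have hbr := BV.SuperManifold.Operator.antibracket_inChart hodd h2 hnd
  have hJ := BV.SuperManifold.Operator.jacobi_iff hodd h2 hnd
  have hnil := BV.SuperManifold.Operator.isNilpotent_iff_jacobi hodd h2 hnd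
  refine ⟨fun κ => ⟨⟨hE κ, hF κ, (hodd.inChart κ).hp_one, happ κ⟩, fun E' F' ν' hE' hF' h =>
      BV.components_unique (hnd κ) (hodd.inChart κ) hE' hF' h⟩,
    hnil, BV.SuperManifold.Operator.jacobi_iff_eClosed hodd h2 hnd,
    fun κ => ⟨fun h x hx => h.exists_isDLog (hF κ) hx, BV.isFlatConn_of_local⟩,
    fun κ V hV ρ hρ h => ⟨h.lap_eq_lapRho hρ, hρ.exists_sqrt, fun r hr hrr =>
      BV.nuRho_eq (hnd κ) hV hr (h.sqrt hr hρ hrr)⟩,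
    fun hjac hflat => ⟨fun κ => ?_, fun ν' _ hν W => ?_, fun hconn ν₁ ν₂ hp₁ hp₂ h₁ h₂ => ?_⟩,
    fun h κ hκ => ?_⟩
  · have hsq := BV.lap_sq_eq (hE κ) (hnd κ) (hF κ) (hJ.mp hjac κ) (hflat κ)
    have hν := BV.nuF_hp (hE κ) (hnd κ) (hF κ)
    refine ⟨hν, fun c _ f => ?_, fun ν' hp h => ?_⟩
    · rw [hbr, map_add, LinearMap.add_apply, BV.br_sconst_left, add_zero, hsq]
    · simp only [hbr] at h
      refine ⟨BV.lap_eq_zero_of_lap_sq (hE κ) (hnd κ) (hF κ) (hJ.mp hjac κ) (hflat κ) h,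
        fun hκ => ?_, fun K γ => γ.value_eq (hnd κ) hp h⟩
      obtain ⟨c, hc, e⟩ := BV.exists_odd_const hκ (BV.HP.sub hp hν)
        (BV.pd_sub_eq_zero (hnd κ) h hsq)
      exact ⟨c, hc, by rw [← e, add_sub_cancel]⟩
  · refine BV.SuperManifold.fn_ext fun κ hκ => ?_
    rw [BV.SuperManifold.Operator.nuEq_iff hodd h2 hnd] at hν
    rw [BV.SuperManifold.Operator.res_lapF, BV.SuperSpace.res_res,
      BV.SuperManifold.Operator.read_lapF hodd h2 hnd, map_zero, map_zero]
    exact BV.lap_eq_zero_of_lap_sq (hE κ) (hnd κ) (hF κ) (hJ.mp hjac κ) (hflat κ) (hν κ)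
  · exact BV.SuperManifold.Operator.exists_eq_add_const hodd h2 hnd hp₁ hp₂ h₁ h₂
  · obtain ⟨hjac, hflat, hν⟩ := hnil.mp h
    rw [BV.SuperManifold.Operator.nuEq_iff hodd h2 hnd] at hν
    have hν := hν κ
    rw [BV.SuperManifold.Operator.res_nu, BV.SuperManifold.Operator.read_nu] at hν
    obtain ⟨c, hc, e⟩ := BV.exists_odd_const hκ
      (BV.HP.sub (hodd.inChart κ).hp_one (BV.nuF_hp (hE κ) (hnd κ) (hF κ)))
      (BV.pd_sub_eq_zero (hnd κ) hν
        (BV.lap_sq_eq (hE κ) (hnd κ) (hF κ) (hJ.mp hjac κ) (hflat κ)))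
    refine ⟨c, hc, fun f => ?_⟩
    rw [← e, add_sub_cancel]
    exact happ κ f
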